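/- Let $n\ge 1$, let $a^{(1)},\dots,a^{(N)}\in\mathbb Z^n$ generate $\mathbb Z^n$ as an abelian group, and let $A=\{a^{(1)},\dots,a^{(N)}\}$. Let $K=\mathbb C(\lambda)=\mathbb C(\lambda_1,\dots,\lambda_N)$, let $\bar{\mathcal D}=K\langle\partial_1,\dots,\partial_N\rangle$ (with $\partial_j=\partial/\partial\lambda_j$) be the ring of differential operators with coefficients in $K$, and let $L=\{l\in\mathbb Z^N : \sum_j l_ja^{(j)}=0\}$. For $\alpha\in\mathbb C^n$ put $$\Box_l=\prod_{l_j>0}\partial_j^{l_j}-\prod_{l_j<0}\partial_j^{-l_j}\ (l\in L),\qquad Z_{i,\alpha}=\sum_{j=1}^N a^{(j)}_i\lambda_j\partial_j-\alpha_i\ (1\le i\le n),$$ $$\bar{\mathcal M}_\alpha=\bar{\mathcal D}\Big/\Big(\sum_{l\in L}\bar{\mathcal D}\,\Box_l+\sum_{i=1}^n\bar{\mathcal D}\,Z_{i,\alpha}\Big).$$ Let $C(A)\subseteq\mathbb R^n$ be the real cone generated by $A$, and let $\ell_1,\dots,\ell_s$ be the linear forms with relatively prime integer coefficients which are $\ge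 0$ on $C(A)$ and define its faces of codimension one. Assume that $\alpha$ is nonresonant for $A$, i.e. $\ell_i(\alpha)\notin\mathbb Z$ for all $i$, and that $$f=\sum_{j=1}^N\lambda_jx^{a^{(j)}}=x_n\,g(x_1,\dots,x_{n-1}).$$ Let $\bar U$ be the open subset $g\ne 0$ of the torus over $K$ with coordinates $x_1,\dots,x_{n-1}$. For $\beta\in\mathbb C^n$ let $$\widetilde\nabla_\beta(\omega)=d\omega+\sum_{i=1}^{n-1}\beta_i\frac{dx_i}{x_i}\wedge\omega-\beta_n\frac{dg}{g}\wedge\omega$$ on the relative differential forms $\Omega^\bullet_{\bar U/K}$, and let $\bar{\mathcal D}$ act on this complex, and hence on its cohomology, so that $\partial_j$ acts as $\partial_j-\beta_n\,g^{\partial_j}/g$, where $\partial_j$ is applied to the coefficients of a form relative to the basis of exterior products of the $dx_i/x_i$ (with $\partial_j x_i=0$), and $g^{\partial_j}$ is $g$ with $\partial_j$ applied to its coefficients. Then there is an isomorphism of $\bar{\mathcal D}$-modules $$\bar{\mathcal M}_\alpha\;\cong\;H^{n-1}\big(\Omega^\bullet_{\bar U/K},\widetilde\nabla_{-\alpha}\big).$$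 If moreover $\alpha\in\mathbb Q^n$, then $\bar{\mathcal M}_\alpha$ comes from geometry, with an affine variety: there are a smooth affine variety $X$ over $K$ (not necessarily irreducible), a finite group $G$ acting on $X/K$, an irreducible complex representation $\chi$ of $G$ and an integer $i\ge 0$ such that $\bar{\mathcal M}_\alpha$ is isomorphic as a $\bar{\mathcal D}$-module to the $\chi$-isotypic component $H^i_{\rm DR}(X/K)^\chi$ (the sum of all $G$-submodules isomorphic to $\chi$), on which $\bar{\mathcal D}$ acts by the Gauss-Manin connection. -/

import Mathlib

noncomputable section

namespace AHyp

open scoped KaehlerDifferential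

/-! ### Algebraic differential forms -/

section Forms

variable (A B : Type) [CommRing A] [CommRing B] [Algebra A B]

/-- The algebra `Ω^•_{B/A} = ⨁ₖ ⋀ᵏ Ω_{B/A}` of relative differential forms. Its part of degree `k`
is the submodule `⋀[B]^k Ω[B⁄A]`. -/
abbrev Forms : Type := ExteriorAlgebra B (Ω[B⁄A])

/-- The relative `k`-forms `Ω^k_{B/A}`, regarded as an `A`-module. -/
def formsDeg (k : ℕ) : Submodule A (Forms A B) :=
  (⋀[B]^k (Ω[B⁄A])).restrictScalars A

variable {B}

/-- A function, as a form of degree `0`. -/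
def fn : B →+* Forms A B := algebraMap B (Forms A B)

/-- The form `dc` of degree `1` attached to a function `c`. -/
def dd : B →+ Forms A B where
  toFun c := ExteriorAlgebra.ι B (KaehlerDifferential.D A B c)
  map_zero' := by simp
  map_add' := by simp

variable {A}

theorem fn_def (b : B) : fn A b = algebraMap B (Forms A B) b := rfl

theorem dd_def (c : B) : dd A c = ExteriorAlgebra.ι B (KaehlerDifferential.D A B c) := rfl

theorem dd_sq (c : B) : dd A c * dd A c = 0 := ExteriorAlgebra.ι_sq_zero _

theorem dd_swap (b c : B) : dd A b * dd A c = -(dd A c * dd A b) :=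
  eq_neg_of_add_eq_zero_left (ExteriorAlgebra.ι_add_mul_swap _ _)

theorem fn_comm (b : B) (x : Forms A B) : fn A b * x = x * fn A b := Algebra.commutes b x

theorem dd_mul (b c : B) : dd A (b * c) = fn A b * dd A c + fn A c * dd A b := by
  simp [dd_def, fn_def, Algebra.smul_def]

theorem dd_base (a : A) : dd A (algebraMap A B a) = 0 := by
  simp [dd_def]

theorem smul_eq_fn_mul (a : A) (x : Forms A B) : a • x = fn A (algebraMap A B a) * x := by
  rw [fn_def, ← Algebra.smul_def, algebraMap_smul]

theorem kaehler_induction {P : Ω[B⁄A] → Prop} (D : ∀ c, P (KaehlerDifferential.D A B c))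
    (add : ∀ x y, P x → P y → P (x + y)) (smul : ∀ (b : B) x, P x → P (b • x)) (m : Ω[B⁄A]) :
    P m := by
  have hm : m ∈ Submodule.span B (Set.range (KaehlerDifferential.D A B)) := by
    rw [KaehlerDifferential.span_range_derivation]; trivial
  induction hm using Submodule.span_induction with
  | mem m h =>
    obtain ⟨c, rfl⟩ := h
    exact D c
  | zero => simpa using smul 0 _ (D 0)
  | add x y _ _ h h' => exact add _ _ h h'
  | smul b x _ h => exact smul _ _ h

/-- Every form is obtained from `1` by sums, multiplication by functions, and multiplication by
exact forms `dc`. -/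
theorem forms_induction {P : Forms A B → Prop} (one : P 1) (add : ∀ x y, P x → P y → P (x + y))
    (fn_mul : ∀ b x, P x → P (fn A b * x)) (dd_mul : ∀ c x, P x → P (dd A c * x)) (x : Forms A B) :
    P x := by
  induction x using CliffordAlgebra.left_induction with
  | algebraMap r => simpa [fn_def] using fn_mul r 1 one
  | add x y hx hy => exact add x y hx hy
  | ι_mul x m hx =>
    induction m using kaehler_induction with
    | D c => exact dd_mul c x hx
    | add m m' h h' => simpa [add_mul] using add _ _ h h'
    | smul b m h => simpa [fn_def, Algebra.smul_def, mul_assoc] using fn_mul b _ h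

theorem fn_mem (b : B) : fn A b ∈ formsDeg A B 0 := by
  change algebraMap B _ b ∈ (LinearMap.range (ExteriorAlgebra.ι B) : Submodule B (Forms A B)) ^ 0
  rw [pow_zero]
  exact Submodule.mem_one.2 ⟨b, rfl⟩

theorem fn_mul_mem {k : ℕ} (b : B) {x : Forms A B} (hx : x ∈ formsDeg A B k) :
    fn A b * x ∈ formsDeg A B k := by
  rw [fn_def, ← Algebra.smul_def]
  exact (⋀[B]^k (Ω[B⁄A])).smul_mem b hx

theorem ι_mul_mem {k : ℕ} (m : Ω[B⁄A]) {x : Forms A B} (hx : x ∈ formsDeg A B k) :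
    ExteriorAlgebra.ι B m * x ∈ formsDeg A B (k + 1) := by
  change _ ∈ (LinearMap.range (ExteriorAlgebra.ι B) : Submodule B (Forms A B)) ^ (k + 1)
  rw [pow_succ']
  exact Submodule.mul_mem_mul ⟨m, rfl⟩ hx

theorem dd_mul_mem {k : ℕ} (c : B) {x : Forms A B} (hx : x ∈ formsDeg A B k) :
    dd A c * x ∈ formsDeg A B (k + 1) := ι_mul_mem _ hx

/-- The graded version of `forms_induction`. -/
theorem formsDeg_induction {P : ℕ → Forms A B → Prop} (one : P 0 1)
    (add : ∀ k x y, P k x → P k y → P k (x + y))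
    (fn_mul : ∀ k b x, x ∈ formsDeg A B k → P k x → P k (fn A b * x))
    (dd_mul : ∀ k c x, x ∈ formsDeg A B k → P k x → P (k + 1) (dd A c * x)) {k : ℕ} {x : Forms A B}
    (hx : x ∈ formsDeg A B k) : P k x := by
  induction k generalizing x with
  | zero =>
    change x ∈ (LinearMap.range (ExteriorAlgebra.ι B) : Submodule B (Forms A B)) ^ 0 at hx
    rw [pow_zero] at hx
    obtain ⟨b, rfl⟩ := Submodule.mem_one.1 hx
    simpa [fn_def] using fn_mul 0 b 1 (by simpa using fn_mem (A := A) (1 : B)) one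
  | succ k ih =>
    change x ∈ (LinearMap.range (ExteriorAlgebra.ι B) : Submodule B (Forms A B)) ^ (k + 1) at hx
    rw [pow_succ'] at hx
    induction hx using Submodule.mul_induction_on' with
    | mem_mul_mem m hm n hn =>
      obtain ⟨m, rfl⟩ := hm
      have hn' := ih hn
      induction m using kaehler_induction with
      | D c => exact dd_mul k c n hn hn'
      | add m m' h h' => simpa [add_mul] using add _ _ _ h h'
      | smul b m h =>
        simpa [fn_def, Algebra.smul_def, mul_assoc] using fn_mul _ b _ (ι_mul_mem m hn) h
    | add x _ y _ hx hy => exact add _ _ _ hx hy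

/-- A derivation into a `B`-algebra all of whose values have square zero extends to an algebra
homomorphism on differential forms. -/
def liftFormsAlg {S : Type} [Ring S] [Algebra B S] [Module A S] [IsScalarTower A B S]
    (D : Derivation A B S) (hD : ∀ c, D c * D c = 0) : Forms A B →ₐ[B] S :=
  ExteriorAlgebra.lift B ⟨D.liftKaehlerDifferential, by
    have key : ∀ b c, D b * D c + D c * D b = 0 := by
      intro b c
      have h := hD (b + c)
      simp only [map_add, add_mul, mul_add, hD, zero_add, add_zero] at h
      exact (add_comm _ _).trans h
    have hanti : ∀ m n, D.liftKaehlerDifferential m * D.liftKaehlerDifferential n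
        + D.liftKaehlerDifferential n * D.liftKaehlerDifferential m = 0 := by
      intro m n
      induction m using kaehler_induction with
      | D b =>
        induction n using kaehler_induction with
        | D c => simp only [Derivation.liftKaehlerDifferential_comp_D, key]
        | add x y h h' => rw [map_add, add_mul, mul_add, add_add_add_comm, h, h', add_zero]
        | smul r x h => rw [map_smul, smul_mul_assoc, mul_smul_comm, ← smul_add, h, smul_zero]
      | add x y h h' => rw [map_add, add_mul, mul_add, add_add_add_comm, h, h', add_zero]
      | smul r x h => rw [map_smul, smul_mul_assoc, mul_smul_comm, ← smul_add, h, smul_zero]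
    intro m
    induction m using kaehler_induction with
    | D b => rw [Derivation.liftKaehlerDifferential_comp_D, hD]
    | add x y h h' =>
      rw [map_add, add_mul, mul_add, mul_add, h, h', zero_add, add_zero, hanti]
    | smul r x h => rw [map_smul, smul_mul_assoc, mul_smul_comm, h, smul_zero, smul_zero]⟩

theorem exists_liftForms {T : Type} [Ring T] (f : B →+* T) (δ : B →+ T)
    (hbase : ∀ a : A, δ (algebraMap A B a) = 0)
    (hmul : ∀ b c, δ (b * c) = f b * δ c + f c * δ b)
    (hcomm : ∀ b c, f b * δ c = δ c * f b)
    (hsq : ∀ c, δ c * δ c = 0) :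
    ∃ Φ : Forms A B →+* T, (∀ b, Φ (fn A b) = f b) ∧ ∀ c, Φ (dd A c) = δ c := by
  -- the values of `f` are central in the centralizer of the image of `f`
  let f' : B →+* Subring.centralizer (Set.range f) := f.codRestrict _ (by
    rintro b _ ⟨c, rfl⟩
    rw [← map_mul, ← map_mul, mul_comm])
  let _ : Algebra B (Subring.centralizer (Set.range f)) := f'.toAlgebra' (by
    rintro b ⟨s, hs⟩
    exact Subtype.ext (hs (f b) ⟨b, rfl⟩))
  let _ : Module A (Subring.centralizer (Set.range f)) := Module.compHom _ (algebraMap A B)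
  have _ : IsScalarTower A B (Subring.centralizer (Set.range f)) := ⟨fun a b s => by
    rw [Algebra.smul_def a b]; exact mul_smul (algebraMap A B a) b s⟩
  let D : Derivation A B (Subring.centralizer (Set.range f)) := Derivation.mk'
    { toFun := fun c => ⟨δ c, by rintro _ ⟨b, rfl⟩; exact hcomm b c⟩
      map_add' := fun b c => Subtype.ext (map_add δ b c)
      map_smul' := by
        intro a b
        apply Subtype.ext
        change δ (a • b) = f (algebraMap A B a) * δ b
        rw [Algebra.smul_def, hmul, hbase, mul_zero, add_zero] }
    (by
      intro b c
      apply Subtype.ext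
      exact hmul b c)
  refine ⟨(Subring.subtype _).comp (liftFormsAlg D fun c => Subtype.ext (hsq c)).toRingHom, ?_, ?_⟩
  · intro b
    exact congrArg Subtype.val ((liftFormsAlg D fun c => Subtype.ext (hsq c)).commutes b)
  · intro c
    have h : liftFormsAlg D (fun c => Subtype.ext (hsq c)) (dd A c) = D c := by
      rw [dd_def, liftFormsAlg, ExteriorAlgebra.lift_ι_apply,
        Derivation.liftKaehlerDifferential_comp_D]
    exact congrArg Subtype.val h

/-- The universal property of the algebra of forms: a ring homomorphism `f` on functions and an
additive map `δ` (the image of `c ↦ dc`) which satisfy the evident relations extend, uniquely, to a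
ring homomorphism on all forms. -/
def liftForms {T : Type} [Ring T] (f : B →+* T) (δ : B →+ T)
    (hbase : ∀ a : A, δ (algebraMap A B a) = 0)
    (hmul : ∀ b c, δ (b * c) = f b * δ c + f c * δ b)
    (hcomm : ∀ b c, f b * δ c = δ c * f b)
    (hsq : ∀ c, δ c * δ c = 0) : Forms A B →+* T :=
  (exists_liftForms f δ hbase hmul hcomm hsq).choose

section

variable {T : Type} [Ring T] (f : B →+* T) (δ : B →+ T)
    (hbase : ∀ a : A, δ (algebraMap A B a) = 0)
    (hmul : ∀ b c, δ (b * c) = f b * δ c + f c * δ b)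
    (hcomm : ∀ b c, f b * δ c = δ c * f b)
    (hsq : ∀ c, δ c * δ c = 0)

theorem liftForms_fn (b : B) : liftForms f δ hbase hmul hcomm hsq (fn A b) = f b :=
  (exists_liftForms f δ hbase hmul hcomm hsq).choose_spec.1 b

theorem liftForms_dd (c : B) : liftForms f δ hbase hmul hcomm hsq (dd A c) = δ c :=
  (exists_liftForms f δ hbase hmul hcomm hsq).choose_spec.2 c

end

/-! ### Exterior differentiation -/

section Triangular

variable {E : Type} [Ring E]

/-- An upper triangular `2 × 2` matrix. -/
def tri (a b c : E) : Matrix (Fin 2) (Fin 2) E := !![a, b; 0, c]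

theorem tri_mul (a b c a' b' c' : E) :
    tri a b c * tri a' b' c' = tri (a * a') (a * b' + b * c') (c * c') := by
  simp [tri]

theorem tri_add (a b c a' b' c' : E) :
    tri a b c + tri a' b' c' = tri (a + a') (b + b') (c + c') := by
  simp [tri]

theorem tri_zero : tri (0 : E) 0 0 = 0 := by
  ext i j; fin_cases i <;> fin_cases j <;> rfl

theorem tri_one : tri (1 : E) 0 1 = 1 := by
  rw [Matrix.one_fin_two]; rfl

theorem tri_mul_zero_one (a b c : E) (M : Matrix (Fin 2) (Fin 2) E) :
    (tri a b c * M) 0 1 = a * M 0 1 + b * M 1 1 := by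
  rw [Matrix.mul_apply, Fin.sum_univ_two]; simp [tri]

theorem tri_mul_one_one (a b c : E) (M : Matrix (Fin 2) (Fin 2) E) :
    (tri a b c * M) 1 1 = c * M 1 1 := by
  rw [Matrix.mul_apply, Fin.sum_univ_two]; simp [tri]

end Triangular

theorem dd_one : dd A (1 : B) = 0 := by simp [dd_def]

/-- The ring homomorphism `ω ↦ (± ω, dω; 0, ω)` on forms, with sign `(-1)^k` in degree `k`. -/
def extDerivHom : Forms A B →+* Matrix (Fin 2) (Fin 2) (Forms A B) :=
  liftForms
    { toFun := fun b => tri (fn A b) (dd A b) (fn A b)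
      map_one' := by rw [map_one, dd_one, tri_one]
      map_mul' := by
        intro b c
        rw [tri_mul, map_mul, dd_mul, fn_comm c]
      map_zero' := by rw [map_zero, map_zero, tri_zero]
      map_add' := by intro b c; rw [tri_add, map_add, map_add] }
    { toFun := fun c => tri (-dd A c) 0 (dd A c)
      map_zero' := by rw [map_zero, neg_zero, tri_zero]
      map_add' := by intro b c; rw [tri_add, map_add, neg_add, add_zero] }
    (by
      intro a
      change tri _ _ _ = _
      rw [dd_base, neg_zero, tri_zero])
    (by
      intro b c
      change tri _ _ _ = tri _ _ _ * tri _ _ _ + tri _ _ _ * tri _ _ _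
      rw [tri_mul, tri_mul, tri_add, dd_mul, dd_swap b c]
      congr 1
      · simp [add_comm]
      · simp)
    (by
      intro b c
      change tri _ _ _ * tri _ _ _ = tri _ _ _ * tri _ _ _
      rw [tri_mul, tri_mul, fn_comm b (-dd A c), fn_comm b (dd A c), dd_swap b c]
      simp)
    (by
      intro c
      change tri _ _ _ * tri _ _ _ = _
      rw [tri_mul, neg_mul_neg, dd_sq, mul_zero, zero_mul, add_zero, tri_zero])

theorem extDerivHom_fn (b : B) : extDerivHom (fn A b) = tri (fn A b) (dd A b) (fn A b) :=
  liftForms_fn _ _ _ _ _ _ b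

theorem extDerivHom_dd (c : B) : extDerivHom (dd A c) = tri (-dd A c) 0 (dd A c) :=
  liftForms_dd _ _ _ _ _ _ c

theorem extDerivHom_one_one (x : Forms A B) : extDerivHom x 1 1 = x := by
  induction x using forms_induction with
  | one => simp
  | add x y hx hy => simp [hx, hy]
  | fn_mul b x hx => rw [map_mul, extDerivHom_fn, tri_mul_one_one, hx]
  | dd_mul c x hx => rw [map_mul, extDerivHom_dd, tri_mul_one_one, hx]

/-- Exterior differentiation `d : Ω^•_{B/A} → Ω^•_{B/A}`. It is characterized by `extDeriv_one`,
`extDeriv_fn_mul` and `extDeriv_dd_mul`. -/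
def extDeriv : Forms A B →ₗ[A] Forms A B where
  toFun x := extDerivHom x 0 1
  map_add' x y := by simp
  map_smul' a x := by
    simp only [smul_eq_fn_mul, map_mul, extDerivHom_fn, tri_mul_zero_one]
    simp [dd_base]

theorem extDeriv_one : extDeriv (1 : Forms A B) = 0 := by simp [extDeriv]

theorem extDeriv_fn_mul (b : B) (x : Forms A B) :
    extDeriv (fn A b * x) = dd A b * x + fn A b * extDeriv x := by
  simp [extDeriv, extDerivHom_fn, tri_mul_zero_one, extDerivHom_one_one, add_comm]

theorem extDeriv_dd_mul (c : B) (x : Forms A B) :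
    extDeriv (dd A c * x) = -(dd A c * extDeriv x) := by
  simp [extDeriv, extDerivHom_dd, tri_mul_zero_one]

theorem extDeriv_mem {k : ℕ} {x : Forms A B} (hx : x ∈ formsDeg A B k) :
    extDeriv x ∈ formsDeg A B (k + 1) := by
  refine formsDeg_induction (P := fun k x => extDeriv x ∈ formsDeg A B (k + 1)) ?_ ?_ ?_ ?_ hx
  · rw [extDeriv_one]; exact zero_mem _
  · intro k x y hx hy; rw [map_add]; exact add_mem hx hy
  · intro k b x hx h; rw [extDeriv_fn_mul]; exact add_mem (dd_mul_mem _ hx) (fn_mul_mem _ h)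
  · intro k c x _ h; rw [extDeriv_dd_mul]; exact neg_mem (dd_mul_mem _ h)

theorem extDeriv_extDeriv (x : Forms A B) : extDeriv (extDeriv x) = 0 := by
  induction x using forms_induction with
  | one => simp [extDeriv_one]
  | add x y hx hy => simp [hx, hy]
  | fn_mul b x hx => simp [extDeriv_fn_mul, extDeriv_dd_mul, hx]
  | dd_mul c x hx => simp [extDeriv_dd_mul, hx]

/-! ### Lie derivatives -/

section Lie

variable {δ : Derivation ℤ A A} {θ : Derivation ℤ B B}

/-- The derivation `θ` of `B` extends the derivation `δ` of `A`. -/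
def Extends (δ : Derivation ℤ A A) (θ : Derivation ℤ B B) : Prop :=
  ∀ a, θ (algebraMap A B a) = algebraMap A B (δ a)

/-- The ring homomorphism `ω ↦ (ω, L_θ ω; 0, ω)` on forms. -/
def lieDerivHom (h : Extends δ θ) : Forms A B →+* Matrix (Fin 2) (Fin 2) (Forms A B) :=
  liftForms
    { toFun := fun b => tri (fn A b) (fn A (θ b)) (fn A b)
      map_one' := by rw [map_one, Derivation.map_one_eq_zero, map_zero, tri_one]
      map_mul' := by
        intro b c
        rw [tri_mul, Derivation.leibniz, smul_eq_mul, smul_eq_mul, map_add, map_mul, map_mul,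
          map_mul, fn_comm c]
      map_zero' := by rw [map_zero, map_zero, map_zero, tri_zero]
      map_add' := by intro b c; rw [tri_add, map_add, map_add, map_add] }
    { toFun := fun c => tri (dd A c) (dd A (θ c)) (dd A c)
      map_zero' := by rw [map_zero, map_zero, map_zero, tri_zero]
      map_add' := by intro b c; rw [tri_add, map_add, map_add, map_add] }
    (by
      intro a
      change tri _ _ _ = _
      rw [h a, dd_base, dd_base, tri_zero])
    (by
      intro b c
      change tri _ _ _ = tri _ _ _ * tri _ _ _ + tri _ _ _ * tri _ _ _
      rw [tri_mul, tri_mul, tri_add, dd_mul, Derivation.leibniz, smul_eq_mul, smul_eq_mul, map_add,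
        dd_mul, dd_mul]
      congr 1
      abel)
    (by
      intro b c
      change tri _ _ _ * tri _ _ _ = tri _ _ _ * tri _ _ _
      rw [tri_mul, tri_mul, fn_comm b (dd A c), fn_comm b (dd A (θ c)), fn_comm (θ b), add_comm])
    (by
      intro c
      change tri _ _ _ * tri _ _ _ = _
      rw [tri_mul, dd_sq, dd_swap c (θ c), neg_add_cancel, tri_zero])

theorem lieDerivHom_fn (h : Extends δ θ) (b : B) :
    lieDerivHom h (fn A b) = tri (fn A b) (fn A (θ b)) (fn A b) :=
  liftForms_fn _ _ _ _ _ _ b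

theorem lieDerivHom_dd (h : Extends δ θ) (c : B) :
    lieDerivHom h (dd A c) = tri (dd A c) (dd A (θ c)) (dd A c) :=
  liftForms_dd _ _ _ _ _ _ c

theorem lieDerivHom_one_one (h : Extends δ θ) (x : Forms A B) : lieDerivHom h x 1 1 = x := by
  induction x using forms_induction with
  | one => simp
  | add x y hx hy => simp [hx, hy]
  | fn_mul b x hx => rw [map_mul, lieDerivHom_fn, tri_mul_one_one, hx]
  | dd_mul c x hx => rw [map_mul, lieDerivHom_dd, tri_mul_one_one, hx]

/-- The Lie derivative `L_θ` on relative forms, for a derivation `θ` of `B` which extends a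
derivation of `A`: the derivation of the algebra of forms with `b ↦ θ(b)` and `dc ↦ d(θ(c))`. -/
def lieDeriv (h : Extends δ θ) : Forms A B →+ Forms A B where
  toFun x := lieDerivHom h x 0 1
  map_zero' := by simp
  map_add' x y := by simp

theorem lieDeriv_one (h : Extends δ θ) : lieDeriv h (1 : Forms A B) = 0 := by simp [lieDeriv]

theorem lieDeriv_fn_mul (h : Extends δ θ) (b : B) (x : Forms A B) :
    lieDeriv h (fn A b * x) = fn A (θ b) * x + fn A b * lieDeriv h x := by
  simp [lieDeriv, lieDerivHom_fn, tri_mul_zero_one, lieDerivHom_one_one, add_comm]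

theorem lieDeriv_dd_mul (h : Extends δ θ) (c : B) (x : Forms A B) :
    lieDeriv h (dd A c * x) = dd A (θ c) * x + dd A c * lieDeriv h x := by
  simp [lieDeriv, lieDerivHom_dd, tri_mul_zero_one, lieDerivHom_one_one, add_comm]

theorem lieDeriv_mul (h : Extends δ θ) (x y : Forms A B) :
    lieDeriv h (x * y) = lieDeriv h x * y + x * lieDeriv h y := by
  induction x using forms_induction with
  | one => simp [lieDeriv_one]
  | add x x' hx hx' => simp only [add_mul, map_add, hx, hx']; abel
  | fn_mul b x hx => simp only [mul_assoc, lieDeriv_fn_mul, hx, add_mul, mul_add]; abel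
  | dd_mul c x hx => simp only [mul_assoc, lieDeriv_dd_mul, hx, add_mul, mul_add]; abel

theorem lieDeriv_smul (h : Extends δ θ) (a : A) (x : Forms A B) :
    lieDeriv h (a • x) = δ a • x + a • lieDeriv h x := by
  simp only [smul_eq_fn_mul, lieDeriv_fn_mul, h a]

theorem lieDeriv_dd (h : Extends δ θ) (c : B) : lieDeriv h (dd A c) = dd A (θ c) := by
  simpa [lieDeriv_one] using lieDeriv_dd_mul h c 1

theorem lieDeriv_mem (h : Extends δ θ) {k : ℕ} {x : Forms A B} (hx : x ∈ formsDeg A B k) :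
    lieDeriv h x ∈ formsDeg A B k := by
  refine formsDeg_induction (P := fun k x => lieDeriv h x ∈ formsDeg A B k) ?_ ?_ ?_ ?_ hx
  · rw [lieDeriv_one]; exact zero_mem _
  · intro k x y hx hy; rw [map_add]; exact add_mem hx hy
  · intro k b x hx h'; rw [lieDeriv_fn_mul]; exact add_mem (fn_mul_mem _ hx) (fn_mul_mem _ h')
  · intro k c x hx h'; rw [lieDeriv_dd_mul]; exact add_mem (dd_mul_mem _ hx) (dd_mul_mem _ h')

theorem lieDeriv_extDeriv (h : Extends δ θ) (x : Forms A B) :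
    lieDeriv h (extDeriv x) = extDeriv (lieDeriv h x) := by
  induction x using forms_induction with
  | one => simp [lieDeriv_one, extDeriv_one]
  | add x x' hx hx' => simp only [map_add, hx, hx']
  | fn_mul b x hx =>
    simp only [lieDeriv_fn_mul, lieDeriv_dd_mul, extDeriv_fn_mul, map_add, hx]; abel
  | dd_mul c x hx =>
    simp only [lieDeriv_dd_mul, extDeriv_dd_mul, map_add, map_neg, hx]; abel

end Lie

/-! ### Pullback of forms -/

/-- The pullback of forms along an endomorphism of the `A`-algebra `B`: the ring homomorphism with
`b ↦ σ(b)` and `dc ↦ d(σ(c))`. -/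
def pullback (σ : B →ₐ[A] B) : Forms A B →+* Forms A B :=
  liftForms ((fn A).comp σ.toRingHom) ((dd A).comp σ.toRingHom.toAddMonoidHom)
    (by intro a; simp [dd_base])
    (by intro b c; simp [dd_mul])
    (by intro b c; simp [fn_comm])
    (by intro c; simp [dd_sq])

theorem pullback_fn (σ : B →ₐ[A] B) (b : B) : pullback σ (fn A b) = fn A (σ b) :=
  liftForms_fn _ _ _ _ _ _ b

theorem pullback_dd (σ : B →ₐ[A] B) (c : B) : pullback σ (dd A c) = dd A (σ c) :=
  liftForms_dd _ _ _ _ _ _ c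

theorem pullback_smul (σ : B →ₐ[A] B) (a : A) (x : Forms A B) :
    pullback σ (a • x) = a • pullback σ x := by
  simp [smul_eq_fn_mul, pullback_fn]

theorem pullback_mem (σ : B →ₐ[A] B) {k : ℕ} {x : Forms A B} (hx : x ∈ formsDeg A B k) :
    pullback σ x ∈ formsDeg A B k := by
  refine formsDeg_induction (P := fun k x => pullback σ x ∈ formsDeg A B k) ?_ ?_ ?_ ?_ hx
  · rw [map_one, ← map_one (fn A)]; exact fn_mem 1
  · intro k x y hx hy; rw [map_add]; exact add_mem hx hy
  · intro k b x _ h; rw [map_mul, pullback_fn]; exact fn_mul_mem _ h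
  · intro k c x _ h; rw [map_mul, pullback_dd]; exact dd_mul_mem _ h

theorem pullback_extDeriv (σ : B →ₐ[A] B) (x : Forms A B) :
    pullback σ (extDeriv x) = extDeriv (pullback σ x) := by
  induction x using forms_induction with
  | one => simp [extDeriv_one]
  | add x x' hx hx' => simp only [map_add, hx, hx']
  | fn_mul b x hx =>
    simp only [map_mul, pullback_fn, extDeriv_fn_mul, map_add, hx, pullback_dd]
  | dd_mul c x hx =>
    simp only [map_mul, pullback_dd, extDeriv_dd_mul, map_neg, hx]

/-! ### Contraction and Cartan's formula -/

/-- Contraction of relative forms with a relative derivation. -/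
def contract (θ : Derivation A B B) : Forms A B →ₗ[B] Forms A B :=
  CliffordAlgebra.contractLeft (Q := (0 : QuadraticForm B (Ω[B⁄A]))) θ.liftKaehlerDifferential

theorem contract_one (θ : Derivation A B B) : contract θ 1 = 0 :=
  CliffordAlgebra.contractLeft_one _ _

theorem contract_fn_mul (θ : Derivation A B B) (b : B) (x : Forms A B) :
    contract θ (fn A b * x) = fn A b * contract θ x :=
  CliffordAlgebra.contractLeft_algebraMap_mul _ _ _

theorem contract_dd_mul (θ : Derivation A B B) (c : B) (x : Forms A B) :
    contract θ (dd A c * x) = fn A (θ c) * x - dd A c * contract θ x := by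
  have h := CliffordAlgebra.contractLeft_ι_mul (Q := (0 : QuadraticForm B (Ω[B⁄A])))
    θ.liftKaehlerDifferential (KaehlerDifferential.D A B c) x
  rw [Derivation.liftKaehlerDifferential_comp_D, Algebra.smul_def] at h
  exact h

theorem cartan (θ : Derivation A B B) (M : Forms A B →+ Forms A B) (one : M 1 = 0)
    (fn_mul : ∀ b x, M (fn A b * x) = fn A (θ b) * x + fn A b * M x)
    (dd_mul : ∀ c x, M (dd A c * x) = dd A (θ c) * x + dd A c * M x) (x : Forms A B) :
    M x = extDeriv (contract θ x) + contract θ (extDeriv x) := by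
  induction x using forms_induction with
  | one => simp [one, contract_one, extDeriv_one]
  | add x x' hx hx' => simp only [map_add, hx, hx']; abel
  | fn_mul b x hx =>
    simp only [fn_mul, hx, contract_fn_mul, extDeriv_fn_mul, map_add, contract_dd_mul, mul_add]
    abel
  | dd_mul c x hx =>
    simp only [dd_mul, hx, contract_dd_mul, extDeriv_dd_mul, extDeriv_fn_mul, map_sub,
      map_neg, mul_add]
    abel

theorem contract_mem (θ : Derivation A B B) {k : ℕ} {x : Forms A B} (hx : x ∈ formsDeg A B k) :
    (k = 0 → contract θ x = 0) ∧ ∀ j, k = j + 1 → contract θ x ∈ formsDeg A B j := by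
  refine formsDeg_induction (P := fun k x => (k = 0 → contract θ x = 0) ∧
    ∀ j, k = j + 1 → contract θ x ∈ formsDeg A B j) ?_ ?_ ?_ ?_ hx
  · rw [contract_one]; exact ⟨fun _ => rfl, fun _ _ => zero_mem _⟩
  · intro k x y hx hy
    rw [map_add]
    exact ⟨fun h => by rw [hx.1 h, hy.1 h, add_zero], fun j h => add_mem (hx.2 j h) (hy.2 j h)⟩
  · intro k b x _ hx
    rw [contract_fn_mul]
    exact ⟨fun h => by rw [hx.1 h, mul_zero], fun j h => fn_mul_mem _ (hx.2 j h)⟩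
  · intro k c x hx h
    refine ⟨fun h0 => absurd h0 (Nat.succ_ne_zero k), fun j hj => ?_⟩
    obtain rfl : k = j := by omega
    rw [contract_dd_mul]
    refine sub_mem (fn_mul_mem _ hx) ?_
    cases k with
    | zero => rw [h.1 rfl, mul_zero]; exact zero_mem _
    | succ i => exact dd_mul_mem _ (h.2 i rfl)

/-! ### Cohomology of twisted de Rham complexes -/

/-- The differential `ω ↦ dω + η ∧ ω` attached to a `1`-form `η`. Its square is zero if `dη = 0`. -/
def twistedDiff (η : Ω[B⁄A]) : Forms A B →ₗ[A] Forms A B :=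
  extDeriv + LinearMap.mulLeft A (ExteriorAlgebra.ι B η)

theorem twistedDiff_apply (η : Ω[B⁄A]) (x : Forms A B) :
    twistedDiff η x = extDeriv x + ExteriorAlgebra.ι B η * x := rfl

theorem twistedDiff_mem (η : Ω[B⁄A]) {k : ℕ} {x : Forms A B} (hx : x ∈ formsDeg A B k) :
    twistedDiff η x ∈ formsDeg A B (k + 1) :=
  add_mem (extDeriv_mem hx) (ι_mul_mem η hx)

/-- The kernel of `d + η ∧` on `Ω^k`. -/
def cocycles (η : Ω[B⁄A]) (k : ℕ) : Submodule A (Forms A B) :=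
  LinearMap.ker (twistedDiff η) ⊓ formsDeg A B k

/-- The image of `d + η ∧ : Ω^{k-1} → Ω^k`. -/
def coboundaries (η : Ω[B⁄A]) : ℕ → Submodule A (Forms A B)
  | 0 => ⊥
  | k + 1 => (formsDeg A B k).map (twistedDiff η)

/-- The cohomology `H^k(Ω^•_{B/A}, d + η ∧)`. -/
abbrev Cohomology (η : Ω[B⁄A]) (k : ℕ) : Type :=
  cocycles η k ⧸ (coboundaries η k).submoduleOf (cocycles η k)

/-- The class of a closed form. -/
def cohomologyClass (η : Ω[B⁄A]) (k : ℕ) : cocycles η k →ₗ[A] Cohomology η k :=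
  ((coboundaries η k).submoduleOf (cocycles η k)).mkQ

theorem cohomologyClass_surjective (η : Ω[B⁄A]) (k : ℕ) :
    Function.Surjective (cohomologyClass η k) :=
  Submodule.mkQ_surjective _

theorem cohomologyClass_eq_zero {η : Ω[B⁄A]} {k : ℕ} {x : cocycles η k} :
    cohomologyClass η k x = 0 ↔ (x : Forms A B) ∈ coboundaries η k := by
  rw [cohomologyClass, Submodule.mkQ_apply, Submodule.Quotient.mk_eq_zero]
  rfl

section CohomologyMap

variable {η : Ω[B⁄A]} {T : Forms A B →+ Forms A B}

theorem map_coboundaries (hT : ∀ x, T (twistedDiff η x) = twistedDiff η (T x))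
    (hdeg : ∀ k x, x ∈ formsDeg A B k → T x ∈ formsDeg A B k) {k : ℕ} {x : Forms A B}
    (hx : x ∈ coboundaries η k) : T x ∈ coboundaries η k := by
  cases k with
  | zero =>
    obtain rfl : x = 0 := hx
    rw [map_zero]; exact zero_mem _
  | succ k =>
    obtain ⟨y, hy, rfl⟩ := hx
    exact ⟨T y, hdeg k y hy, (hT y).symm⟩

/-- The restriction to cocycles of an additive map which commutes with the differential. -/
def cocyclesMap (hT : ∀ x, T (twistedDiff η x) = twistedDiff η (T x))
    (hdeg : ∀ k x, x ∈ formsDeg A B k → T x ∈ formsDeg A B k) (k : ℕ) :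
    cocycles η k →+ cocycles η k where
  toFun x := ⟨T x, by
    refine ⟨?_, hdeg k _ x.2.2⟩
    have h : twistedDiff η (x : Forms A B) = 0 := x.2.1
    change twistedDiff η (T x) = 0
    rw [← hT, h, map_zero]⟩
  map_zero' := Subtype.ext (map_zero T)
  map_add' x y := Subtype.ext (map_add T _ _)

/-- The map on cohomology induced by an additive map which commutes with the differential. -/
def cohomologyMap (hT : ∀ x, T (twistedDiff η x) = twistedDiff η (T x))
    (hdeg : ∀ k x, x ∈ formsDeg A B k → T x ∈ formsDeg A B k) (k : ℕ) :
    Cohomology η k →+ Cohomology η k :=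
  (cohomologyClass η k).toAddMonoidHom.liftOfSurjective (cohomologyClass_surjective η k)
    ⟨(cohomologyClass η k).toAddMonoidHom.comp (cocyclesMap hT hdeg k), by
      intro x hx
      have hx' : cohomologyClass η k x = 0 := hx
      change cohomologyClass η k (cocyclesMap hT hdeg k x) = 0
      rw [cohomologyClass_eq_zero] at hx' ⊢
      exact map_coboundaries hT hdeg hx'⟩

theorem cohomologyMap_class (hT : ∀ x, T (twistedDiff η x) = twistedDiff η (T x))
    (hdeg : ∀ k x, x ∈ formsDeg A B k → T x ∈ formsDeg A B k) (k : ℕ) (x : cocycles η k) :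
    cohomologyMap hT hdeg k (cohomologyClass η k x)
      = cohomologyClass η k (cocyclesMap hT hdeg k x) :=
  AddMonoidHom.liftOfRightInverse_comp_apply _ _ _ _ x

end CohomologyMap

/-! ### The Gauss-Manin connection -/

/-- A derivation of `A` extends to every formally smooth `A`-algebra. -/
theorem exists_extends [Algebra.FormallySmooth A B] (δ : Derivation ℤ A A) :
    ∃ θ : Derivation ℤ B B, Extends δ θ := by
  let i : A →+* TrivSqZeroExt B B :=
    { toFun := fun a => (algebraMap A B a, algebraMap A B (δ a))
      map_one' := TrivSqZeroExt.ext (map_one _) (by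
        change algebraMap A B (δ 1) = 0
        simp)
      map_mul' := fun a b => TrivSqZeroExt.ext (map_mul _ _ _) (by
        change algebraMap A B (δ (a * b)) = algebraMap A B a * algebraMap A B (δ b)
          + algebraMap A B (δ a) * algebraMap A B b
        simp [mul_comm])
      map_zero' := TrivSqZeroExt.ext (map_zero _) (by
        change algebraMap A B (δ 0) = 0
        simp)
      map_add' := fun a b => TrivSqZeroExt.ext (map_add _ _ _) (by
        change algebraMap A B (δ (a + b)) = algebraMap A B (δ a) + algebraMap A B (δ b)
        simp) }
  let _ : Algebra A (TrivSqZeroExt B B) := i.toAlgebra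
  let p : TrivSqZeroExt B B →ₐ[A] B :=
    { TrivSqZeroExt.fstHom B B B with
      commutes' := by
        intro a
        rfl }
  have hp : Function.Surjective p := fun b => ⟨TrivSqZeroExt.inl b, rfl⟩
  have hk : IsNilpotent (RingHom.ker (p : TrivSqZeroExt B B →+* B)) := by
    refine ⟨2, ?_⟩
    rw [Submodule.pow_succ, Submodule.pow_one, Submodule.zero_eq_bot, eq_bot_iff, Ideal.mul_le]
    intro r hr s hs
    have hr' : r.fst = 0 := hr
    have hs' : s.fst = 0 := hs
    rw [Ideal.mem_bot]
    ext <;> simp [hr', hs']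
  let s : B →ₐ[A] TrivSqZeroExt B B := Algebra.FormallySmooth.liftOfSurjective (AlgHom.id A B) p hp hk
  have hs : ∀ b, (s b).fst = b := fun b =>
    Algebra.FormallySmooth.liftOfSurjective_apply (AlgHom.id A B) p hp hk b
  refine ⟨Derivation.mk' (AddMonoidHom.toIntLinearMap
    { toFun := fun b => (s b).snd, map_zero' := by simp, map_add' := by simp }) ?_, ?_⟩
  · intro b c
    change (s (b * c)).snd = b * (s c).snd + c * (s b).snd
    rw [map_mul, TrivSqZeroExt.snd_mul, hs, hs]
    simp [mul_comm c]
  · intro a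
    change (s (algebraMap A B a)).snd = _
    rw [s.commutes]
    rfl

section GaussManin

variable {δ : Derivation ℤ A A} {θ θ' : Derivation ℤ B B}

theorem twistedDiff_zero (x : Forms A B) : twistedDiff (0 : Ω[B⁄A]) x = extDeriv x := by
  simp [twistedDiff_apply]

/-- The map induced by the Lie derivative `L_θ` on de Rham cohomology. -/
def lieCohomology (h : Extends δ θ) (k : ℕ) :
    Cohomology (0 : Ω[B⁄A]) k →+ Cohomology (0 : Ω[B⁄A]) k :=
  cohomologyMap (T := lieDeriv h)
    (fun x => by rw [twistedDiff_zero, twistedDiff_zero, lieDeriv_extDeriv])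
    (fun _ _ hx => lieDeriv_mem h hx) k

theorem sub_coboundary_of_cartan (ψ : Derivation A B B) (M : Forms A B →+ Forms A B)
    (one : M 1 = 0)
    (fn_mul : ∀ b x, M (fn A b * x) = fn A (ψ b) * x + fn A b * M x)
    (dd_mul : ∀ c x, M (dd A c * x) = dd A (ψ c) * x + dd A c * M x) {k : ℕ}
    (x : cocycles (0 : Ω[B⁄A]) k) : M x ∈ coboundaries (0 : Ω[B⁄A]) k := by
  have hd : extDeriv (x : Forms A B) = 0 := by
    rw [← twistedDiff_zero]; exact x.2.1
  rw [cartan ψ M one fn_mul dd_mul, hd, map_zero, add_zero]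
  have hc := contract_mem ψ x.2.2
  cases k with
  | zero => rw [hc.1 rfl, map_zero]; exact zero_mem _
  | succ k => exact ⟨_, hc.2 k rfl, twistedDiff_zero _⟩

/-- The map induced by `L_θ` on de Rham cohomology depends only on the derivation of `A` which `θ`
extends. -/
theorem lieCohomology_eq (h : Extends δ θ) (h' : Extends δ θ') (k : ℕ) :
    lieCohomology (A := A) h k = lieCohomology h' k := by
  let ψ : Derivation A B B := Derivation.mk'
    { toFun := fun b => θ b - θ' b
      map_add' := by intro b c; simp only [map_add]; abel
      map_smul' := by
        intro a b
        change θ (a • b) - θ' (a • b) = a • (θ b - θ' b)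
        rw [Algebra.smul_def, Algebra.smul_def]
        simp only [Derivation.leibniz, h a, h' a, smul_eq_mul]
        ring }
    (by
      intro b c
      change θ (b * c) - θ' (b * c) = b * (θ c - θ' c) + c * (θ b - θ' b)
      simp only [Derivation.leibniz, smul_eq_mul]
      ring)
  have hψ : ∀ b, ψ b = θ b - θ' b := fun _ => rfl
  ext z
  obtain ⟨x, rfl⟩ := cohomologyClass_surjective _ _ z
  rw [lieCohomology, lieCohomology, cohomologyMap_class, cohomologyMap_class, ← sub_eq_zero,
    ← map_sub, cohomologyClass_eq_zero]
  refine sub_coboundary_of_cartan ψ (lieDeriv h - lieDeriv h') ?_ ?_ ?_ x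
  · simp [lieDeriv_one]
  · intro b x
    simp only [AddMonoidHom.sub_apply, lieDeriv_fn_mul, hψ, map_sub, sub_mul, mul_sub]
    abel
  · intro b x
    simp only [AddMonoidHom.sub_apply, lieDeriv_dd_mul, hψ, map_sub, sub_mul, mul_sub]
    abel

/-- The Gauss-Manin connection on `H^k_DR(B/A)` in the direction of a derivation of `A`: the map
induced by the Lie derivative along any extension of this derivation to `B`. -/
def gaussManin [Algebra.FormallySmooth A B] (δ : Derivation ℤ A A) (k : ℕ) :
    Cohomology (0 : Ω[B⁄A]) k →+ Cohomology (0 : Ω[B⁄A]) k :=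
  lieCohomology (exists_extends δ).choose_spec k

theorem gaussManin_eq [Algebra.FormallySmooth A B] (h : Extends δ θ) (k : ℕ) :
    gaussManin δ k = lieCohomology (A := A) h k :=
  lieCohomology_eq _ _ k

theorem gaussManin_smul [Algebra.FormallySmooth A B] (δ : Derivation ℤ A A) (k : ℕ) (a : A)
    (z : Cohomology (0 : Ω[B⁄A]) k) :
    gaussManin δ k (a • z) = δ a • z + a • gaussManin δ k z := by
  obtain ⟨x, rfl⟩ := cohomologyClass_surjective _ _ z
  rw [← map_smul, gaussManin, lieCohomology, cohomologyMap_class, cohomologyMap_class, ← map_smul,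
    ← map_smul, ← map_add]
  exact congrArg _ (Subtype.ext (lieDeriv_smul _ a (x : Forms A B)))

theorem gaussManin_comm [Algebra.FormallySmooth A B] {δ δ' : Derivation ℤ A A}
    (hδ : ∀ a, δ (δ' a) = δ' (δ a)) (k : ℕ) (z : Cohomology (0 : Ω[B⁄A]) k) :
    gaussManin δ k (gaussManin δ' k z) = gaussManin δ' k (gaussManin δ k z) := by
  obtain ⟨θ, h⟩ := exists_extends (B := B) δ
  obtain ⟨θ', h'⟩ := exists_extends (B := B) δ'
  rw [gaussManin_eq h, gaussManin_eq h']
  let ψ : Derivation A B B := Derivation.mk'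
    { toFun := fun b => θ (θ' b) - θ' (θ b)
      map_add' := by intro b c; simp only [map_add]; abel
      map_smul' := by
        intro a b
        change θ (θ' (a • b)) - θ' (θ (a • b)) = a • (θ (θ' b) - θ' (θ b))
        rw [Algebra.smul_def, Algebra.smul_def]
        simp only [Derivation.leibniz, h _, h' _, smul_eq_mul, map_add, hδ]
        ring }
    (by
      intro b c
      change θ (θ' (b * c)) - θ' (θ (b * c)) = b * (θ (θ' c) - θ' (θ c)) + c * (θ (θ' b) - θ' (θ b))
      simp only [Derivation.leibniz, smul_eq_mul, map_add]
      ring)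
  have hψ : ∀ b, ψ b = θ (θ' b) - θ' (θ b) := fun _ => rfl
  obtain ⟨x, rfl⟩ := cohomologyClass_surjective _ _ z
  simp only [lieCohomology, cohomologyMap_class]
  rw [← sub_eq_zero, ← map_sub, cohomologyClass_eq_zero]
  refine sub_coboundary_of_cartan ψ
    ((lieDeriv h).comp (lieDeriv h') - (lieDeriv h').comp (lieDeriv h)) ?_ ?_ ?_ x
  · simp [lieDeriv_one]
  · intro b x
    simp only [AddMonoidHom.sub_apply, AddMonoidHom.comp_apply, lieDeriv_fn_mul, hψ, map_sub,
      map_add, sub_mul, mul_sub]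
    abel
  · intro b x
    simp only [AddMonoidHom.sub_apply, AddMonoidHom.comp_apply, lieDeriv_dd_mul, hψ, map_sub,
      map_add, sub_mul, mul_sub]
    abel

end GaussManin

/-- The map induced on `H^k_DR(B/A)` by an endomorphism of the `A`-algebra `B`. -/
def pullbackCohomology (σ : B →ₐ[A] B) (k : ℕ) :
    Cohomology (0 : Ω[B⁄A]) k →+ Cohomology (0 : Ω[B⁄A]) k :=
  cohomologyMap (T := (pullback σ).toAddMonoidHom)
    (fun x => by
      rw [twistedDiff_zero, twistedDiff_zero]
      exact pullback_extDeriv σ x)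
    (fun _ _ hx => pullback_mem σ hx) k

end Forms

/-! ### The field `ℂ(λ)` and its ring of differential operators -/

section DifferentialOperators

variable (N : ℕ)

/-- The field `ℂ(λ) = ℂ(λ₁, …, λ_N)`. -/
def RatFun : Type := FractionRing (MvPolynomial (Fin N) ℂ)

instance : Field (RatFun N) := inferInstanceAs (Field (FractionRing (MvPolynomial (Fin N) ℂ)))

instance : Algebra (MvPolynomial (Fin N) ℂ) (RatFun N) :=
  inferInstanceAs (Algebra (MvPolynomial (Fin N) ℂ) (FractionRing (MvPolynomial (Fin N) ℂ)))

instance : IsFractionRing (MvPolynomial (Fin N) ℂ) (RatFun N) :=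
  inferInstanceAs (IsFractionRing _ (FractionRing (MvPolynomial (Fin N) ℂ)))

instance : Algebra ℂ (RatFun N) :=
  ((algebraMap (MvPolynomial (Fin N) ℂ) (RatFun N)).comp MvPolynomial.C).toAlgebra

variable {N}

/-- The variable `λ_j`, as an element of `ℂ(λ)`. -/
def lam (j : Fin N) : RatFun N :=
  algebraMap (MvPolynomial (Fin N) ℂ) (RatFun N) (MvPolynomial.X j)

theorem exists_partialDeriv (j : Fin N) : ∃ θ : Derivation ℤ (RatFun N) (RatFun N),
    Extends ((MvPolynomial.pderiv (R := ℂ) j).restrictScalars ℤ) θ := by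
  have : Algebra.FormallySmooth (MvPolynomial (Fin N) ℂ) (RatFun N) :=
    Algebra.FormallySmooth.of_isLocalization (nonZeroDivisors _)
  exact exists_extends _

/-- The derivation `∂/∂λ_j` of `ℂ(λ)`: the (unique) extension of the partial derivative of
polynomials. -/
def partialDeriv (j : Fin N) : Derivation ℤ (RatFun N) (RatFun N) := (exists_partialDeriv j).choose

theorem partialDeriv_polynomial (j : Fin N) (p : MvPolynomial (Fin N) ℂ) :
    partialDeriv j (algebraMap _ (RatFun N) p) = algebraMap _ (RatFun N) (MvPolynomial.pderiv j p) :=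
  (exists_partialDeriv j).choose_spec p

/-- Two derivations of a localization are equal if they agree on the original ring. -/
theorem derivation_ext_of_localization {R S : Type} [CommRing R] [CommRing S] [Algebra R S]
    (M : Submonoid R) [IsLocalization M S] {θ θ' : Derivation ℤ S S}
    (h : ∀ r, θ (algebraMap R S r) = θ' (algebraMap R S r)) : θ = θ' := by
  ext x
  obtain ⟨⟨r, s⟩, hx⟩ := IsLocalization.surj M x
  have h1 := congrArg θ hx
  have h2 := congrArg θ' hx
  simp only [Derivation.leibniz, smul_eq_mul, h] at h1 h2
  have h3 : algebraMap R S s * θ x = algebraMap R S s * θ' x := by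
    rw [← h2] at h1
    exact add_left_cancel h1
  exact (IsLocalization.map_units S s).mul_left_cancel h3

theorem partialDeriv_const (j : Fin N) (c : ℂ) : partialDeriv j (algebraMap ℂ (RatFun N) c) = 0 := by
  have h := partialDeriv_polynomial j (MvPolynomial.C c)
  rw [MvPolynomial.pderiv_C, map_zero] at h
  exact h

theorem partialDeriv_comm (i j : Fin N) (κ : RatFun N) :
    partialDeriv i (partialDeriv j κ) = partialDeriv j (partialDeriv i κ) := by
  have h : ⁅partialDeriv i, partialDeriv j⁆ = (0 : Derivation ℤ (RatFun N) (RatFun N)) := by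
    refine derivation_ext_of_localization (nonZeroDivisors (MvPolynomial (Fin N) ℂ)) fun p => ?_
    rw [Derivation.commutator_apply]
    simp only [partialDeriv_polynomial]
    rw [← map_sub]
    have hp : ⁅MvPolynomial.pderiv (R := ℂ) i, MvPolynomial.pderiv (R := ℂ) j⁆ = 0 := by
      apply MvPolynomial.derivation_ext
      intro k
      simp only [Derivation.commutator_apply, MvPolynomial.pderiv_X, Pi.single_apply]
      split_ifs <;> simp
    have hp' := congrArg (fun D => D p) hp
    rw [Derivation.commutator_apply] at hp'
    rw [hp']
    simp
  have h' := congrArg (fun D => D κ) h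
  rw [Derivation.commutator_apply] at h'
  exact sub_eq_zero.1 h'

/-- The defining relations of the ring of differential operators with coefficients in `ℂ(λ)`, on
the generators `κ ∈ ℂ(λ)` and `∂₁, …, ∂_N`. -/
inductive DiffOpRel : FreeAlgebra ℤ (RatFun N ⊕ Fin N) → FreeAlgebra ℤ (RatFun N ⊕ Fin N) → Prop
  | one : DiffOpRel (FreeAlgebra.ι ℤ (Sum.inl 1)) 1
  | add (κ κ' : RatFun N) : DiffOpRel (FreeAlgebra.ι ℤ (Sum.inl (κ + κ')))
      (FreeAlgebra.ι ℤ (Sum.inl κ) + FreeAlgebra.ι ℤ (Sum.inl κ'))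
  | mul (κ κ' : RatFun N) : DiffOpRel (FreeAlgebra.ι ℤ (Sum.inl (κ * κ')))
      (FreeAlgebra.ι ℤ (Sum.inl κ) * FreeAlgebra.ι ℤ (Sum.inl κ'))
  | comm (i j : Fin N) : DiffOpRel
      (FreeAlgebra.ι ℤ (Sum.inr i) * FreeAlgebra.ι ℤ (Sum.inr j))
      (FreeAlgebra.ι ℤ (Sum.inr j) * FreeAlgebra.ι ℤ (Sum.inr i))
  | leibniz (j : Fin N) (κ : RatFun N) : DiffOpRel
      (FreeAlgebra.ι ℤ (Sum.inr j) * FreeAlgebra.ι ℤ (Sum.inl κ))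
      (FreeAlgebra.ι ℤ (Sum.inl κ) * FreeAlgebra.ι ℤ (Sum.inr j)
        + FreeAlgebra.ι ℤ (Sum.inl (partialDeriv j κ)))

variable (N) in
/-- The ring `𝒟̄ = ℂ(λ)⟨∂₁, …, ∂_N⟩` of differential operators with coefficients in `ℂ(λ)`. -/
def DiffOp : Type := RingQuot (DiffOpRel (N := N))

instance : Ring (DiffOp N) := inferInstanceAs (Ring (RingQuot (DiffOpRel (N := N))))

/-- The canonical map from the free algebra on the generators to `𝒟̄`. -/
def diffOpMk : FreeAlgebra ℤ (RatFun N ⊕ Fin N) →+* DiffOp N := RingQuot.mkRingHom DiffOpRel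

/-- An element of `ℂ(λ)`, as a differential operator of order `0`. -/
def coeff (κ : RatFun N) : DiffOp N := diffOpMk (FreeAlgebra.ι ℤ (Sum.inl κ))

/-- The differential operator `∂_j = ∂/∂λ_j`. -/
def del (j : Fin N) : DiffOp N := diffOpMk (FreeAlgebra.ι ℤ (Sum.inr j))

section Action

variable {V : Type} [AddCommGroup V] [Module (RatFun N) V]

/-- The action of `𝒟̄` on a vector space over `ℂ(λ)` in which `∂₁, …, ∂_N` act by the commuting
operators `T₁, …, T_N` satisfying the Leibniz rule. -/
def diffOpAction (T : Fin N → AddMonoid.End V)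
    (hT : ∀ j (κ : RatFun N) v, T j (κ • v) = partialDeriv j κ • v + κ • T j v)
    (hcomm : ∀ i j v, T i (T j v) = T j (T i v)) : DiffOp N →+* AddMonoid.End V :=
  RingQuot.lift ⟨(FreeAlgebra.lift ℤ (Sum.elim (DistribMulAction.toAddMonoidEnd (RatFun N) V) T) :
    FreeAlgebra ℤ (RatFun N ⊕ Fin N) →ₐ[ℤ] AddMonoid.End V).toRingHom, by
    intro x y h
    induction h with
    | one => ext v; simp; exact one_smul (RatFun N) v
    | add κ κ' => ext v; simp; exact add_smul κ κ' v
    | mul κ κ' => ext v; simp; exact mul_smul κ κ' v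
    | comm i j => ext v; simpa using hcomm i j v
    | leibniz j κ => ext v; simp; exact (hT j κ v).trans (add_comm _ _)⟩

theorem diffOpAction_coeff (T : Fin N → AddMonoid.End V)
    (hT : ∀ j (κ : RatFun N) v, T j (κ • v) = partialDeriv j κ • v + κ • T j v)
    (hcomm : ∀ i j v, T i (T j v) = T j (T i v)) (κ : RatFun N) (v : V) :
    diffOpAction T hT hcomm (coeff κ) v = κ • v := by
  unfold diffOpAction coeff diffOpMk
  erw [RingQuot.lift_mkRingHom_apply]
  simp
  rfl

theorem diffOpAction_del (T : Fin N → AddMonoid.End V)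
    (hT : ∀ j (κ : RatFun N) v, T j (κ • v) = partialDeriv j κ • v + κ • T j v)
    (hcomm : ∀ i j v, T i (T j v) = T j (T i v)) (j : Fin N) (v : V) :
    diffOpAction T hT hcomm (del j) v = T j v := by
  unfold diffOpAction del diffOpMk
  erw [RingQuot.lift_mkRingHom_apply]
  simp

end Action

end DifferentialOperators

/-! ### Hypergeometric systems -/

section Hypergeometric

variable {N n : ℕ}

/-- The operator `□_l`. -/
def boxOp (l : Fin N → ℤ) : DiffOp N :=
  (List.ofFn fun j => del j ^ (l j).toNat).prod - (List.ofFn fun j => del j ^ (-l j).toNat).prod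

/-- The operator `Z_{i,α} = ∑ⱼ aᵢ⁽ʲ⁾ λⱼ ∂ⱼ - αᵢ`. -/
def eulerOp (a : Fin N → Fin n → ℤ) (α : Fin n → ℂ) (i : Fin n) : DiffOp N :=
  ∑ j, coeff ((a j i : RatFun N) * lam j) * del j - coeff (algebraMap ℂ (RatFun N) (α i))

/-- The left ideal of `𝒟̄` generated by the operators `□_l`, for `l` in the lattice of relations
among the `a⁽ʲ⁾`, and by the operators `Z_{i,α}`. -/
def hypergeometricIdeal (a : Fin N → Fin n → ℤ) (α : Fin n → ℂ) :
    Submodule (DiffOp N) (DiffOp N) :=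
  Submodule.span (DiffOp N)
    ({P | ∃ l : Fin N → ℤ, ∑ j, l j • a j = 0 ∧ P = boxOp l} ∪ Set.range (eulerOp a α))

/-- The hypergeometric `𝒟̄`-module. -/
abbrev HypergeometricModule (a : Fin N → Fin n → ℤ) (α : Fin n → ℂ) : Type :=
  DiffOp N ⧸ hypergeometricIdeal a α

/-- The real cone `C(A)` generated by the `a⁽ʲ⁾`. -/
def realCone (a : Fin N → Fin n → ℤ) : PointedCone ℝ (Fin n → ℝ) :=
  PointedCone.hull ℝ (Set.range fun j i => (a j i : ℝ))

/-- `ℓ` (given by its coefficients) is a normalized linear form which defines a face of `C(A)` of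
codimension one. -/
structure IsFacetForm (a : Fin N → Fin n → ℤ) (ℓ : Fin n → ℤ) : Prop where
  coprime : Finset.univ.gcd ℓ = 1
  nonneg : ∀ u ∈ realCone a, 0 ≤ ∑ i, (ℓ i : ℝ) * u i
  codim_one : Module.finrank ℝ
    (Submodule.span ℝ {u | u ∈ realCone a ∧ ∑ i, (ℓ i : ℝ) * u i = 0}) + 1 = n

/-- `α` is nonresonant for `A = {a⁽¹⁾, …, a⁽ᴺ⁾}`. -/
def Nonresonant (a : Fin N → Fin n → ℤ) (α : Fin n → ℂ) : Prop :=
  ∀ ℓ : Fin n → ℤ, IsFacetForm a ℓ → ¬ ∃ z : ℤ, ∑ i, (ℓ i : ℂ) * α i = z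

variable (N n) in
/-- The ring `ℂ(λ)[x₁^{±1}, …, xₙ^{±1}]` of Laurent polynomials: the group algebra of `ℤⁿ`. -/
def Laurent : Type := AddMonoidAlgebra (RatFun N) (Fin n → ℤ)

instance : CommRing (Laurent N n) :=
  inferInstanceAs (CommRing (AddMonoidAlgebra (RatFun N) (Fin n → ℤ)))

instance : Algebra (RatFun N) (Laurent N n) :=
  inferInstanceAs (Algebra (RatFun N) (AddMonoidAlgebra (RatFun N) (Fin n → ℤ)))

/-- The monomial `κ xᵘ`. -/
def mono (u : Fin n → ℤ) (κ : RatFun N) : Laurent N n := AddMonoidAlgebra.single u κ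

theorem mono_mul (u u' : Fin n → ℤ) (κ κ' : RatFun N) :
    mono u κ * mono u' κ' = mono (u + u') (κ * κ') :=
  AddMonoidAlgebra.single_mul_single ..

theorem algebraMap_laurent (κ : RatFun N) : algebraMap (RatFun N) (Laurent N n) κ = mono 0 κ := rfl

theorem laurent_induction {P : Laurent N n → Prop} (x : Laurent N n) (zero : P 0)
    (add : ∀ x y, P x → P y → P (x + y)) (mono : ∀ u κ, P (mono u κ)) : P x :=
  AddMonoidAlgebra.induction_linear (motive := P) x zero add mono

/-- The Laurent polynomial `f = ∑ⱼ λⱼ x^{a⁽ʲ⁾}`. -/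
def hypPoly (a : Fin N → Fin n → ℤ) : Laurent N n := ∑ j, mono (a j) (lam j)

/-- A Laurent polynomial in `x₁, …, x_m`, regarded as one in `x₁, …, x_{m+1}`. -/
def addVariable {m : ℕ} (g : Laurent N m) : Laurent N (m + 1) :=
  AddMonoidAlgebra.mapDomain (fun u => (Fin.snoc u 0 : Fin (m + 1) → ℤ)) g

/-- The variable `xᵢ`. -/
def lvar (i : Fin n) : Laurent N n := mono (Pi.single i 1) 1

/-- The inverse `xᵢ⁻¹` of the variable `xᵢ`. -/
def lvarInv (i : Fin n) : Laurent N n := mono (-Pi.single i 1) 1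

theorem lvarInv_mul (i : Fin n) : (lvarInv i : Laurent N n) * lvar i = 1 := by
  rw [lvarInv, lvar, mono_mul, neg_add_cancel, mul_one]
  rfl

/-- The derivation of the ring of Laurent polynomials which applies a derivation to the
coefficients. -/
def coeffwise (δ : Derivation ℤ (RatFun N) (RatFun N)) : Derivation ℤ (Laurent N n) (Laurent N n) :=
  let F : Laurent N n →+ Laurent N n :=
    { toFun := AddMonoidAlgebra.map (AddMonoidHomClass.toAddMonoidHom δ)
      map_zero' := AddMonoidAlgebra.map_zero _
      map_add' := AddMonoidAlgebra.map_add _ }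
  have hF : ∀ u κ, F (mono u κ) = mono u (δ κ) := fun u κ => AddMonoidAlgebra.map_single _ κ u
  Derivation.mk' F.toIntLinearMap (by
    intro x y
    change F (x * y) = x * F y + y * F x
    induction x using laurent_induction with
    | zero => simp
    | add x x' hx hx' => rw [add_mul, map_add, map_add, hx, hx']; ring
    | mono u κ =>
      induction y using laurent_induction with
      | zero => simp
      | add y y' hy hy' => rw [mul_add, map_add, map_add, hy, hy']; ring
      | mono u' κ' =>
        rw [mono_mul, hF, hF, hF, mono_mul, mono_mul, add_comm u' u]
        refine Eq.trans ?_ (AddMonoidAlgebra.single_add _ _ _)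
        rw [Derivation.leibniz]
        rfl)

theorem coeffwise_mono (δ : Derivation ℤ (RatFun N) (RatFun N)) (u : Fin n → ℤ) (κ : RatFun N) :
    coeffwise δ (mono u κ) = mono u (δ κ) :=
  AddMonoidAlgebra.map_single _ κ u

theorem coeffwise_lvar (δ : Derivation ℤ (RatFun N) (RatFun N)) (i : Fin n) :
    coeffwise δ (lvar i) = 0 := by
  rw [lvar, coeffwise_mono, Derivation.map_one_eq_zero]
  exact AddMonoidAlgebra.single_zero _

theorem coeffwise_comm {δ δ' : Derivation ℤ (RatFun N) (RatFun N)} (h : ∀ κ, δ (δ' κ) = δ' (δ κ))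
    (x : Laurent N n) : coeffwise δ (coeffwise δ' x) = coeffwise δ' (coeffwise δ x) := by
  induction x using laurent_induction with
  | zero => simp
  | add x y hx hy => simp only [map_add, hx, hy]
  | mono u κ => simp only [coeffwise_mono, h]

end Hypergeometric

/-! ### The twisted de Rham complex of the complement of a hypersurface in a torus -/

section TorusOpen

/-- The logarithmic differential `du / u`, where `v` is the inverse of `u`. -/
def dlog {A B : Type} [CommRing A] [CommRing B] [Algebra A B] (u v : B) : Ω[B⁄A] :=
  v • KaehlerDifferential.D A B u

section

variable {A B : Type} [CommRing A] [CommRing B] [Algebra A B] {δ : Derivation ℤ A A}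
  {θ : Derivation ℤ B B}

theorem derivation_inv {u v : B} (h : v * u = 1) : θ v = -(v * v * θ u) := by
  have h1 := congrArg θ h
  rw [Derivation.leibniz, Derivation.map_one_eq_zero, smul_eq_mul, smul_eq_mul] at h1
  have h2 : u * v = 1 := by rw [mul_comm, h]
  calc θ v = (u * v) * θ v := by rw [h2, one_mul]
    _ = v * (v * θ u + u * θ v) - v * v * θ u := by ring
    _ = -(v * v * θ u) := by rw [h1]; ring

theorem derivation_logDeriv_comm {θ' : Derivation ℤ B B} (hθ : ∀ b, θ (θ' b) = θ' (θ b)) {u v : B}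
    (h : v * u = 1) : θ (v * θ' u) = θ' (v * θ u) := by
  simp only [Derivation.leibniz, smul_eq_mul, derivation_inv h, hθ]
  ring

theorem ι_dlog (u v : B) : ExteriorAlgebra.ι B (dlog (A := A) u v) = fn A v * dd A u := by
  rw [dlog, map_smul, Algebra.smul_def]; rfl

theorem dd_inv {u v : B} (h : v * u = 1) : dd A v = -(fn A (v * v) * dd A u) := by
  have h1 := dd_mul (A := A) v u
  rw [h, dd_one] at h1
  have h2 : fn A v * (fn A v * dd A u + fn A u * dd A v) = 0 := by rw [← h1, mul_zero]
  rw [mul_add, ← mul_assoc, ← mul_assoc, ← map_mul, ← map_mul, h, map_one, one_mul] at h2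
  exact eq_neg_of_add_eq_zero_right h2

theorem lieDeriv_dlog (h : Extends δ θ) {u v : B} (huv : v * u = 1) :
    lieDeriv h (ExteriorAlgebra.ι B (dlog (A := A) u v)) = dd A (v * θ u) := by
  rw [ι_dlog, lieDeriv_fn_mul, lieDeriv_dd, derivation_inv huv, dd_mul, dd_inv huv, mul_neg,
    ← mul_assoc, ← map_mul, mul_comm (θ u), map_neg, neg_mul, add_comm]

/-- The operator `L_θ + c` on forms. -/
def lieDerivAdd (h : Extends δ θ) (c : B) : Forms A B →+ Forms A B :=
  lieDeriv h + AddMonoidHom.mulLeft (fn A c)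

theorem lieDerivAdd_apply (h : Extends δ θ) (c : B) (x : Forms A B) :
    lieDerivAdd h c x = lieDeriv h x + fn A c * x := rfl

theorem lieDerivAdd_twistedDiff (h : Extends δ θ) {c : B} {η : Ω[B⁄A]}
    (hc : lieDeriv h (ExteriorAlgebra.ι B η) = dd A c) (x : Forms A B) :
    lieDerivAdd h c (twistedDiff η x) = twistedDiff η (lieDerivAdd h c x) := by
  simp only [lieDerivAdd_apply, twistedDiff_apply, map_add, lieDeriv_mul, hc, lieDeriv_extDeriv,
    extDeriv_fn_mul]
  rw [← mul_assoc (fn A c), fn_comm c (ExteriorAlgebra.ι B η), mul_assoc]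
  abel

theorem lieDerivAdd_mem (h : Extends δ θ) (c : B) (k : ℕ) (x : Forms A B)
    (hx : x ∈ formsDeg A B k) : lieDerivAdd h c x ∈ formsDeg A B k :=
  add_mem (lieDeriv_mem h hx) (fn_mul_mem c hx)

theorem lieDerivAdd_smul (h : Extends δ θ) (c : B) (a : A) (x : Forms A B) :
    lieDerivAdd h c (a • x) = δ a • x + a • lieDerivAdd h c x := by
  rw [lieDerivAdd_apply, lieDerivAdd_apply, lieDeriv_smul, smul_add, mul_smul_comm, add_assoc]

theorem lieDeriv_comm {δ' : Derivation ℤ A A} {θ' : Derivation ℤ B B} (h : Extends δ θ)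
    (h' : Extends δ' θ') (hθ : ∀ b, θ (θ' b) = θ' (θ b)) (x : Forms A B) :
    lieDeriv h (lieDeriv h' x) = lieDeriv h' (lieDeriv h x) := by
  induction x using forms_induction with
  | one => simp [lieDeriv_one]
  | add x y hx hy => simp only [map_add, hx, hy]
  | fn_mul b x hx => simp only [lieDeriv_fn_mul, map_add, hx, hθ]; abel
  | dd_mul c x hx => simp only [lieDeriv_dd_mul, map_add, hx, hθ]; abel

theorem lieDerivAdd_comm {δ' : Derivation ℤ A A} {θ' : Derivation ℤ B B} (h : Extends δ θ)
    (h' : Extends δ' θ') (hθ : ∀ b, θ (θ' b) = θ' (θ b)) {c c' : B} (hc : θ c' = θ' c)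
    (x : Forms A B) :
    lieDerivAdd h c (lieDerivAdd h' c' x) = lieDerivAdd h' c' (lieDerivAdd h c x) := by
  simp only [lieDerivAdd_apply, map_add, lieDeriv_fn_mul, lieDeriv_comm h h' hθ, hc]
  rw [← mul_assoc, ← mul_assoc, ← map_mul, ← map_mul, mul_comm c c']
  abel

theorem dd_smul (a : A) (b : B) : dd A (a • b) = a • dd A b := by
  rw [Algebra.smul_def, dd_mul, dd_base, mul_zero, add_zero, smul_eq_fn_mul]

/-- The map induced by `L_θ + c` on the cohomology of `d + η ∧`, if `L_θ η = dc`. -/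
def connection {η : Ω[B⁄A]} (h : Extends δ θ) {c : B}
    (hc : lieDeriv h (ExteriorAlgebra.ι B η) = dd A c) (k : ℕ) :
    Cohomology η k →+ Cohomology η k :=
  cohomologyMap (T := lieDerivAdd h c) (lieDerivAdd_twistedDiff h hc) (lieDerivAdd_mem h c) k

theorem connection_smul {η : Ω[B⁄A]} (h : Extends δ θ) {c : B}
    (hc : lieDeriv h (ExteriorAlgebra.ι B η) = dd A c) (k : ℕ) (a : A) (z : Cohomology η k) :
    connection h hc k (a • z) = δ a • z + a • connection h hc k z := by
  obtain ⟨x, rfl⟩ := cohomologyClass_surjective η k z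
  rw [← map_smul, connection, cohomologyMap_class, cohomologyMap_class, ← map_smul, ← map_smul,
    ← map_add]
  exact congrArg _ (Subtype.ext (lieDerivAdd_smul h c a (x : Forms A B)))

theorem connection_comm {η : Ω[B⁄A]} {δ' : Derivation ℤ A A} {θ' : Derivation ℤ B B}
    (h : Extends δ θ) (h' : Extends δ' θ') {c c' : B}
    (hc : lieDeriv h (ExteriorAlgebra.ι B η) = dd A c)
    (hc' : lieDeriv h' (ExteriorAlgebra.ι B η) = dd A c')
    (hθ : ∀ b, θ (θ' b) = θ' (θ b)) (hcc' : θ c' = θ' c) (k : ℕ) (z : Cohomology η k) :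
    connection h hc k (connection h' hc' k z) = connection h' hc' k (connection h hc k z) := by
  obtain ⟨x, rfl⟩ := cohomologyClass_surjective η k z
  simp only [connection, cohomologyMap_class]
  exact congrArg _ (Subtype.ext (lieDerivAdd_comm h h' hθ hcc' (x : Forms A B)))

end

variable {N m : ℕ}

/-- The coordinate ring of the open set `Ū` of the torus over `ℂ(λ)` with coordinates
`x₁, …, x_m` where the Laurent polynomial `g` does not vanish. -/
def TorusOpen (g : Laurent N m) : Type := Localization.Away g

variable (g : Laurent N m)

instance : CommRing (TorusOpen g) := inferInstanceAs (CommRing (Localization.Away g))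

instance : Algebra (Laurent N m) (TorusOpen g) :=
  inferInstanceAs (Algebra (Laurent N m) (Localization.Away g))

instance : IsLocalization.Away g (TorusOpen g) :=
  inferInstanceAs (IsLocalization.Away g (Localization.Away g))

instance : Algebra (RatFun N) (TorusOpen g) :=
  ((algebraMap (Laurent N m) (TorusOpen g)).comp (algebraMap (RatFun N) (Laurent N m))).toAlgebra

/-- A Laurent polynomial, as a function on `Ū`. -/
def toOpen : Laurent N m →+* TorusOpen g := algebraMap (Laurent N m) (TorusOpen g)

/-- The function `1/g` on `Ū`. -/
def gInv : TorusOpen g := IsLocalization.Away.invSelf g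

theorem gInv_mul : gInv g * toOpen g g = 1 := by
  rw [mul_comm]; exact IsLocalization.Away.mul_invSelf g

theorem exists_openDeriv (j : Fin N) : ∃ θ : Derivation ℤ (TorusOpen g) (TorusOpen g),
    Extends (A := Laurent N m) (B := TorusOpen g) (coeffwise (partialDeriv j)) θ := by
  have : Algebra.FormallySmooth (Laurent N m) (TorusOpen g) :=
    Algebra.FormallySmooth.of_isLocalization (Submonoid.powers g)
  exact exists_extends _

/-- The (unique) derivation of the coordinate ring of `Ū` which acts on Laurent polynomials by
applying `∂/∂λ_j` to the coefficients. -/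
def openDeriv (j : Fin N) : Derivation ℤ (TorusOpen g) (TorusOpen g) := (exists_openDeriv g j).choose

theorem openDeriv_toOpen (j : Fin N) (p : Laurent N m) :
    openDeriv g j (toOpen g p) = toOpen g (coeffwise (partialDeriv j) p) :=
  (exists_openDeriv g j).choose_spec p

theorem openDeriv_extends (j : Fin N) : Extends (partialDeriv j) (openDeriv g j) := by
  intro κ
  change openDeriv g j (toOpen g (algebraMap _ _ κ)) = toOpen g (algebraMap _ _ (partialDeriv j κ))
  rw [openDeriv_toOpen, algebraMap_laurent, coeffwise_mono, algebraMap_laurent]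

theorem openDeriv_comm (i j : Fin N) (b : TorusOpen g) :
    openDeriv g i (openDeriv g j b) = openDeriv g j (openDeriv g i b) := by
  have h : ⁅openDeriv g i, openDeriv g j⁆ = (0 : Derivation ℤ (TorusOpen g) (TorusOpen g)) := by
    refine derivation_ext_of_localization (R := Laurent N m) (Submonoid.powers g) fun p => ?_
    change ⁅openDeriv g i, openDeriv g j⁆ (toOpen g p) = 0
    rw [Derivation.commutator_apply]
    simp only [openDeriv_toOpen]
    rw [coeffwise_comm (partialDeriv_comm i j), sub_self]
  have h' := congrArg (fun D => D b) h
  rw [Derivation.commutator_apply] at h'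
  exact sub_eq_zero.1 h'

variable (β : Fin (m + 1) → ℂ)

/-- The `1`-form `∑_{i=1}^m βᵢ dxᵢ/xᵢ - β_{m+1} dg/g` on `Ū`. -/
def twistForm : Ω[TorusOpen g⁄RatFun N] :=
  ∑ i : Fin m, algebraMap ℂ (RatFun N) (β i.castSucc) •
      dlog (toOpen g (lvar i)) (toOpen g (lvarInv i))
    - algebraMap ℂ (RatFun N) (β (Fin.last m)) • dlog (toOpen g g) (gInv g)

/-- The function `-β_{m+1} g^{∂_j}/g` on `Ū`, where `g^{∂_j}` is `g` with `∂_j = ∂/∂λ_j` applied to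
its coefficients. -/
def twistFun (j : Fin N) : TorusOpen g :=
  -(algebraMap ℂ (RatFun N) (β (Fin.last m)) •
    (gInv g * toOpen g (coeffwise (partialDeriv j) g)))

theorem lieDeriv_twistForm (j : Fin N) :
    lieDeriv (openDeriv_extends g j) (ExteriorAlgebra.ι (TorusOpen g) (twistForm g β))
      = dd (RatFun N) (twistFun g β j) := by
  have hs : ∀ (c : ℂ) (ω : Ω[TorusOpen g⁄RatFun N]), lieDeriv (openDeriv_extends g j)
      (ExteriorAlgebra.ι (TorusOpen g) (algebraMap ℂ (RatFun N) c • ω))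
        = algebraMap ℂ (RatFun N) c • lieDeriv (openDeriv_extends g j)
          (ExteriorAlgebra.ι (TorusOpen g) ω) := by
    intro c ω
    rw [LinearMap.map_smul_of_tower, lieDeriv_smul, partialDeriv_const, zero_smul, zero_add]
  have hx : ∀ i : Fin m, toOpen g (lvarInv i) * toOpen g (lvar i) = 1 := by
    intro i; rw [← map_mul, lvarInv_mul, map_one]
  rw [twistForm, map_sub, map_sub, map_sum, map_sum, hs, lieDeriv_dlog _ (gInv_mul g),
    Finset.sum_eq_zero, zero_sub, twistFun, map_neg, dd_smul, openDeriv_toOpen]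
  · intro i _
    rw [hs, lieDeriv_dlog _ (hx i), openDeriv_toOpen, coeffwise_lvar]
    simp

theorem openDeriv_smul (j : Fin N) (c : ℂ) (b : TorusOpen g) :
    openDeriv g j (algebraMap ℂ (RatFun N) c • b) = algebraMap ℂ (RatFun N) c • openDeriv g j b := by
  rw [Algebra.smul_def, Derivation.leibniz, openDeriv_extends g j, partialDeriv_const, map_zero,
    smul_zero, add_zero, smul_eq_mul, Algebra.smul_def]

theorem openDeriv_twistFun (i j : Fin N) :
    openDeriv g i (twistFun g β j) = openDeriv g j (twistFun g β i) := by
  rw [twistFun, twistFun, map_neg, map_neg, openDeriv_smul, openDeriv_smul, ← openDeriv_toOpen,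
    ← openDeriv_toOpen, derivation_logDeriv_comm (openDeriv_comm g i j) (gInv_mul g)]

/-- The cohomology `H^k(Ω^•_{Ū/ℂ(λ)}, ∇̃_β)`, where
`∇̃_β(ω) = dω + ∑_{i=1}^m βᵢ dxᵢ/xᵢ ∧ ω - β_{m+1} dg/g ∧ ω`. -/
def TorusCohomology (k : ℕ) : Type := Cohomology (twistForm g β) k

instance (k : ℕ) : AddCommGroup (TorusCohomology g β k) :=
  inferInstanceAs (AddCommGroup (Cohomology (twistForm g β) k))

instance (k : ℕ) : Module (RatFun N) (TorusCohomology g β k) :=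
  inferInstanceAs (Module (RatFun N) (Cohomology (twistForm g β) k))

/-- The action of `∂_j` on `H^k(Ω^•_{Ū/ℂ(λ)}, ∇̃_β)`, induced by `D̃_j = ∂_j - β_{m+1} g^{∂_j}/g` on
forms on `Ū`. Here `∂_j` acts on the coefficients of a form with respect to the basis of exterior
products of the `dxᵢ/xᵢ`; this is the Lie derivative along `openDeriv g j`, which kills the
`dxᵢ/xᵢ`. -/
def torusConnection (k : ℕ) (j : Fin N) : AddMonoid.End (TorusCohomology g β k) :=
  connection (openDeriv_extends g j) (lieDeriv_twistForm g β j) k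

/-- The `𝒟̄`-module structure on `H^k(Ω^•_{Ū/ℂ(λ)}, ∇̃_β)`. -/
instance (k : ℕ) : Module (DiffOp N) (TorusCohomology g β k) :=
  Module.compHom _ (diffOpAction (torusConnection g β k)
    (fun j κ z => connection_smul (openDeriv_extends g j) (lieDeriv_twistForm g β j) k κ z)
    (fun i j z => connection_comm (openDeriv_extends g i) (openDeriv_extends g j)
      (lieDeriv_twistForm g β i) (lieDeriv_twistForm g β j) (openDeriv_comm g i j)
      (openDeriv_twistFun g β i j) k z))

theorem coeff_smul_torusCohomology (k : ℕ) (κ : RatFun N) (z : TorusCohomology g β k) :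
    coeff κ • z = κ • z :=
  diffOpAction_coeff _ _ _ κ z

theorem del_smul_torusCohomology (k : ℕ) (j : Fin N) (z : TorusCohomology g β k) :
    del j • z = torusConnection g β k j z :=
  diffOpAction_del _ _ _ j z

end TorusOpen

/-! ### `𝒟̄`-modules which come from geometry -/

section Geometry

variable (N : ℕ) (B : Type) [CommRing B] [Algebra (RatFun N) B]

/-- The de Rham cohomology `H^k_DR(X/ℂ(λ))` of the affine scheme `X = Spec B` over `ℂ(λ)`: the
cohomology of the complex of relative differential forms on `X`. -/
def DeRham (k : ℕ) : Type := Cohomology (0 : Ω[B⁄RatFun N]) k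

instance (k : ℕ) : AddCommGroup (DeRham N B k) :=
  inferInstanceAs (AddCommGroup (Cohomology (0 : Ω[B⁄RatFun N]) k))

instance (k : ℕ) : Module (RatFun N) (DeRham N B k) :=
  inferInstanceAs (Module (RatFun N) (Cohomology (0 : Ω[B⁄RatFun N]) k))

/-- The action of `∂_j` on `H^k_DR(X/ℂ(λ))` by the Gauss-Manin connection. -/
def deRhamConnection [Algebra.FormallySmooth (RatFun N) B] (k : ℕ) (j : Fin N) :
    AddMonoid.End (DeRham N B k) :=
  gaussManin (B := B) (partialDeriv j) k

/-- The `𝒟̄`-module structure on `H^k_DR(X/ℂ(λ))`, for smooth `X`, given by the Gauss-Manin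
connection. -/
instance [Algebra.FormallySmooth (RatFun N) B] (k : ℕ) : Module (DiffOp N) (DeRham N B k) :=
  Module.compHom _ (diffOpAction (deRhamConnection N B k)
    (fun j κ z => gaussManin_smul (partialDeriv j) k κ z)
    (fun i j z => gaussManin_comm (partialDeriv_comm i j) k z))

variable {N B}

theorem coeff_smul_deRham [Algebra.FormallySmooth (RatFun N) B] (k : ℕ) (κ : RatFun N)
    (z : DeRham N B k) : coeff κ • z = κ • z :=
  diffOpAction_coeff _ _ _ κ z

theorem del_smul_deRham [Algebra.FormallySmooth (RatFun N) B] (k : ℕ) (j : Fin N)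
    (z : DeRham N B k) : del j • z = deRhamConnection N B k j z :=
  diffOpAction_del _ _ _ j z

/-- The endomorphism of `H^k_DR(X/ℂ(λ))` induced by an automorphism of `X`. -/
def deRhamMap (σ : B ≃ₐ[RatFun N] B) (k : ℕ) : DeRham N B k →+ DeRham N B k :=
  pullbackCohomology (σ : B →ₐ[RatFun N] B) k

/-- The `χ`-isotypic component `H^k_DR(X/ℂ(λ))^χ` for an action of a group `G` on `X/ℂ(λ)` and a
complex representation `χ` of `G`: the sum of all `G`-submodules isomorphic to `χ`, i.e. of the
images of all injective `G`-equivariant `ℂ`-linear maps from `χ`. (These images are permuted by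
scalars in `ℂ(λ)`, so that their sum is a `ℂ(λ)`-subspace.) -/
def deRhamIsotypic {G : Type} [Group G] (act : G →* (B ≃ₐ[RatFun N] B)) {V : Type}
    [AddCommGroup V] [Module ℂ V] (χ : Representation ℂ G V) (k : ℕ) :
    Submodule (RatFun N) (DeRham N B k) :=
  Submodule.span (RatFun N) {z | ∃ φ : V →ₛₗ[algebraMap ℂ (RatFun N)] DeRham N B k,
    Function.Injective φ ∧ (∀ s v, φ (χ s v) = deRhamMap (act s) k (φ v)) ∧ ∃ v, φ v = z}

variable (N) in
/-- A `𝒟̄`-module comes from geometry if it is isomorphic to the isotypic component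
`H^k_DR(X/ℂ(λ))^χ` for some smooth variety `X` over `ℂ(λ)`, some action of a finite group `G` on
`X/ℂ(λ)` and some irreducible representation `χ` of `G`. Here `X = Spec B` is required to be affine,
which makes the notion a priori stronger; the de Rham cohomology of an affine `X` is the cohomology
of the complex of global forms. -/
def ComesFromGeometry (M : Type) [AddCommGroup M] [Module (DiffOp N) M] : Prop :=
  ∃ (B : Type) (_ : CommRing B) (_ : Algebra (RatFun N) B) (_ : Algebra.Smooth (RatFun N) B)
    (G : Type) (_ : Group G) (_ : Finite G) (act : G →* (B ≃ₐ[RatFun N] B))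
    (V : Type) (_ : AddCommGroup V) (_ : Module ℂ V) (χ : Representation ℂ G V)
    (_ : χ.IsIrreducible) (k : ℕ) (φ : M →ₗ[DiffOp N] DeRham N B k),
    Function.Injective φ ∧ ∀ z, z ∈ deRhamIsotypic act χ k ↔ ∃ x, φ x = z

end Geometry

end AHyp

end

open AHyp

/-! Let V be the Laurent polynomials in x₁, …, xₙ over K = ℂ(λ), where n = m + 1. Conjugating
xᵢ∂/∂xᵢ by x^{-α} exp(f) gives the operators Dᵢ = xᵢ∂/∂xᵢ + xᵢ∂f/∂xᵢ - αᵢ (`dOp`), and conjugating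
∂/∂λⱼ gives ∂ⱼ + x^{a⁽ʲ⁾} (`delOp`). All of these commute suitably, so 𝒟̄ acts on V/∑DᵢV, and both
the hypergeometric module and the cohomology of Ū are identified with this quotient.

Hypergeometric side. The rule ∂^w ↦ x^{∑ wⱼa⁽ʲ⁾} turns the box relations into equalities of
monomials, and the relations ∂^w Zᵢ into Dᵢx^u (compare `delPow_mul_eulerOp` with `dOp_mono`). This
only sees exponents in the semigroup generated by A. Nonresonance removes the restriction: for a
facet form ℓ, the operator ∑ℓᵢDᵢ sends x^u to ℓ(u - α)x^u plus terms of larger ℓ-value, and ℓ(u - α)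
≠ 0, so modulo ∑DᵢV each monomial can be pushed across every facet (`reach_halfSpace`). Points deep
inside the cone belong to the semigroup (`exists_facets`, from Farkas' lemma and a conductor). The
pushing is done by operators 1 + ∑cᵢDᵢ, which commute with the Dᵢ and act trivially on coinvariants.
Applying one to a relation moves the whole relation into the smaller space, so restriction to the
semigroup changes neither generators nor relations (`sumRange_inf`, `exists_extension`). The outcome
is the criterion `nonempty_equiv_hypergeometricModule`.

Geometric side. Since f = xₙg, integrating x^u x^{-α} exp(xₙg) over xₙ formally produces a Gamma
factor times a power of g. Algebraically this is the map x^u ↦ γ(uₙ) x'^{u'} g^{-uₙ}, where x' and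
u' omit the last component and γ(k + 1) = (αₙ - k)γ(k) (`toFunctions`). On exponents with uₙ large
it is onto the functions on Ū, its kernel is the image of Dₙ (`toFunctions_eq_zero`), and it carries
the other Dᵢ to the components of the twisted differential and `delOp` to the connection. The same
pushing argument permits the restriction to large uₙ (`reach_upper`). As the dxᵢ/xᵢ form a frame,
top cohomology is the space of coinvariants of those components (`EtaleCoords.topClass_eq_zero`),
and the two sides agree.

Rational α. If dα is integral, a suitable monomial h in the xᵢ and g has dh/h equal to d times the
twisting form. On the étale covering wᵈ = h of Ū, multiplication by w turns the twisted differential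
into the ordinary one. The image is the part of de Rham cohomology on which the d-th roots of unity
act by the tautological character (`mem_deRhamIsotypic_cover`). -/

noncomputable section

namespace AHyp

/-! ### Rational polyhedral cones -/

section Polyhedral

/-- Farkas' lemma. -/
theorem farkas {W : Type*} [AddCommGroup W] [Module ℚ W] {N : ℕ} (A : Fin N → W →ₗ[ℚ] ℚ)
    (γ : W →ₗ[ℚ] ℚ) (h : ∀ x, (∀ j, 0 ≤ A j x) → 0 ≤ γ x) :
    ∃ c : Fin N → ℚ, (∀ j, 0 ≤ c j) ∧ γ = ∑ j, c j • A j := by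
  induction N generalizing γ with
  | zero =>
    refine ⟨0, fun j => le_rfl, ?_⟩
    ext x
    have h1 := h x (fun j => j.elim0)
    have h2 := h (-x) (fun j => j.elim0)
    rw [map_neg] at h2
    simp only [Finset.univ_eq_empty, Finset.sum_empty, LinearMap.zero_apply]
    linarith
  | succ N ih =>
    by_cases hγ : ∀ x, (∀ j : Fin N, 0 ≤ A j.castSucc x) → 0 ≤ γ x
    · obtain ⟨c, hc, e⟩ := ih (fun j => A j.castSucc) γ hγ
      refine ⟨Fin.snoc c 0, fun j => ?_, ?_⟩
      · refine Fin.lastCases ?_ (fun i => ?_) j <;> simp [hc]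
      · rw [Fin.sum_univ_castSucc]; simpa using e
    -- Otherwise the last inequality is really needed: it must fail at the point x where `γ` is
    -- negative.
    · push Not at hγ
      obtain ⟨x, hx, hxγ⟩ := hγ
      have hl : A (Fin.last N) x < 0 := by
        by_contra hl
        push Not at hl
        refine absurd (h x fun j => ?_) (not_le.2 hxγ)
        exact Fin.lastCases hl hx j
      -- The map y ↦ y - α(y)x projects onto the hyperplane where the last form vanishes. Composing
      -- the other forms and `γ` with it gives the forms to which the induction hypothesis is
      -- applied.
      let α := (A (Fin.last N) x)⁻¹ • A (Fin.last N)
      have hα : α x = 1 := by simp [α, hl.ne]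
      have hαl : ∀ y, A (Fin.last N) y = A (Fin.last N) x * α y := by
        intro y; simp [α, hl.ne]
      obtain ⟨c, hc, e⟩ := ih (fun j => A j.castSucc - A j.castSucc x • α) (γ - γ x • α) (by
        intro y hy
        have := h (y - α y • x) (by
          intro j
          refine Fin.lastCases ?_ (fun i => ?_) j
          · rw [map_sub, map_smul, hαl y, smul_eq_mul]; apply le_of_eq; ring
          · have := hy i
            simp only [LinearMap.sub_apply, LinearMap.smul_apply, smul_eq_mul] at this
            rw [map_sub, map_smul, smul_eq_mul]; linarith)
        rw [map_sub, map_smul, smul_eq_mul] at this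
        simp only [LinearMap.sub_apply, LinearMap.smul_apply, smul_eq_mul]
        linarith)
      -- The last coefficient is forced by evaluation at x. It is a quotient of a nonpositive by a
      -- negative number.
      refine ⟨Fin.snoc c ((γ x - ∑ j, c j * A j.castSucc x) * (A (Fin.last N) x)⁻¹), fun j => ?_, ?_⟩
      · refine Fin.lastCases ?_ (fun i => ?_) j
        · rw [Fin.snoc_last]
          refine mul_nonneg_of_nonpos_of_nonpos ?_ (inv_nonpos.2 hl.le)
          have : 0 ≤ ∑ j, c j * A j.castSucc x :=
            Finset.sum_nonneg fun j _ => mul_nonneg (hc j) (hx j)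
          linarith
        · simpa using hc i
      · rw [Fin.sum_univ_castSucc]
        ext y
        have e' := congrArg (fun f => f y) e
        simp only [LinearMap.sub_apply, LinearMap.smul_apply, smul_eq_mul, LinearMap.sum_apply,
          mul_sub, Finset.sum_sub_distrib, α] at e'
        simp only [Fin.snoc_castSucc, Fin.snoc_last, LinearMap.add_apply, LinearMap.sum_apply,
          LinearMap.smul_apply, smul_eq_mul]
        have e2 : ∑ j, c j * (A j.castSucc x * ((A (Fin.last N) x)⁻¹ * A (Fin.last N) y))
            = (∑ j, c j * A j.castSucc x) * ((A (Fin.last N) x)⁻¹ * A (Fin.last N) y) := by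
          rw [Finset.sum_mul]; exact Finset.sum_congr rfl fun j _ => by ring
        rw [e2] at e'
        linear_combination e'

variable {V : Type*} [AddCommGroup V] [Module ℚ V] {N : ℕ}

/-- Farkas' lemma on the dual space, with vectors acting by evaluation; linear forms separate
points, so the resulting identity of evaluations is one of vectors. -/
theorem exists_separating (a : Fin N → V) (u : V)
    (hu : ¬ ∃ c : Fin N → ℚ, (∀ j, 0 ≤ c j) ∧ u = ∑ j, c j • a j) :
    ∃ ℓ : Module.Dual ℚ V, (∀ j, 0 ≤ ℓ (a j)) ∧ ℓ u < 0 := by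
  by_contra hcon
  push Not at hcon
  obtain ⟨c, hc, e⟩ := farkas (fun j => Module.Dual.eval ℚ V (a j)) (Module.Dual.eval ℚ V u)
    (fun ℓ h => hcon ℓ h)
  refine hu ⟨c, hc, ?_⟩
  rw [← sub_eq_zero, ← Module.forall_dual_apply_eq_zero_iff ℚ]
  intro f
  have := congrArg (fun F => F f) e
  simp only [Module.Dual.eval_apply, LinearMap.sum_apply, LinearMap.smul_apply] at this
  rw [map_sub, this, map_sum]
  simp

/-- A point outside of a finitely generated cone is separated from it by a facet. -/
theorem exists_separating_facet (a : Fin N → V) (ha : Submodule.span ℚ (Set.range a) = ⊤) (u : V)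
    (hu : ¬ ∃ c : Fin N → ℚ, (∀ j, 0 ≤ c j) ∧ u = ∑ j, c j • a j) :
    ∃ ℓ : Module.Dual ℚ V, (∀ j, 0 ≤ ℓ (a j)) ∧ ℓ u < 0 ∧
      Submodule.span ℚ (insert u {v | ∃ j, ℓ (a j) = 0 ∧ v = a j}) = ⊤ := by
  classical
  -- Among the separating forms, one is taken that vanishes on as many generators as possible. If
  -- its zero set together with u did not span, the form could be tilted to vanish on one more.
  let P : ℕ → Prop := fun k => ∃ ℓ : Module.Dual ℚ V, (∀ j, 0 ≤ ℓ (a j)) ∧ ℓ u < 0 ∧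
    k ≤ (Finset.univ.filter fun j => ℓ (a j) = 0).card
  have hP0 : P 0 := by
    obtain ⟨ℓ, h1, h2⟩ := exists_separating a u hu
    exact ⟨ℓ, h1, h2, Nat.zero_le _⟩
  have hPN : ∀ k, P k → k ≤ N := by
    rintro k ⟨ℓ, -, -, h⟩
    exact h.trans ((Finset.card_le_univ _).trans (by simp))
  obtain ⟨ℓ, h1, h2, h3⟩ := Nat.findGreatest_spec (P := P) (Nat.zero_le N) hP0
  refine ⟨ℓ, h1, h2, ?_⟩
  by_contra hne
  obtain ⟨ℓ', hℓ', hker⟩ := Submodule.exists_le_ker_of_lt_top _ (lt_top_iff_ne_top.2 hne)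
  have hu' : ℓ' u = 0 := hker (Submodule.subset_span (Set.mem_insert _ _))
  have hz : ∀ j, ℓ (a j) = 0 → ℓ' (a j) = 0 := fun j hj =>
    hker (Submodule.subset_span (Set.mem_insert_of_mem _ ⟨j, hj, rfl⟩))
  -- after a change of sign, the form `ℓ'` is negative somewhere
  obtain ⟨μ, hμu, hμz, j0, hj0⟩ : ∃ μ : Module.Dual ℚ V, μ u = 0 ∧
      (∀ j, ℓ (a j) = 0 → μ (a j) = 0) ∧ ∃ j, μ (a j) < 0 := by
    have : ∃ j, ℓ' (a j) ≠ 0 := by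
      by_contra hall
      push Not at hall
      refine hℓ' (LinearMap.ext_on_range ha fun j => ?_)
      rw [hall, LinearMap.zero_apply]
    obtain ⟨j, hj⟩ := this
    rcases lt_or_gt_of_ne hj with hj | hj
    · exact ⟨ℓ', hu', hz, j, hj⟩
    · exact ⟨-ℓ', by simp [hu'], fun i hi => by simp [hz i hi], j, by simpa using hj⟩
  -- The tilt ℓ + tμ leaves the value at u and the old zeros unchanged. The minimal ratio is the
  -- largest t for which it stays nonnegative on all generators, and it then vanishes on the
  -- generator attaining the minimum.
  obtain ⟨i, hi, hmin⟩ := Finset.exists_min_image (Finset.univ.filter fun j => μ (a j) < 0)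
    (fun j => ℓ (a j) / (-μ (a j))) ⟨j0, by simpa using hj0⟩
  simp only [Finset.mem_filter, Finset.mem_univ, true_and] at hi hmin
  set t := ℓ (a i) / (-μ (a i)) with ht
  have ht0 : 0 ≤ t := div_nonneg (h1 i) (by linarith)
  have hnew : P ((Finset.univ.filter fun j => ℓ (a j) = 0).card + 1) := by
    refine ⟨ℓ + t • μ, fun j => ?_, by simp [hμu, h2], ?_⟩
    · simp only [LinearMap.add_apply, LinearMap.smul_apply, smul_eq_mul]
      rcases lt_or_ge (μ (a j)) 0 with hj | hj
      · have := hmin j hj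
        rw [le_div_iff₀ (by linarith)] at this
        linarith
      · exact add_nonneg (h1 j) (mul_nonneg ht0 hj)
    · have hi0 : i ∉ Finset.univ.filter fun j => ℓ (a j) = 0 := by
        simp only [Finset.mem_filter, Finset.mem_univ, true_and]
        intro h; rw [hμz i h] at hi; exact lt_irrefl _ hi
      rw [← Finset.card_insert_of_notMem hi0]
      refine Finset.card_le_card fun j hj => ?_
      simp only [Finset.mem_insert, Finset.mem_filter, Finset.mem_univ, true_and] at hj ⊢
      rcases hj with rfl | hj
      · simp only [LinearMap.add_apply, LinearMap.smul_apply, smul_eq_mul, ht]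
        rw [div_neg, neg_mul, div_mul_cancel₀ _ hi.ne, add_neg_cancel]
      · simp [hj, hμz j hj]
  have := Nat.le_findGreatest (hPN _ hnew) hnew
  omega

variable {n : ℕ}

/-- An integral vector, as a rational vector. -/
def ratVec : (Fin n → ℤ) →+ (Fin n → ℚ) where
  toFun v i := v i
  map_zero' := by ext; simp
  map_add' u v := by ext; simp

theorem ratVec_apply (v : Fin n → ℤ) (i : Fin n) : ratVec v i = v i := rfl

theorem span_ratVec {a : Fin N → Fin n → ℤ} (ha : AddSubgroup.closure (Set.range a) = ⊤) :
    Submodule.span ℚ (Set.range fun j => ratVec (a j)) = ⊤ := by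
  have h : ∀ v : Fin n → ℤ, ratVec v ∈ Submodule.span ℚ (Set.range fun j => ratVec (a j)) := by
    intro v
    have hv : v ∈ AddSubgroup.closure (Set.range a) := by rw [ha]; trivial
    induction hv using AddSubgroup.closure_induction with
    | mem x hx =>
      obtain ⟨j, rfl⟩ := hx
      exact Submodule.subset_span ⟨j, rfl⟩
    | zero => rw [map_zero]; exact zero_mem _
    | add x y _ _ hx hy => rw [map_add]; exact add_mem hx hy
    | neg x _ hx => rw [map_neg]; exact neg_mem hx
  rw [eq_top_iff]
  intro x _
  have : x = ∑ i, x i • ratVec (Pi.single i 1) := by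
    ext k
    simp [ratVec_apply, Pi.single_apply]
  rw [this]
  exact Submodule.sum_mem _ fun i _ => Submodule.smul_mem _ _ (h _)

/-- A nonzero rational vector is proportional to a primitive integral one. -/
theorem exists_primitive (ℓ : Fin n → ℚ) (hℓ : ℓ ≠ 0) :
    ∃ (t : ℚ) (ℓ' : Fin n → ℤ), 0 < t ∧ Finset.univ.gcd ℓ' = 1 ∧ ∀ i, (ℓ' i : ℚ) = t * ℓ i := by
  have hd : ∀ i, ((ℓ i).den : ℤ) ∣ ∏ k, ((ℓ k).den : ℤ) :=
    fun i => Finset.dvd_prod_of_mem _ (Finset.mem_univ i)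
  choose q hq using hd
  have hdpos : (0 : ℚ) < ((∏ k, ((ℓ k).den : ℤ) : ℤ) : ℚ) := by
    have : (0 : ℤ) < ∏ k, ((ℓ k).den : ℤ) := Finset.prod_pos fun k _ => by
      exact_mod_cast (ℓ k).den_pos
    exact_mod_cast this
  set d : ℤ := ∏ k, ((ℓ k).den : ℤ) with hddef
  have hz : ∀ i, (((ℓ i).num * q i : ℤ) : ℚ) = d * ℓ i := by
    intro i
    rw [hq i]
    push_cast
    have h := Rat.mul_den_eq_num (ℓ i)
    rw [← h]; ring
  obtain ⟨i0, hi0⟩ := Function.ne_iff.1 hℓ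
  obtain ⟨ℓ', h1, h2⟩ := Finset.extract_gcd (fun i => (ℓ i).num * q i)
    (⟨i0, Finset.mem_univ _⟩ : (Finset.univ : Finset (Fin n)).Nonempty)
  set e : ℤ := Finset.univ.gcd fun i => (ℓ i).num * q i with hedef
  have he0 : e ≠ 0 := by
    intro h0
    have := h1 i0 (Finset.mem_univ _)
    rw [h0, zero_mul] at this
    have h3 := hz i0
    rw [this, Int.cast_zero] at h3
    exact hi0 (by simpa [hdpos.ne'] using h3.symm)
  have hepos : (0 : ℚ) < e := by
    have : 0 ≤ e := Int.nonneg_of_normalize_eq_self (Finset.normalize_gcd)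
    exact_mod_cast lt_of_le_of_ne this (Ne.symm he0)
  refine ⟨d / e, ℓ', div_pos hdpos hepos, h2, fun i => ?_⟩
  have h3 := hz i
  rw [h1 i (Finset.mem_univ _)] at h3
  push_cast at h3
  field_simp
  linarith

/-- A primitive integral form whose zero set on `A`, together with one further vector, spans the
space, and which is nonnegative on `A`, defines a facet. -/
theorem isFacetForm_of_span {a : Fin N → Fin n → ℤ} {ℓ : Fin n → ℤ} (hℓ : Finset.univ.gcd ℓ = 1)
    (hn : ∀ j, 0 ≤ ∑ i, ℓ i * a j i) (u : Fin n → ℚ)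
    (hs : Submodule.span ℚ (insert u {v | ∃ j, ∑ i, ℓ i * a j i = 0 ∧ v = ratVec (a j)}) = ⊤) :
    IsFacetForm a ℓ := by
  have hreal : ∀ j, (0 : ℝ) ≤ ∑ i, (ℓ i : ℝ) * (a j i : ℝ) := by
    intro j; exact_mod_cast hn j
  let L : (Fin n → ℝ) →ₗ[ℝ] ℝ := ∑ i, (ℓ i : ℝ) • LinearMap.proj i
  have hL : ∀ x, L x = ∑ i, (ℓ i : ℝ) * x i := by intro x; simp [L]
  refine ⟨hℓ, ?_, ?_⟩
  · intro x hx
    induction hx using Submodule.span_induction with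
    | mem x hx => obtain ⟨j, rfl⟩ := hx; exact hreal j
    | zero => simp
    | add x y _ _ hx hy =>
      simp only [Pi.add_apply, mul_add, Finset.sum_add_distrib]; exact add_nonneg hx hy
    | smul c x _ hx =>
      have : ∑ i, (ℓ i : ℝ) * (c • x) i = (c : ℝ) * ∑ i, (ℓ i : ℝ) * x i := by
        rw [Finset.mul_sum]
        refine Finset.sum_congr rfl fun i _ => ?_
        change (ℓ i : ℝ) * ((c : ℝ) * x i) = _
        ring
      rw [this]
      exact mul_nonneg c.2 hx
  · set S : Set (Fin n → ℝ) := {u | u ∈ realCone a ∧ ∑ i, (ℓ i : ℝ) * u i = 0}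
    have hL0 : L ≠ 0 := by
      intro h0
      have hz : ∀ i, ℓ i = 0 := by
        intro i
        have := congrArg (fun f => f (Pi.single i 1)) h0
        simp only [hL, Pi.single_apply] at this
        simpa using this
      have hg : Finset.univ.gcd ℓ = 0 := Finset.gcd_eq_zero_iff.2 fun i _ => hz i
      rw [hg] at hℓ
      exact zero_ne_one hℓ
    have hle : Submodule.span ℝ S ≤ LinearMap.ker L := by
      rw [Submodule.span_le]
      rintro x ⟨-, hx⟩
      change L x = 0
      rw [hL, hx]
    have h1 : Module.finrank ℝ (LinearMap.ker L) + 1 = n := by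
      have hr : LinearMap.range L = ⊤ := LinearMap.range_eq_top.2 (LinearMap.surjective hL0)
      have := LinearMap.finrank_range_add_finrank_ker L
      rw [hr, finrank_top, Module.finrank_self, Module.finrank_fin_fun] at this
      omega
    have h2 : Module.finrank ℝ (Submodule.span ℝ S) ≤ Module.finrank ℝ (LinearMap.ker L) :=
      Submodule.finrank_mono hle
    let cast : (Fin n → ℚ) →ₗ[ℚ] (Fin n → ℝ) :=
      { toFun := fun x i => x i
        map_add' := by intro x y; ext; simp
        map_smul' := by intro c x; ext; simp [Rat.smul_def] }
    -- One extra vector completes the span of the face to the whole space, so the codimension is at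
    -- most one; it is at least one because the face lies in the kernel of the nonzero form L.
    have h3 : Submodule.span ℝ S ⊔ Submodule.span ℝ {cast u} = ⊤ := by
      have key : ∀ x : Fin n → ℚ, cast x ∈ Submodule.span ℝ S ⊔ Submodule.span ℝ {cast u} := by
        intro x
        have hx : x ∈ Submodule.span ℚ (insert u {v | ∃ j, ∑ i, ℓ i * a j i = 0 ∧ v = ratVec (a j)}) := by
          rw [hs]; trivial
        induction hx using Submodule.span_induction with
        | mem x hx =>
          rcases hx with rfl | ⟨j, hj, rfl⟩
          · exact Submodule.mem_sup_right (Submodule.subset_span rfl)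
          · refine Submodule.mem_sup_left (Submodule.subset_span ?_)
            have hc : cast (ratVec (a j)) = fun i => (a j i : ℝ) := by
              ext i; change (((a j i : ℤ) : ℚ) : ℝ) = _; simp
            rw [hc]
            refine ⟨Submodule.subset_span ⟨j, rfl⟩, ?_⟩
            change ∑ i, (ℓ i : ℝ) * (a j i : ℝ) = 0
            exact_mod_cast hj
        | zero => rw [map_zero]; exact zero_mem _
        | add x y _ _ hx hy => rw [map_add]; exact add_mem hx hy
        | smul c x _ hx =>
          rw [map_smul, ← Rat.cast_smul_eq_qsmul ℝ]
          exact Submodule.smul_mem _ _ hx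
      rw [eq_top_iff]
      intro x _
      have : x = ∑ i, x i • cast (Pi.single i 1) := by
        ext k
        have : ∀ i, cast (Pi.single i 1) k = if k = i then 1 else 0 := by
          intro i
          change ((Pi.single i (1 : ℚ) : Fin n → ℚ) k : ℝ) = _
          rw [Pi.single_apply]; split_ifs <;> simp
        simp [this]
      rw [this]
      exact Submodule.sum_mem _ fun i _ => Submodule.smul_mem _ _ (key _)
    have h4 := Submodule.finrank_add_le_finrank_add_finrank (Submodule.span ℝ S)
      (Submodule.span ℝ {cast u})
    rw [h3, finrank_top, Module.finrank_fin_fun] at h4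
    have h5 := finrank_span_le_card (R := ℝ) ({cast u} : Set (Fin n → ℝ))
    simp only [Set.toFinset_singleton, Finset.card_singleton] at h5
    omega

end Polyhedral

/-! ### Facets of the cone and the conductor of the semigroup -/

section Conductor

variable {N n : ℕ}

/-- A primitive form, nonnegative on `A`, whose zero set on `A` is as large as possible. -/
structure IsFacetData (a : Fin N → Fin n → ℤ) (T : Finset (Fin N)) (ℓ : Fin n → ℤ) : Prop where
  coprime : Finset.univ.gcd ℓ = 1
  nonneg : ∀ j, 0 ≤ ∑ i, ℓ i * a j i
  mem_iff : ∀ j, j ∈ T ↔ ∑ i, ℓ i * a j i = 0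
  span : ∃ u, Submodule.span ℚ (insert u {v | ∃ j, ∑ i, ℓ i * a j i = 0 ∧ v = ratVec (a j)}) = ⊤

/-- A facet form is determined by the set of generators on which it vanishes, so one form per subset
of the generators suffices, and there are finitely many. A point outside the cone violates the one
attached to the zero set of a separating facet. -/
theorem exists_facets_cone {a : Fin N → Fin n → ℤ}
    (ha : AddSubgroup.closure (Set.range a) = ⊤) :
    ∃ F : Finset (Fin n → ℤ), (∀ ℓ ∈ F, IsFacetForm a ℓ) ∧
      ∀ u : Fin n → ℤ, (∀ ℓ ∈ F, 0 ≤ ∑ i, ℓ i * u i) →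
        ∃ c : Fin N → ℚ, (∀ j, 0 ≤ c j) ∧ ratVec u = ∑ j, c j • ratVec (a j) := by
  classical
  -- Subsets that are not the zero set of a facet get the junk value 0 and are filtered out below.
  have hf : ∀ T : Finset (Fin N), ∃ ℓ, (∃ ℓ', IsFacetData a T ℓ') → IsFacetData a T ℓ := by
    intro T
    by_cases h : ∃ ℓ', IsFacetData a T ℓ'
    · exact ⟨h.choose, fun _ => h.choose_spec⟩
    · exact ⟨0, fun h' => absurd h' h⟩
  choose f hf using hf
  refine ⟨(Finset.univ.filter fun T => ∃ ℓ', IsFacetData a T ℓ').image f, ?_, ?_⟩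
  · intro ℓ hℓ
    obtain ⟨T, hT, rfl⟩ := Finset.mem_image.1 hℓ
    have h := hf T (Finset.mem_filter.1 hT).2
    obtain ⟨u, hu⟩ := h.span
    exact isFacetForm_of_span h.coprime h.nonneg u hu
  · intro u hu
    by_contra hcon
    obtain ⟨ℓ, h1, h2, h3⟩ := exists_separating_facet _ (span_ratVec ha) (ratVec u) hcon
    have hℓ : ∀ x, ℓ x = ∑ i, ℓ (Pi.single i 1) * x i := by
      intro x
      conv_lhs => rw [← Finset.univ_sum_single x, map_sum]
      refine Finset.sum_congr rfl fun i _ => ?_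
      have : (Pi.single i (x i) : Fin n → ℚ) = x i • Pi.single i (1 : ℚ) := by
        rw [← Pi.single_smul, smul_eq_mul, mul_one]
      rw [this, map_smul, smul_eq_mul, mul_comm]
    obtain ⟨t, ℓ', ht, hg, hℓ'⟩ := exists_primitive (fun i => ℓ (Pi.single i 1)) (by
      intro h0
      rw [hℓ] at h2
      simp only [funext_iff] at h0
      simp [h0] at h2)
    have hval : ∀ v : Fin n → ℤ, ((∑ i, ℓ' i * v i : ℤ) : ℚ) = t * ℓ (ratVec v) := by
      intro v
      rw [hℓ, Finset.mul_sum]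
      push_cast
      exact Finset.sum_congr rfl fun i _ => by rw [hℓ', ratVec_apply, mul_assoc]
    have hzero : ∀ v : Fin n → ℤ, ∑ i, ℓ' i * v i = 0 ↔ ℓ (ratVec v) = 0 := by
      intro v
      rw [← Int.cast_eq_zero (α := ℚ), hval, mul_eq_zero, or_iff_right ht.ne']
    have hdata : IsFacetData a (Finset.univ.filter fun j => ℓ (ratVec (a j)) = 0) ℓ' := by
      refine ⟨hg, fun j => ?_, fun j => ?_, ratVec u, ?_⟩
      · have := mul_nonneg ht.le (h1 j)
        rw [← hval] at this
        exact_mod_cast this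
      · rw [hzero]; simp
      · simp only [hzero]; exact h3
    have hT := hf _ ⟨ℓ', hdata⟩
    have hmem := hu _ (Finset.mem_image_of_mem f (Finset.mem_filter.2 ⟨Finset.mem_univ _, ℓ', hdata⟩))
    set T := Finset.univ.filter fun j => ℓ (ratVec (a j)) = 0 with hTdef
    let L : (Fin n → ℚ) →ₗ[ℚ] ℚ := ∑ i, (f T i : ℚ) • LinearMap.proj i
    have hL : ∀ v : Fin n → ℤ, L (ratVec v) = ((∑ i, f T i * v i : ℤ) : ℚ) := by
      intro v; simp [L, ratVec_apply]
    -- Both forms vanish on the generators indexed by T, and these span together with u. If L were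
    -- nonnegative at u, the factor would be nonpositive, so L would be both ≤ 0 and ≥ 0 on A, hence
    -- zero, which contradicts primitivity.
    have hprop : L = (L (ratVec u) / ℓ (ratVec u)) • ℓ := by
      refine LinearMap.ext_on h3 ?_
      rintro x (rfl | ⟨j, hj, rfl⟩)
      · simp [h2.ne]
      · have hjT : j ∈ T := by simp [hTdef, hj]
        rw [LinearMap.smul_apply, hj, smul_zero, hL, (hT.mem_iff j).1 hjT, Int.cast_zero]
    have hLu : 0 ≤ L (ratVec u) := by rw [hL]; exact_mod_cast hmem
    have hc : L (ratVec u) / ℓ (ratVec u) ≤ 0 := div_nonpos_of_nonneg_of_nonpos hLu h2.le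
    have hL0 : L = 0 := by
      refine LinearMap.ext_on_range (span_ratVec ha) fun j => ?_
      apply le_antisymm
      · rw [hprop]; exact mul_nonpos_of_nonpos_of_nonneg hc (h1 j)
      · rw [hL, LinearMap.zero_apply]; exact_mod_cast hT.nonneg j
    have hz : ∀ i, f T i = 0 := by
      intro i
      have := hL (Pi.single i 1)
      rw [hL0] at this
      simpa [Pi.single_apply] using this.symm
    have hg := hT.coprime
    rw [Finset.gcd_eq_zero_iff.2 fun i _ => hz i] at hg
    exact zero_ne_one hg

/-- The integral points of the cone lie in a translate of the semigroup generated by `A`. -/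
theorem exists_conductor {a : Fin N → Fin n → ℤ}
    (ha : AddSubgroup.closure (Set.range a) = ⊤) :
    ∃ c : Fin n → ℤ, ∀ v : Fin n → ℤ,
      (∃ q : Fin N → ℚ, (∀ j, 0 ≤ q j) ∧ ratVec v = ∑ j, q j • ratVec (a j)) →
        v + c ∈ AddSubmonoid.closure (Set.range a) := by
  classical
  -- Since A generates ℤⁿ as a group, each lattice vector is a difference of two elements of the
  -- semigroup.
  have hp : ∀ v : Fin n → ℤ, ∃ p ∈ AddSubmonoid.closure (Set.range a),
      v + p ∈ AddSubmonoid.closure (Set.range a) := by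
    intro v
    have hv : v ∈ AddSubgroup.closure (Set.range a) := by rw [ha]; trivial
    induction hv using AddSubgroup.closure_induction with
    | mem x hx => exact ⟨0, zero_mem _, by simpa using AddSubmonoid.subset_closure hx⟩
    | zero => exact ⟨0, zero_mem _, by simp⟩
    | add x y _ _ hx hy =>
      obtain ⟨p, hp, hxp⟩ := hx
      obtain ⟨q, hq, hyq⟩ := hy
      exact ⟨p + q, add_mem hp hq, by rw [add_add_add_comm]; exact add_mem hxp hyq⟩
    | neg x _ hx =>
      obtain ⟨p, hp, hxp⟩ := hx
      exact ⟨x + p, hxp, by rwa [neg_add_cancel_left]⟩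
  choose p hp hvp using hp
  -- Rounding down the coefficients of a point of the cone leaves a remainder ∑ (qⱼ - ⌊qⱼ⌋)a⁽ʲ⁾ in
  -- the box [-M, M]. The box contains finitely many lattice points r, and the conductor is the sum
  -- of all their corrections `p r`.
  let M : Fin n → ℤ := fun i => ∑ j, |a j i|
  refine ⟨∑ r ∈ Finset.Icc (-M) M, p r, ?_⟩
  rintro v ⟨q, hq, hv⟩
  set s : Fin n → ℤ := ∑ j, ⌊q j⌋₊ • a j with hs
  have hsmem : s ∈ AddSubmonoid.closure (Set.range a) :=
    sum_mem fun j _ => nsmul_mem (AddSubmonoid.subset_closure (Set.mem_range_self j)) _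
  have hr : ∀ i, |v i - s i| ≤ M i := by
    intro i
    have h1 : ((v i - s i : ℤ) : ℚ) = ∑ j, (q j - ⌊q j⌋₊) * (a j i : ℚ) := by
      have := congrFun hv i
      simp only [ratVec_apply, Finset.sum_apply, Pi.smul_apply, smul_eq_mul] at this
      rw [Int.cast_sub, this, hs]
      simp only [Finset.sum_apply, Pi.smul_apply, Int.cast_sum, sub_mul, Finset.sum_sub_distrib]
      simp
    have h2 : ((|v i - s i| : ℤ) : ℚ) ≤ ((M i : ℤ) : ℚ) := by
      rw [Int.cast_abs, h1]
      refine (Finset.abs_sum_le_sum_abs _ _).trans ?_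
      rw [Int.cast_sum]
      refine Finset.sum_le_sum fun j _ => ?_
      rw [abs_mul, Int.cast_abs]
      have h3 : |q j - ⌊q j⌋₊| ≤ 1 := by
        have h4 := Nat.floor_le (hq j)
        have h5 := Nat.lt_floor_add_one (q j)
        rw [abs_le]; constructor <;> linarith
      exact mul_le_of_le_one_left (abs_nonneg _) h3
    exact_mod_cast h2
  have hmem : v - s ∈ Finset.Icc (-M) M := by
    rw [Finset.mem_Icc]
    exact ⟨fun i => (abs_le.1 (hr i)).1, fun i => (abs_le.1 (hr i)).2⟩
  -- The correction for the actual remainder v - s is singled out; the remaining ones merely add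
  -- semigroup elements.
  rw [← Finset.add_sum_erase _ _ hmem,
    show v + (p (v - s) + ∑ r ∈ (Finset.Icc (-M) M).erase (v - s), p r)
      = s + (v - s + p (v - s)) + ∑ r ∈ (Finset.Icc (-M) M).erase (v - s), p r by abel]
  exact add_mem (add_mem hsmem (hvp _)) (sum_mem fun r _ => hp r)

/-- A point which is deep enough inside of the cone lies in the semigroup generated by `A`. -/
theorem exists_facets {a : Fin N → Fin n → ℤ} (ha : AddSubgroup.closure (Set.range a) = ⊤) :
    ∃ (F : Finset (Fin n → ℤ)) (K : ℤ), (∀ ℓ ∈ F, IsFacetForm a ℓ) ∧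
      ∀ u : Fin n → ℤ, (∀ ℓ ∈ F, K ≤ ∑ i, ℓ i * u i) →
        u ∈ AddSubmonoid.closure (Set.range a) := by
  obtain ⟨F, hF, hcone⟩ := exists_facets_cone ha
  obtain ⟨c, hc⟩ := exists_conductor ha
  -- This depth is enough for u - c to remain in the cone.
  refine ⟨F, ∑ ℓ ∈ F, |∑ i, ℓ i * c i|, hF, fun u hu => ?_⟩
  have h := hc (u - c) (hcone _ fun ℓ hℓ => ?_)
  · rwa [sub_add_cancel] at h
  · have h1 := hu ℓ hℓ
    have h2 : |∑ i, ℓ i * c i| ≤ ∑ ℓ ∈ F, |∑ i, ℓ i * c i| :=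
      Finset.single_le_sum (f := fun ℓ : Fin n → ℤ => |∑ i, ℓ i * c i|)
        (fun _ _ => abs_nonneg _) hℓ
    have h3 := le_abs_self (∑ i, ℓ i * c i)
    simp only [Pi.sub_apply, mul_sub, Finset.sum_sub_distrib]
    linarith

theorem IsFacetForm.nonneg_gen {a : Fin N → Fin n → ℤ} {ℓ : Fin n → ℤ} (h : IsFacetForm a ℓ)
    (j : Fin N) : 0 ≤ ∑ i, ℓ i * a j i := by
  have := h.nonneg (fun i => (a j i : ℝ)) (Submodule.subset_span ⟨j, rfl⟩)
  exact_mod_cast this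

end Conductor

/-! ### Coinvariants of commuting operators -/

section Coinvariants

variable {K V X ι : Type*} [CommRing K] [AddCommGroup V] [Module K V] [AddCommGroup X] [Module K X]
  [Fintype ι] (D : ι → Module.End K V)

/-- The subspace `∑ᵢ Dᵢ(W)`. -/
def sumRange (W : Submodule K V) : Submodule K V where
  carrier := {x | ∃ w : ι → V, (∀ i, w i ∈ W) ∧ x = ∑ i, D i (w i)}
  zero_mem' := ⟨0, fun _ => zero_mem _, by simp⟩
  add_mem' := by
    rintro _ _ ⟨w, hw, rfl⟩ ⟨w', hw', rfl⟩
    exact ⟨w + w', fun i => add_mem (hw i) (hw' i), by simp [Finset.sum_add_distrib]⟩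
  smul_mem' := by
    rintro c _ ⟨w, hw, rfl⟩
    exact ⟨c • w, fun i => Submodule.smul_mem _ _ (hw i), by simp [Finset.smul_sum]⟩

variable {D}

theorem apply_mem_sumRange {W : Submodule K V} (i : ι) {w : V} (hw : w ∈ W) :
    D i w ∈ sumRange D W := by
  classical
  refine ⟨Pi.single i w, fun k => ?_, ?_⟩
  · rcases eq_or_ne k i with rfl | h
    · simpa using hw
    · simp [h]
  · rw [Finset.sum_eq_single i]
    · simp
    · intro k _ h; simp [h]
    · simp

theorem sumRange_le {W W' : Submodule K V} (h : ∀ i, ∀ w ∈ W, D i w ∈ W') :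
    sumRange D W ≤ W' := by
  rintro _ ⟨w, hw, rfl⟩
  exact Submodule.sum_mem _ fun i _ => h i _ (hw i)

theorem sumRange_mono {W W' : Submodule K V} (h : W ≤ W') : sumRange D W ≤ sumRange D W' :=
  sumRange_le fun i _ hw => apply_mem_sumRange i (h hw)

variable (D)

/-- The monoid generated by the operators `1 + ∑ᵢ cᵢ Dᵢ`. -/
def unipotentOps : Submonoid (Module.End K V) :=
  Submonoid.closure {T | ∃ c : ι → K, T = 1 + ∑ i, c i • D i}

/-- A subspace is stable under the operators `Dᵢ`. -/
def IsStable (W : Submodule K V) : Prop := ∀ i, ∀ w ∈ W, D i w ∈ W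

variable {D}

theorem isStable_top {ι : Type*} {D : ι → Module.End K V} : IsStable D ⊤ := fun _ _ _ => trivial

theorem IsStable.apply_mem {W : Submodule K V} (hW : IsStable D W) {T : Module.End K V}
    (hT : T ∈ unipotentOps D) {w : V} (hw : w ∈ W) : T w ∈ W := by
  induction hT using Submonoid.closure_induction generalizing w with
  | mem T hT =>
    obtain ⟨c, rfl⟩ := hT
    simp only [LinearMap.add_apply, Module.End.one_apply, LinearMap.sum_apply,
      LinearMap.smul_apply]
    exact add_mem hw (Submodule.sum_mem _ fun i _ => Submodule.smul_mem _ _ (hW i w hw))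
  | one => exact hw
  | mul S T _ _ hS hT => exact hS (hT hw)

/-- This is the point of `unipotentOps`: on a stable W they induce the identity on W/∑DᵢW, so a
vector may be replaced by its image without changing its class. -/
theorem IsStable.apply_sub_mem {W : Submodule K V} (hW : IsStable D W) {T : Module.End K V}
    (hT : T ∈ unipotentOps D) {w : V} (hw : w ∈ W) : T w - w ∈ sumRange D W := by
  induction hT using Submonoid.closure_induction generalizing w with
  | mem T hT =>
    obtain ⟨c, rfl⟩ := hT
    simp only [LinearMap.add_apply, Module.End.one_apply, LinearMap.sum_apply,
      LinearMap.smul_apply, add_sub_cancel_left]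
    exact Submodule.sum_mem _ fun i _ => Submodule.smul_mem _ _ (apply_mem_sumRange i hw)
  | one => simp
  | mul S T _ hT' hS hT =>
    have := add_mem (hS (hW.apply_mem hT' hw)) (hT hw)
    rwa [sub_add_sub_cancel] at this

theorem unipotentOps_commute (hD : ∀ i j, Commute (D i) (D j)) {T : Module.End K V}
    (hT : T ∈ unipotentOps D) (i : ι) : Commute T (D i) := by
  induction hT using Submonoid.closure_induction with
  | mem T hT =>
    obtain ⟨c, rfl⟩ := hT
    exact (Commute.one_left _).add_left (Commute.sum_left _ _ _ fun j _ => (hD j i).smul_left _)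
  | one => exact Commute.one_left _
  | mul S T _ _ hS hT => exact hS.mul_left hT

theorem unipotentOps_commute' (hD : ∀ i j, Commute (D i) (D j)) {S T : Module.End K V}
    (hS : S ∈ unipotentOps D) (hT : T ∈ unipotentOps D) : Commute S T := by
  induction hT using Submonoid.closure_induction with
  | mem T hT =>
    obtain ⟨c, rfl⟩ := hT
    exact (Commute.one_right _).add_right
      (Commute.sum_right _ _ _ fun j _ => (unipotentOps_commute hD hS j).smul_right _)
  | one => exact Commute.one_right _
  | mul S T _ _ hS hT => exact hS.mul_right hT

/-- The vectors which are mapped to a stable subspace by one of the operators in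
`unipotentOps D`. -/
def reach (hD : ∀ i j, Commute (D i) (D j)) {W : Submodule K V} (hW : IsStable D W) :
    Submodule K V where
  carrier := {v | ∃ T ∈ unipotentOps D, T v ∈ W}
  zero_mem' := ⟨1, one_mem _, by simp⟩
  add_mem' := by
    rintro v v' ⟨T, hT, hv⟩ ⟨T', hT', hv'⟩
    -- The operators commute and preserve W, so the product serves both vectors.
    refine ⟨T * T', mul_mem hT hT', ?_⟩
    rw [map_add]
    refine add_mem ?_ (hW.apply_mem hT hv')
    rw [(unipotentOps_commute' hD hT hT').eq]
    exact hW.apply_mem hT' hv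
  smul_mem' := by
    rintro c v ⟨T, hT, hv⟩
    exact ⟨T, hT, by rw [map_smul]; exact Submodule.smul_mem _ _ hv⟩

variable (hD : ∀ i j, Commute (D i) (D j))

theorem mem_reach_of_apply {W : Submodule K V} {hW : IsStable D W} {T : Module.End K V}
    (hT : T ∈ unipotentOps D) {v : V} (hv : T v ∈ reach hD hW) : v ∈ reach hD hW := by
  obtain ⟨S, hS, h⟩ := hv
  exact ⟨S * T, mul_mem hS hT, h⟩

/-- The subspaces are reached one after another. Stability keeps each later operator from leaving a
subspace already reached. -/
theorem exists_apply_mem {σ : Type*} (F : Finset σ) (W : σ → Submodule K V)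
    (hW : ∀ s, IsStable D (W s)) (h : ∀ s ∈ F, reach hD (hW s) = ⊤) (v : V) :
    ∃ T ∈ unipotentOps D, ∀ s ∈ F, T v ∈ W s := by
  classical
  induction F using Finset.induction_on generalizing v with
  | empty => exact ⟨1, one_mem _, by simp⟩
  | insert s F _ ih =>
    obtain ⟨T, hT, hv⟩ := ih (fun t ht => h t (Finset.mem_insert_of_mem ht)) v
    have hs : T v ∈ reach hD (hW s) := by rw [h s (Finset.mem_insert_self _ _)]; trivial
    obtain ⟨S, hS, hs⟩ := hs
    refine ⟨S * T, mul_mem hS hT, fun t ht => ?_⟩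
    rcases Finset.mem_insert.1 ht with rfl | ht
    · exact hs
    · exact (hW t).apply_mem hS (hv t ht)

/-- Injectivity of W/∑DᵢW → V/∑DᵢV. If v = ∑Dᵢwᵢ, choose T with all Twᵢ in W. Then Tv = ∑DᵢTwᵢ is a
relation inside W, and v differs from Tv by another such relation. -/
theorem sumRange_inf (hD : ∀ i j, Commute (D i) (D j)) {W : Submodule K V} {hW : IsStable D W} (hr : reach hD hW = ⊤) {v : V}
    (hv : v ∈ W) (hv' : v ∈ sumRange D ⊤) : v ∈ sumRange D W := by
  obtain ⟨w, -, rfl⟩ := hv'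
  -- one operator which works for all `w i`
  have key : ∀ F : Finset ι, ∃ T ∈ unipotentOps D, ∀ i ∈ F, T (w i) ∈ W := by
    classical
    intro F
    induction F using Finset.induction_on with
    | empty => exact ⟨1, one_mem _, by simp⟩
    | insert s F _ ih =>
      obtain ⟨T, hT, hv⟩ := ih
      have hs : T (w s) ∈ reach hD hW := by rw [hr]; trivial
      obtain ⟨S, hS, hs⟩ := hs
      refine ⟨S * T, mul_mem hS hT, fun t ht => ?_⟩
      rcases Finset.mem_insert.1 ht with rfl | ht
      · exact hs
      · exact hW.apply_mem hS (hv t ht)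
  obtain ⟨T, hT, h⟩ := key Finset.univ
  have h1 := hW.apply_sub_mem hT hv
  have h2 : T (∑ i, D i (w i)) ∈ sumRange D W := by
    rw [map_sum]
    refine Submodule.sum_mem _ fun i _ => ?_
    have : T (D i (w i)) = D i (T (w i)) :=
      congrArg (fun S => S (w i)) (unipotentOps_commute hD hT i).eq
    rw [this]
    exact apply_mem_sumRange i (h i (Finset.mem_univ i))
  have := sub_mem h2 h1
  rwa [sub_sub_cancel] at this

/-- Linear maps which kill `∑ᵢ Dᵢ(W)` extend from `W` to `V`, so as to kill `∑ᵢ Dᵢ(V)`. -/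
theorem exists_extension {W : Submodule K V} {hW : IsStable D W} (hr : reach hD hW = ⊤)
    (F : V →ₗ[K] X) (hF : ∀ v ∈ sumRange D W, F v = 0) :
    ∃ F' : V →ₗ[K] X, (∀ v ∈ W, F' v = F v) ∧ (∀ v ∈ sumRange D ⊤, F' v = 0) ∧
      ((∀ v ∈ W, F v = 0 → v ∈ sumRange D W) → ∀ v, F' v = 0 → v ∈ sumRange D ⊤) ∧
      ∀ (T : V →+ V) (T' : X →+ X), (∀ v ∈ W, T v ∈ W ∧ F (T v) = T' (F v)) →
        (∀ v ∈ sumRange D ⊤, T v ∈ sumRange D ⊤) → ∀ v, F' (T v) = T' (F' v) := by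
  -- Surjectivity of W/∑DᵢW → V/∑DᵢV. The extension is F evaluated at such a representative w of v;
  -- by `sumRange_inf` its value does not depend on the choice.
  have hex : ∀ v, ∃ w ∈ W, w - v ∈ sumRange D ⊤ := by
    intro v
    have hv : v ∈ reach hD hW := by rw [hr]; trivial
    obtain ⟨T, hT, h⟩ := hv
    exact ⟨T v, h, isStable_top.apply_sub_mem hT trivial⟩
  choose w hwW hw using hex
  have key : ∀ x ∈ W, x ∈ sumRange D ⊤ → F x = 0 :=
    fun x hx hx' => hF x (sumRange_inf hD hr hx hx')
  have hkey : ∀ v, ∀ x ∈ W, x - v ∈ sumRange D ⊤ → F (w v) = F x := by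
    intro v x hx hxv
    rw [← sub_eq_zero, ← map_sub]
    refine key _ (sub_mem (hwW v) hx) ?_
    have := sub_mem (hw v) hxv
    rwa [sub_sub_sub_cancel_right] at this
  refine ⟨{ toFun := fun v => F (w v), map_add' := ?_, map_smul' := ?_ }, ?_, ?_, ?_, ?_⟩
  · intro u v
    rw [← map_add]
    refine hkey _ _ (add_mem (hwW u) (hwW v)) ?_
    rw [add_sub_add_comm]
    exact add_mem (hw u) (hw v)
  · intro c v
    rw [RingHom.id_apply, ← map_smul]
    refine hkey _ _ (Submodule.smul_mem _ _ (hwW v)) ?_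
    rw [← smul_sub]
    exact Submodule.smul_mem _ _ (hw v)
  · intro v hv
    exact hkey v v hv (by rw [sub_self]; exact zero_mem _)
  · intro v hv
    refine (hkey v 0 (zero_mem _) ?_).trans (map_zero F)
    rw [zero_sub]; exact neg_mem hv
  · intro hker v hv
    have h1 := sumRange_mono (D := D) (le_top : W ≤ ⊤) (hker _ (hwW v) hv)
    have := sub_mem h1 (hw v)
    rwa [sub_sub_cancel] at this
  · intro T T' hT hT' v
    -- As T preserves the relations, `T (w v)` is an admissible representative of `T v`.
    refine (hkey (T v) (T (w v)) (hT _ (hwW v)).1 ?_).trans (hT _ (hwW v)).2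
    rw [← map_sub]
    exact hT' _ (hw v)

end Coinvariants

/-! ### Operators on Laurent polynomials -/

section LaurentOperators

variable {N n : ℕ}

theorem mono_zero (u : Fin n → ℤ) : (mono u 0 : Laurent N n) = 0 := AddMonoidAlgebra.single_zero _

theorem mono_add (u : Fin n → ℤ) (κ κ' : RatFun N) :
    (mono u (κ + κ') : Laurent N n) = mono u κ + mono u κ' := AddMonoidAlgebra.single_add _ _ _

theorem mono_neg (u : Fin n → ℤ) (κ : RatFun N) :
    (mono u (-κ) : Laurent N n) = -mono u κ := AddMonoidAlgebra.single_neg _ _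

theorem mono_sub (u : Fin n → ℤ) (κ κ' : RatFun N) :
    (mono u (κ - κ') : Laurent N n) = mono u κ - mono u κ' := by
  rw [sub_eq_add_neg, mono_add, mono_neg, ← sub_eq_add_neg]

theorem smul_mono (u : Fin n → ℤ) (κ κ' : RatFun N) :
    κ • (mono u κ' : Laurent N n) = mono u (κ * κ') := AddMonoidAlgebra.smul_single' _ _ _

theorem mono_sum {ι : Type*} (s : Finset ι) (u : Fin n → ℤ) (κ : ι → RatFun N) :
    (mono u (∑ i ∈ s, κ i) : Laurent N n) = ∑ i ∈ s, mono u (κ i) :=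
  map_sum (⟨⟨fun κ => mono u κ, mono_zero u⟩, mono_add u⟩ : RatFun N →+ Laurent N n) _ _

theorem mono_zero_one : (mono 0 1 : Laurent N n) = 1 := rfl

/-- The linear map on Laurent polynomials with prescribed values on monomials. -/
def monoLift {X : Type*} [AddCommGroup X] [Module (RatFun N) X] (φ : (Fin n → ℤ) → X) :
    Laurent N n →ₗ[RatFun N] X :=
  (Finsupp.lsum (RatFun N) (fun u => LinearMap.toSpanSingleton (RatFun N) X (φ u))) ∘ₗ
    (AddMonoidAlgebra.coeffLinearEquiv (M := Fin n → ℤ) (S := RatFun N) (RatFun N)).toLinearMap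

theorem monoLift_mono {X : Type*} [AddCommGroup X] [Module (RatFun N) X] (φ : (Fin n → ℤ) → X)
    (u : Fin n → ℤ) (κ : RatFun N) : monoLift φ (mono u κ) = κ • φ u := by
  change Finsupp.lsum (RatFun N) (fun u => LinearMap.toSpanSingleton (RatFun N) X (φ u))
    (AddMonoidAlgebra.coeff (AddMonoidAlgebra.single u κ)) = _
  rw [AddMonoidAlgebra.coeff_single]
  simp

/-- The Laurent polynomials with support in `s`. -/
def suppIn (s : Set (Fin n → ℤ)) : Submodule (RatFun N) (Laurent N n) :=
  AddMonoidAlgebra.supported (RatFun N) (RatFun N) s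

theorem mem_suppIn {s : Set (Fin n → ℤ)} {x : Laurent N n} :
    x ∈ suppIn s ↔ ∀ u, u ∉ s → AddMonoidAlgebra.coeff x u = 0 := AddMonoidAlgebra.mem_supported'

theorem suppIn_eq_span (s : Set (Fin n → ℤ)) :
    suppIn (N := N) s = Submodule.span (RatFun N) ((fun u => mono u 1) '' s) :=
  AddMonoidAlgebra.supported_eq_span_single (RatFun N) s

theorem mono_mem_suppIn {s : Set (Fin n → ℤ)} {u : Fin n → ℤ} (hu : u ∈ s) (κ : RatFun N) :
    mono u κ ∈ suppIn s := by
  rw [suppIn_eq_span, ← mul_one κ, ← smul_mono]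
  exact Submodule.smul_mem _ _ (Submodule.subset_span ⟨u, hu, rfl⟩)

theorem suppIn_le {s : Set (Fin n → ℤ)} {W : Submodule (RatFun N) (Laurent N n)}
    (h : ∀ u ∈ s, mono u 1 ∈ W) : suppIn s ≤ W := by
  rw [suppIn_eq_span, Submodule.span_le]
  rintro _ ⟨u, hu, rfl⟩
  exact h u hu

theorem laurent_eq_top {W : Submodule (RatFun N) (Laurent N n)} (h : ∀ u, mono u 1 ∈ W) :
    W = ⊤ := by
  rw [eq_top_iff]
  intro x _
  induction x using laurent_induction with
  | zero => exact zero_mem _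
  | add x y hx hy => exact add_mem (hx trivial) (hy trivial)
  | mono u κ =>
    rw [← mul_one κ, ← smul_mono]
    exact Submodule.smul_mem _ _ (h u)

/-- The derivation `xᵢ ∂/∂xᵢ` of Laurent polynomials. -/
def euler (i : Fin n) : Derivation (RatFun N) (Laurent N n) (Laurent N n) :=
  Derivation.mk' (monoLift fun u => mono u (u i : RatFun N)) (by
    intro x y
    induction x using laurent_induction with
    | zero => simp
    | add x x' hx hx' => simp only [add_mul, map_add, hx, hx', smul_eq_mul]; ring
    | mono u κ =>
      induction y using laurent_induction with
      | zero => simp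
      | add y y' hy hy' =>
        simp only [mul_add, map_add, hy, hy', smul_eq_mul]; ring
      | mono u' κ' =>
        rw [mono_mul, monoLift_mono, monoLift_mono, monoLift_mono, smul_eq_mul, smul_eq_mul,
          smul_mono, smul_mono, smul_mono, mono_mul, mono_mul, add_comm u' u, ← mono_add]
        congr 1
        push_cast [Pi.add_apply]
        ring)

theorem euler_mono (i : Fin n) (u : Fin n → ℤ) (κ : RatFun N) :
    euler i (mono u κ) = mono u ((u i : RatFun N) * κ) := by
  rw [mul_comm, ← smul_mono]
  exact monoLift_mono _ u κ

theorem euler_comm (i j : Fin n) (x : Laurent N n) : euler i (euler j x) = euler j (euler i x) := by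
  induction x using laurent_induction with
  | zero => simp
  | add x y hx hy => simp only [map_add, hx, hy]
  | mono u κ => simp only [euler_mono]; rw [mul_left_comm]

variable (a : Fin N → Fin n → ℤ) (α : Fin n → ℂ)

/-- The operator `xᵢ ∂/∂xᵢ + xᵢ ∂f/∂xᵢ - αᵢ`. -/
def dOp (i : Fin n) : Module.End (RatFun N) (Laurent N n) :=
  (euler i).toLinearMap + LinearMap.mulLeft (RatFun N) (euler i (hypPoly a))
    - algebraMap ℂ (RatFun N) (α i) • 1

theorem dOp_apply (i : Fin n) (x : Laurent N n) :
    dOp a α i x = euler i x + euler i (hypPoly a) * x - algebraMap ℂ (RatFun N) (α i) • x := rfl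

theorem euler_hypPoly (i : Fin n) :
    euler i (hypPoly a) = ∑ j, mono (a j) ((a j i : RatFun N) * lam j) := by
  rw [hypPoly, map_sum]
  exact Finset.sum_congr rfl fun j _ => euler_mono i _ _

theorem dOp_mono (i : Fin n) (u : Fin n → ℤ) (κ : RatFun N) :
    dOp a α i (mono u κ) = mono u (((u i : RatFun N) - algebraMap ℂ (RatFun N) (α i)) * κ)
      + ∑ j, mono (u + a j) ((a j i : RatFun N) * lam j * κ) := by
  rw [dOp_apply, euler_mono, smul_mono, sub_mul, mono_sub, euler_hypPoly, Finset.sum_mul]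
  simp only [mono_mul]
  rw [add_sub_right_comm]
  simp only [add_comm u]

/-- These are the conjugates of the commuting operators xᵢ∂/∂xᵢ by x^{-α} exp(f); in the computation
only the symmetry of the second derivatives of f enters. -/
theorem dOp_commute (i j : Fin n) : Commute (dOp a α i) (dOp a α j) := by
  refine LinearMap.ext fun x => ?_
  simp only [Module.End.mul_apply, dOp_apply, map_add, map_sub, Derivation.leibniz, smul_eq_mul,
    Derivation.map_smul, euler_comm i j, mul_smul_comm]
  rw [smul_comm (algebraMap ℂ (RatFun N) (α i)) (algebraMap ℂ (RatFun N) (α j))]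
  ring

/-- The operator `∂/∂λ_j + x^{a⁽ʲ⁾}`. -/
def delOp (j : Fin N) : Laurent N n →+ Laurent N n :=
  (coeffwise (partialDeriv j) : Derivation ℤ (Laurent N n) (Laurent N n)).toLinearMap.toAddMonoidHom
    + AddMonoidHom.mulLeft (mono (a j) 1)

theorem delOp_apply (j : Fin N) (x : Laurent N n) :
    delOp a j x = coeffwise (partialDeriv j) x + mono (a j) 1 * x := rfl

theorem delOp_mono (j : Fin N) (u : Fin n → ℤ) (κ : RatFun N) :
    delOp a j (mono u κ) = mono u (partialDeriv j κ) + mono (u + a j) κ := by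
  rw [delOp_apply, coeffwise_mono, mono_mul, one_mul, add_comm u]

theorem delOp_smul (j : Fin N) (κ : RatFun N) (x : Laurent N n) :
    delOp a j (κ • x) = partialDeriv j κ • x + κ • delOp a j x := by
  rw [delOp_apply, delOp_apply, smul_add, ← mul_smul_comm, ← add_assoc]
  congr 1
  rw [Algebra.smul_def, Derivation.leibniz, algebraMap_laurent, coeffwise_mono, smul_eq_mul,
    smul_eq_mul, Algebra.smul_def, Algebra.smul_def, algebraMap_laurent, algebraMap_laurent]
  ring

theorem partialDeriv_lam (i j : Fin N) :
    partialDeriv i (lam j) = if i = j then 1 else 0 := by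
  classical
  rw [lam, partialDeriv_polynomial, MvPolynomial.pderiv_X, Pi.single_apply]
  by_cases h : j = i
  · rw [if_pos h, if_pos h.symm, map_one]
  · rw [if_neg h, if_neg (Ne.symm h), map_zero]

/-- Differentiation with respect to λⱼ isolates the j-th term of f, even if some of the a⁽ʲ⁾
coincide. -/
theorem coeffwise_hypPoly (j : Fin N) :
    coeffwise (partialDeriv j) (hypPoly a) = mono (a j) 1 := by
  rw [hypPoly, map_sum, Finset.sum_eq_single j]
  · rw [coeffwise_mono, partialDeriv_lam, if_pos rfl]
  · intro i _ h
    rw [coeffwise_mono, partialDeriv_lam, if_neg h.symm, mono_zero]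
  · simp

theorem coeffwise_euler (j : Fin N) (i : Fin n) (x : Laurent N n) :
    coeffwise (partialDeriv j) (euler i x) = euler i (coeffwise (partialDeriv j) x) := by
  induction x using laurent_induction with
  | zero => simp
  | add x y hx hy => simp only [map_add, hx, hy]
  | mono u κ =>
    simp only [euler_mono, coeffwise_mono, Derivation.leibniz, Derivation.map_intCast, mul_zero,
      add_zero, smul_eq_mul]

theorem coeffwise_const_smul (j : Fin N) (c : ℂ) (x : Laurent N n) :
    coeffwise (partialDeriv j) (algebraMap ℂ (RatFun N) c • x)
      = algebraMap ℂ (RatFun N) c • coeffwise (partialDeriv j) x := by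
  rw [Algebra.smul_def, Derivation.leibniz, algebraMap_laurent, coeffwise_mono, partialDeriv_const,
    mono_zero, smul_zero, add_zero, smul_eq_mul, Algebra.smul_def, algebraMap_laurent]

/-- Both operators are conjugates by x^{-α} exp(f) of operators which commute, as xᵢ∂/∂xᵢ does not
involve λ and α is constant. Hence the coinvariants of the Dᵢ carry an action of 𝒟̄. -/
theorem delOp_dOp (j : Fin N) (i : Fin n) (x : Laurent N n) :
    delOp a j (dOp a α i x) = dOp a α i (delOp a j x) := by
  simp only [delOp_apply, dOp_apply, map_add, map_sub, Derivation.leibniz, smul_eq_mul,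
    coeffwise_euler, coeffwise_hypPoly, coeffwise_const_smul, mul_smul_comm]
  ring

theorem delOp_sumRange {j : Fin N} {W : Submodule (RatFun N) (Laurent N n)}
    (hW : ∀ x ∈ W, delOp a j x ∈ W) {x : Laurent N n} (hx : x ∈ sumRange (dOp a α) W) :
    delOp a j x ∈ sumRange (dOp a α) W := by
  obtain ⟨w, hw, rfl⟩ := hx
  rw [map_sum]
  refine Submodule.sum_mem _ fun i _ => ?_
  rw [delOp_dOp]
  exact apply_mem_sumRange i (hW _ (hw i))

variable {a}

theorem isStable_suppIn {s : Set (Fin n → ℤ)} (hs : ∀ j, ∀ u ∈ s, u + a j ∈ s) :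
    IsStable (dOp a α) (suppIn s) := by
  intro i
  change suppIn s ≤ (suppIn s).comap (dOp a α i)
  refine suppIn_le fun u hu => ?_
  rw [Submodule.mem_comap, dOp_mono]
  exact add_mem (mono_mem_suppIn hu _) (Submodule.sum_mem _ fun j _ => mono_mem_suppIn (hs j u hu) _)

theorem delOp_mem_suppIn {s : Set (Fin n → ℤ)} {j : Fin N} (hs : ∀ u ∈ s, u + a j ∈ s)
    {x : Laurent N n} (hx : x ∈ suppIn s) : delOp a j x ∈ suppIn s := by
  rw [suppIn_eq_span] at hx
  induction hx using Submodule.span_induction with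
  | mem x hx =>
    obtain ⟨u, hu, rfl⟩ := hx
    change delOp a j (mono u 1) ∈ _
    rw [delOp_mono]
    exact add_mem (mono_mem_suppIn hu _) (mono_mem_suppIn (hs u hu) _)
  | zero => rw [map_zero]; exact zero_mem _
  | add x y _ _ hx hy => rw [map_add]; exact add_mem hx hy
  | smul κ x hx' hx =>
    rw [delOp_smul]
    rw [← suppIn_eq_span] at hx'
    exact add_mem (Submodule.smul_mem _ _ hx') (Submodule.smul_mem _ _ hx)

/-- With c viewed as a linear form, x^u gets the factor c(u - α), and the translate by a⁽ʲ⁾ the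
factor c(a⁽ʲ⁾)λⱼ. A form that vanishes on a face therefore produces no translates along that face.
-/
theorem sum_smul_dOp_mono (c : Fin n → RatFun N) (u : Fin n → ℤ) (κ : RatFun N) :
    ∑ i, c i • dOp a α i (mono u κ)
      = mono u ((∑ i, c i * ((u i : RatFun N) - algebraMap ℂ (RatFun N) (α i))) * κ)
        + ∑ j, mono (u + a j) ((∑ i, c i * (a j i : RatFun N)) * (lam j * κ)) := by
  simp only [dOp_mono, smul_add, Finset.sum_add_distrib, smul_mono, Finset.smul_sum, Finset.sum_mul,
    mono_sum]
  rw [Finset.sum_comm]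
  simp only [mul_assoc]

/-- Multiplication by an operator in `unipotentOps` makes a Laurent polynomial supported in an
arbitrary translate of a half space, if the translates by `A` of the half space lie in it. -/
theorem reach_halfSpace (ℓ μ : Fin n → ℤ) (hℓ : ∀ j, 0 ≤ ∑ i, ℓ i * a j i)
    (hμ : ∀ j, ∑ i, ℓ i * a j i = 0 → ∑ i, μ i * a j i = 0)
    (hα : ¬ ∃ z : ℤ, ∑ i, (μ i : ℂ) * α i = z) (K : ℤ)
    (hs : IsStable (dOp a α) (suppIn {u | K ≤ ∑ i, ℓ i * u i})) :
    reach (dOp_commute a α) hs = ⊤ := by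
  -- Induction on how far u lies below the half space. The form ℓ measures this height, while μ
  -- supplies the nonvanishing constant; the two need not be equal.
  have key : ∀ (k : ℕ) (u : Fin n → ℤ), K - ∑ i, ℓ i * u i ≤ k → ∀ κ,
      mono u κ ∈ reach (dOp_commute a α) hs := by
    intro k
    induction k with
    | zero =>
      intro u hu κ
      refine ⟨1, one_mem _, mono_mem_suppIn ?_ κ⟩
      simp only [Set.mem_ofPred_eq]
      push_cast at hu
      linarith
    | succ k ih =>
      intro u hu κ
      set d : ℂ := ∑ i, (μ i : ℂ) * (u i - α i) with hd
      have hd0 : d ≠ 0 := by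
        intro h0
        refine hα ⟨∑ i, μ i * u i, ?_⟩
        simp only [hd, mul_sub, Finset.sum_sub_distrib] at h0
        push_cast
        exact (sub_eq_zero.1 h0).symm
      -- Normalized so that ∑cᵢDᵢ contributes -x^u, and 1 + ∑cᵢDᵢ cancels the monomial x^u.
      let c : Fin n → RatFun N := fun i => algebraMap ℂ (RatFun N) (-(d⁻¹ * μ i))
      have hT : (1 + ∑ i, c i • dOp a α i) ∈ unipotentOps (dOp a α) :=
        Submonoid.subset_closure ⟨c, rfl⟩
      refine mem_reach_of_apply _ hT ?_
      have h1 : ∑ i, c i * ((u i : RatFun N) - algebraMap ℂ (RatFun N) (α i)) = -1 := by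
        have : ∑ i, c i * ((u i : RatFun N) - algebraMap ℂ (RatFun N) (α i))
            = algebraMap ℂ (RatFun N) (-(d⁻¹ * d)) := by
          rw [hd, Finset.mul_sum, ← Finset.sum_neg_distrib, map_sum]
          refine Finset.sum_congr rfl fun i _ => ?_
          simp only [c, map_neg, map_mul, map_sub, map_intCast]
          ring
        rw [this, inv_mul_cancel₀ hd0, map_neg, map_one]
      rw [LinearMap.add_apply, Module.End.one_apply, LinearMap.sum_apply]
      simp only [LinearMap.smul_apply]
      rw [sum_smul_dOp_mono, h1, neg_one_mul, mono_neg, add_neg_cancel_left]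
      refine Submodule.sum_mem _ fun j _ => ?_
      -- Generators at height zero drop out because μ vanishes on them; by integrality all others
      -- raise the height by at least one.
      rcases (hℓ j).eq_or_lt with hj | hj
      · have h2 : ∑ i, c i * (a j i : RatFun N) = 0 := by
          have : ∑ i, c i * (a j i : RatFun N)
              = -algebraMap ℂ (RatFun N) d⁻¹ * ((∑ i, μ i * a j i : ℤ) : RatFun N) := by
            rw [Int.cast_sum, Finset.mul_sum]
            refine Finset.sum_congr rfl fun i _ => ?_
            simp only [c, map_neg, map_mul, map_intCast]
            push_cast
            ring
          rw [this, hμ j hj.symm, Int.cast_zero, mul_zero]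
        rw [h2, zero_mul, mono_zero]
        exact zero_mem _
      · refine ih _ ?_ _
        simp only [Pi.add_apply, mul_add, Finset.sum_add_distrib]
        push_cast at hu
        linarith
  refine laurent_eq_top fun u => key (K - ∑ i, ℓ i * u i).toNat u (Int.self_le_toNat _) 1

end LaurentOperators

/-! ### Nonresonance: reaching the semigroup and the half spaces of large last exponent -/

section Reach

variable {N n : ℕ} {a : Fin N → Fin n → ℤ} {α : Fin n → ℂ}

theorem isStable_semigroup :
    IsStable (dOp a α) (suppIn (AddSubmonoid.closure (Set.range a) : Set (Fin n → ℤ))) :=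
  isStable_suppIn α fun j _ hu => add_mem hu (AddSubmonoid.subset_closure ⟨j, rfl⟩)

theorem isStable_halfSpace {ℓ : Fin n → ℤ} (hℓ : ∀ j, 0 ≤ ∑ i, ℓ i * a j i) (K : ℤ) :
    IsStable (dOp a α) (suppIn {u | K ≤ ∑ i, ℓ i * u i}) :=
  isStable_suppIn α fun j u (hu : K ≤ _) => by
    change K ≤ ∑ i, ℓ i * (u i + a j i)
    simp only [mul_add, Finset.sum_add_distrib]
    linarith [hℓ j]

/-- A single operator pushes the support beyond depth K at every facet, and there `exists_facets`
applies. Nonresonance is used with μ = ℓ for each facet form. -/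
theorem reach_semigroup (ha : AddSubgroup.closure (Set.range a) = ⊤) (hα : Nonresonant a α) :
    reach (dOp_commute a α) (isStable_semigroup (a := a)) = ⊤ := by
  obtain ⟨F, K, hF, hK⟩ := exists_facets ha
  rw [eq_top_iff]
  intro v _
  obtain ⟨T, hT, h⟩ := exists_apply_mem (dOp_commute a α) F.attach
    (fun ℓ => suppIn {u | K ≤ ∑ i, ℓ.1 i * u i})
    (fun ℓ => isStable_halfSpace (hF _ ℓ.2).nonneg_gen K)
    (fun ℓ _ => reach_halfSpace α ℓ.1 ℓ.1 (hF _ ℓ.2).nonneg_gen (fun _ h => h) (hα _ (hF _ ℓ.2)) K _)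
    v
  refine ⟨T, hT, mem_suppIn.2 fun u hu => ?_⟩
  by_contra hne
  refine hu (hK u fun ℓ hℓ => ?_)
  by_contra hcon
  exact hne (mem_suppIn.1 (h ⟨ℓ, hℓ⟩ (Finset.mem_attach _ _)) u hcon)

/-- If there were no facets, every lattice vector would lie in the semigroup; but the i-th
coordinate is nonnegative there. -/
theorem exists_isFacetForm (ha : AddSubgroup.closure (Set.range a) = ⊤) (i : Fin n)
    (hi : ∀ j, a j i = 1) : ∃ ℓ, IsFacetForm a ℓ := by
  obtain ⟨F, K, hF, hK⟩ := exists_facets ha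
  rcases F.eq_empty_or_nonempty with rfl | ⟨ℓ, hℓ⟩
  · have h := hK (-Pi.single i 1) (by simp)
    have hnn : ∀ u ∈ AddSubmonoid.closure (Set.range a), 0 ≤ u i := by
      intro u hu
      induction hu using AddSubmonoid.closure_induction with
      | mem x hx => obtain ⟨j, rfl⟩ := hx; rw [hi]; exact zero_le_one
      | zero => exact le_rfl
      | add x y _ _ hx hy => exact add_nonneg hx hy
    have := hnn _ h
    simp at this
  · exact ⟨ℓ, hF ℓ hℓ⟩

theorem isStable_upper {i : Fin n} (hi : ∀ j, a j i = 1) (k : ℤ) :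
    IsStable (dOp a α) (suppIn {u | k ≤ u i}) :=
  isStable_suppIn α fun j u (hu : k ≤ u i) => by
    change k ≤ u i + a j i
    rw [hi]; linarith

/-- The coordinate uᵢ need not be a facet form, and αᵢ may be an integer. But uᵢ is positive on all
of A, so the compatibility condition in `reach_halfSpace` is void and any facet form can serve as μ.
-/
theorem reach_upper (ha : AddSubgroup.closure (Set.range a) = ⊤) (hα : Nonresonant a α) {i : Fin n}
    (hi : ∀ j, a j i = 1) (k : ℤ) :
    reach (dOp_commute a α) (isStable_upper hi k) = ⊤ := by
  obtain ⟨μ, hμ⟩ := exists_isFacetForm ha i hi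
  have he : ∀ u : Fin n → ℤ, ∑ t, (Pi.single i 1 : Fin n → ℤ) t * u t = u i := by
    intro u; simp [Pi.single_apply]
  have hnn : ∀ j, 0 ≤ ∑ t, (Pi.single i 1 : Fin n → ℤ) t * a j t := by
    intro j; rw [he, hi]; exact zero_le_one
  have hr := reach_halfSpace α (Pi.single i 1) μ hnn
    (fun j h => by rw [he, hi] at h; exact absurd h one_ne_zero) (hα μ hμ) k
    (isStable_halfSpace hnn k)
  rw [eq_top_iff]
  intro v _
  have hv : v ∈ reach (dOp_commute a α) (isStable_halfSpace hnn k) := by rw [hr]; trivial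
  obtain ⟨T, hT, h⟩ := hv
  simp only [he] at h
  exact ⟨T, hT, h⟩

end Reach

/-! ### Differential operators -/

section DiffOpLemmas

variable {N : ℕ}

theorem coeff_one : (coeff 1 : DiffOp N) = 1 :=
  (RingQuot.mkRingHom_rel DiffOpRel.one).trans (map_one _)

theorem coeff_add (κ κ' : RatFun N) : (coeff (κ + κ') : DiffOp N) = coeff κ + coeff κ' :=
  (RingQuot.mkRingHom_rel (DiffOpRel.add κ κ')).trans (map_add _ _ _)

theorem coeff_mul (κ κ' : RatFun N) : (coeff (κ * κ') : DiffOp N) = coeff κ * coeff κ' :=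
  (RingQuot.mkRingHom_rel (DiffOpRel.mul κ κ')).trans (map_mul _ _ _)

/-- The inclusion of `ℂ(λ)` into `𝒟̄`. -/
def coeffHom : RatFun N →+* DiffOp N where
  toFun := coeff
  map_one' := coeff_one
  map_mul' := coeff_mul
  map_zero' := by
    have h := coeff_add (0 : RatFun N) 0
    rw [add_zero] at h
    exact left_eq_add.1 h
  map_add' := coeff_add

theorem coeffHom_apply (κ : RatFun N) : coeffHom κ = coeff κ := rfl

theorem del_comm (i j : Fin N) : del i * del j = del j * del i := by
  have h : diffOpMk _ = diffOpMk _ := RingQuot.mkRingHom_rel (DiffOpRel.comm i j)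
  rwa [map_mul, map_mul] at h

theorem del_mul_coeff (j : Fin N) (κ : RatFun N) :
    del j * coeff κ = coeff κ * del j + coeff (partialDeriv j κ) := by
  have h : diffOpMk _ = diffOpMk _ := RingQuot.mkRingHom_rel (DiffOpRel.leibniz j κ)
  rwa [map_add, map_mul, map_mul] at h

theorem diffOp_closure :
    Subring.closure (Set.range (coeff (N := N)) ∪ Set.range del) = ⊤ := by
  rw [eq_top_iff]
  intro P _
  obtain ⟨x, rfl⟩ := RingQuot.mkRingHom_surjective DiffOpRel P
  change diffOpMk x ∈ _
  induction x using FreeAlgebra.induction with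
  | grade0 r =>
    rw [eq_intCast, map_intCast]
    exact intCast_mem _ r
  | grade1 x =>
    rcases x with κ | j
    · exact Subring.subset_closure (Or.inl ⟨κ, rfl⟩)
    · exact Subring.subset_closure (Or.inr ⟨j, rfl⟩)
  | mul x y hx hy => rw [map_mul]; exact mul_mem (hx trivial) (hy trivial)
  | add x y hx hy => rw [map_add]; exact add_mem (hx trivial) (hy trivial)

/-- An additive map which is compatible with the generators of `𝒟̄` is `𝒟̄`-linear. -/
def diffOpLinear {M M' : Type*} [AddCommGroup M] [AddCommGroup M'] [Module (DiffOp N) M]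
    [Module (DiffOp N) M'] (f : M →+ M') (hc : ∀ (κ : RatFun N) x, f (coeff κ • x) = coeff κ • f x)
    (hd : ∀ (j : Fin N) x, f (del j • x) = del j • f x) : M →ₗ[DiffOp N] M' :=
  { f with
    map_smul' := by
      intro P x
      have hP : P ∈ Subring.closure (Set.range (coeff (N := N)) ∪ Set.range del) := by
        rw [diffOp_closure]; trivial
      change f (P • x) = P • f x
      induction hP using Subring.closure_induction generalizing x with
      | mem P hP =>
        rcases hP with ⟨κ, rfl⟩ | ⟨j, rfl⟩
        · exact hc κ x
        · exact hd j x
      | zero => simp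
      | one => simp
      | add P Q _ _ hP hQ => rw [add_smul, map_add, hP, hQ, add_smul]
      | neg P _ hP => rw [neg_smul, map_neg, hP, neg_smul]
      | mul P Q _ _ hP hQ => rw [mul_smul, hP, hQ, mul_smul] }

/-- Stated for ordered products, since 𝒟̄ is noncommutative; it gives additivity of `delPow`. -/
theorem list_ofFn_mul {R : Type*} [Monoid R] {k : ℕ} (f g : Fin k → R)
    (h : ∀ i j, Commute (g i) (f j)) :
    (List.ofFn fun i => f i * g i).prod = (List.ofFn f).prod * (List.ofFn g).prod := by
  induction k with
  | zero => simp
  | succ k ih =>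
    rw [List.ofFn_succ, List.ofFn_succ (f := f), List.ofFn_succ (f := g), List.prod_cons,
      List.prod_cons, List.prod_cons, ih _ _ fun i j => h i.succ j.succ]
    have hc : Commute (g 0) (List.ofFn fun i => f (Fin.succ i)).prod := by
      refine Commute.list_prod_right _ _ fun x hx => ?_
      obtain ⟨i, rfl⟩ := (List.mem_ofFn' _ _).1 hx
      exact h 0 i.succ
    simp only [mul_assoc]
    rw [← mul_assoc (g 0), hc.eq, mul_assoc]

theorem list_ofFn_single {R : Type*} [Monoid R] {k : ℕ} (f : Fin k → R) (j : Fin k)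
    (h : ∀ i, i ≠ j → f i = 1) : (List.ofFn f).prod = f j := by
  induction k with
  | zero => exact j.elim0
  | succ k ih =>
    rw [List.ofFn_succ, List.prod_cons]
    refine Fin.cases (fun h => ?_) (fun j h => ?_) j h
    · rw [List.prod_eq_one, mul_one]
      intro x hx
      obtain ⟨i, rfl⟩ := (List.mem_ofFn' _ _).1 hx
      exact h _ (Fin.succ_ne_zero i)
    · rw [h 0 (Fin.succ_ne_zero j).symm, one_mul,
        ih (fun i => f i.succ) j fun i hi => h _ fun h' => hi (Fin.succ_injective _ h')]

/-- The operator `∂^w`. -/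
def delPow (w : Fin N → ℕ) : DiffOp N := (List.ofFn fun j => del j ^ w j).prod

theorem delPow_add (w w' : Fin N → ℕ) : delPow (w + w') = delPow w * delPow w' := by
  rw [delPow, delPow, delPow, ← list_ofFn_mul]
  · simp only [Pi.add_apply, pow_add]
  · intro i j
    exact (show Commute (del i) (del j) from del_comm i j).pow_pow _ _

theorem delPow_zero : (delPow 0 : DiffOp N) = 1 := by simp [delPow]

theorem delPow_single (j : Fin N) : delPow (Pi.single j 1) = del j := by
  rw [delPow, list_ofFn_single _ j]
  · simp
  · intro i hi; simp [hi]

theorem boxOp_eq (l : Fin N → ℤ) :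
    boxOp l = delPow (fun j => (l j).toNat) - delPow (fun j => (-l j).toNat) := rfl

theorem delPow_induction {P : (Fin N → ℕ) → Prop} (zero : P 0)
    (add : ∀ w w', P w → P w' → P (w + w')) (single : ∀ j, P (Pi.single j 1)) (w : Fin N → ℕ) :
    P w := by
  classical
  rw [← Finset.univ_sum_single w]
  refine Finset.sum_induction _ P (fun _ _ => add _ _) zero fun j _ => ?_
  induction w j with
  | zero => rw [Pi.single_zero]; exact zero
  | succ k ih => rw [Pi.single_add]; exact add _ _ ih (single j)

/-- The identity ∂ⱼλⱼ = λⱼ∂ⱼ + 1 accounts for one factor ∂ⱼ, and the shifts add up along a product.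
-/
theorem delPow_mul_lam_del (w : Fin N → ℕ) (j : Fin N) :
    delPow w * (coeff (lam j) * del j) = (coeff (lam j) * del j + (w j : DiffOp N)) * delPow w := by
  induction w using delPow_induction with
  | zero => simp [delPow_zero]
  | add w w' h h' =>
    rw [delPow_add, mul_assoc, h', ← mul_assoc, mul_add, h, (Nat.cast_commute _ _).eq.symm]
    simp only [Pi.add_apply, Nat.cast_add]
    noncomm_ring
  | single i =>
    rw [delPow_single, ← mul_assoc, del_mul_coeff, partialDeriv_lam, add_mul, add_mul, mul_assoc,
      mul_assoc, del_comm i j]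
    congr 1
    by_cases h : i = j
    · subst h; rw [if_pos rfl, coeff_one]; simp
    · rw [if_neg h, Pi.single_eq_of_ne (Ne.symm h), Nat.cast_zero, zero_mul, ← coeffHom_apply,
        map_zero, zero_mul]

theorem delPow_mul_const (w : Fin N → ℕ) {κ : RatFun N} (hκ : ∀ j, partialDeriv j κ = 0) :
    delPow w * coeff κ = coeff κ * delPow w := by
  induction w using delPow_induction with
  | zero => simp [delPow_zero]
  | add w w' h h' => rw [delPow_add, mul_assoc, h', ← mul_assoc, h, mul_assoc]
  | single i =>
    rw [delPow_single, del_mul_coeff, hκ, ← coeffHom_apply 0, map_zero, add_zero]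

variable {n : ℕ} {a : Fin N → Fin n → ℤ} (α : Fin n → ℂ)

/-- The right side is the formula of `dOp_mono` for u = ∑ wⱼa⁽ʲ⁾, with monomials replaced by powers
of ∂. This is why sending x^u to the class of ∂^w kills the relations Dᵢx^u. -/
theorem delPow_mul_eulerOp (w : Fin N → ℕ) (i : Fin n) :
    delPow w * eulerOp a α i = coeff (((∑ j, w j • a j) i : RatFun N) - algebraMap ℂ (RatFun N) (α i))
      * delPow w + ∑ j, coeff ((a j i : RatFun N) * lam j) * delPow (w + Pi.single j 1) := by
  have hint : ∀ z : ℤ, ∀ j, partialDeriv j (z : RatFun N) = 0 := fun z j =>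
    Derivation.map_intCast _ z
  rw [eulerOp, mul_sub, delPow_mul_const w fun j => partialDeriv_const j _, Finset.mul_sum]
  have h : ∀ j, delPow w * (coeff ((a j i : RatFun N) * lam j) * del j)
      = coeff ((w j : RatFun N) * (a j i : RatFun N)) * delPow w
        + coeff ((a j i : RatFun N) * lam j) * delPow (w + Pi.single j 1) := by
    intro j
    rw [coeff_mul, mul_assoc, ← mul_assoc (delPow w), delPow_mul_const w (hint _), mul_assoc,
      delPow_mul_lam_del, delPow_add, delPow_single, mul_comm (w j : RatFun N), coeff_mul,
      ← coeffHom_apply (w j : RatFun N), map_natCast, add_mul, mul_add, add_comm]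
    congr 1
    · rw [mul_assoc]
    · have hcomm : delPow w * del j = del j * delPow w := by
        rw [← delPow_single, ← delPow_add, ← delPow_add, add_comm]
      rw [hcomm]
      simp only [mul_assoc]
  rw [Finset.sum_congr rfl fun j _ => h j, Finset.sum_add_distrib, ← Finset.sum_mul]
  have h2 : ∑ j, coeff ((w j : RatFun N) * (a j i : RatFun N))
      = coeff ((∑ j, w j • a j) i : RatFun N) := by
    simp only [← coeffHom_apply]
    rw [← map_sum]
    congr 1
    simp
  rw [h2, ← coeffHom_apply (_ - _), map_sub, coeffHom_apply, coeffHom_apply]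
  noncomm_ring

/-- Removing the common factor ∂^{min(w, w')} leaves the box operator of l = w - w'. -/
theorem delPow_sub_mem (w w' : Fin N → ℕ) (h : ∑ j, w j • a j = ∑ j, w' j • a j) :
    delPow w - delPow w' ∈ hypergeometricIdeal a α := by
  let l : Fin N → ℤ := fun j => (w j : ℤ) - w' j
  have hl : ∑ j, l j • a j = 0 := by
    simp only [l, sub_smul, Finset.sum_sub_distrib, natCast_zsmul, h, sub_self]
  have h1 : w = (fun j => min (w j) (w' j)) + fun j => (l j).toNat := by
    ext j; simp only [Pi.add_apply, l]; omega
  have h2 : w' = (fun j => min (w j) (w' j)) + fun j => (-l j).toNat := by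
    ext j; simp only [Pi.add_apply, l]; omega
  have h3 : delPow w - delPow w' = delPow (fun j => min (w j) (w' j)) * boxOp l := by
    rw [boxOp_eq, mul_sub, ← delPow_add, ← delPow_add, ← h1, ← h2]
  rw [h3]
  exact Submodule.smul_mem _ _ (Submodule.subset_span (Or.inl ⟨l, hl, rfl⟩))

end DiffOpLemmas

/-! ### The map from Laurent polynomials to the hypergeometric module -/

section ToHypergeometric

variable {N n : ℕ} {a : Fin N → Fin n → ℤ} {α : Fin n → ℂ}

theorem exists_delPow_lift {u : Fin n → ℤ} (hu : u ∈ AddSubmonoid.closure (Set.range a)) :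
    ∃ w : Fin N → ℕ, ∑ j, w j • a j = u := by
  induction hu using AddSubmonoid.closure_induction with
  | mem x hx =>
    obtain ⟨j, rfl⟩ := hx
    refine ⟨Pi.single j 1, ?_⟩
    rw [Finset.sum_eq_single j]
    · simp
    · intro i _ h; simp [h]
    · simp
  | zero => exact ⟨0, by simp⟩
  | add x y _ _ hx hy =>
    obtain ⟨w, rfl⟩ := hx
    obtain ⟨w', rfl⟩ := hy
    exact ⟨w + w', by simp [add_smul, Finset.sum_add_distrib]⟩

theorem sum_add_single_smul (w : Fin N → ℕ) (j : Fin N) :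
    ∑ i, (w + Pi.single j 1 : Fin N → ℕ) i • a i = ∑ i, w i • a i + a j := by
  simp only [Pi.add_apply, add_smul, Finset.sum_add_distrib]
  congr 1
  rw [Finset.sum_eq_single j]
  · simp
  · intro i _ h; simp [h]
  · simp

/-- The class of an operator in the hypergeometric module. -/
def hypMk (a : Fin N → Fin n → ℤ) (α : Fin n → ℂ) :
    DiffOp N →ₗ[DiffOp N] HypergeometricModule a α := (hypergeometricIdeal a α).mkQ

theorem hypMk_delPow_eq {w w' : Fin N → ℕ} (h : ∑ j, w j • a j = ∑ j, w' j • a j) :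
    hypMk a α (delPow w) = hypMk a α (delPow w') := by
  rw [← sub_eq_zero, ← map_sub]
  exact (Submodule.Quotient.mk_eq_zero _).2 (delPow_sub_mem α w w' h)

theorem hypMk_mul_eulerOp (P : DiffOp N) (i : Fin n) : hypMk a α (P * eulerOp a α i) = 0 :=
  (Submodule.Quotient.mk_eq_zero _).2
    (Submodule.smul_mem _ P (Submodule.subset_span (Or.inr ⟨i, rfl⟩)))

/-- There is a `𝒟̄`-linear map from Laurent polynomials to the hypergeometric module which sends `1`
to the class of `1`. -/
theorem exists_toHypergeometric (ha : AddSubgroup.closure (Set.range a) = ⊤)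
    (hα : Nonresonant a α) :
    ∃ Ψ : Laurent N n →+ HypergeometricModule a α, (∀ (κ : RatFun N) v, Ψ (κ • v) = coeff κ • Ψ v) ∧
      (∀ j v, Ψ (delOp a j v) = del j • Ψ v) ∧ (∀ v ∈ sumRange (dOp a α) ⊤, Ψ v = 0) ∧
      Ψ 1 = hypMk a α 1 := by
  let _ : Module (RatFun N) (HypergeometricModule a α) := Module.compHom _ coeffHom
  have hsmul : ∀ (κ : RatFun N) (z : HypergeometricModule a α), κ • z = coeff κ • z := fun _ _ => rfl
  -- An exponent w is chosen for each u in the semigroup, with junk value 0 elsewhere. The box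
  -- relations make the choice immaterial, and F matters only on polynomials supported in the
  -- semigroup.
  have hw : ∀ u : Fin n → ℤ, ∃ w : Fin N → ℕ, u ∈ AddSubmonoid.closure (Set.range a) →
      ∑ j, w j • a j = u := by
    intro u
    by_cases hu : u ∈ AddSubmonoid.closure (Set.range a)
    · obtain ⟨w, h⟩ := exists_delPow_lift hu
      exact ⟨w, fun _ => h⟩
    · exact ⟨0, fun h => absurd h hu⟩
  choose w hw using hw
  let F : Laurent N n →ₗ[RatFun N] HypergeometricModule a α :=
    monoLift fun u => hypMk a α (delPow (w u))
  set S : Set (Fin n → ℤ) := (AddSubmonoid.closure (Set.range a) : Set (Fin n → ℤ)) with hS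
  have hF : ∀ (w' : Fin N → ℕ) (κ : RatFun N),
      F (mono (∑ j, w' j • a j) κ) = hypMk a α (coeff κ * delPow w') := by
    intro w' κ
    have hmem : ∑ j, w' j • a j ∈ AddSubmonoid.closure (Set.range a) :=
      sum_mem fun j _ => nsmul_mem (AddSubmonoid.subset_closure (Set.mem_range_self j)) _
    rw [monoLift_mono, hypMk_delPow_eq (hw _ hmem), hsmul, ← map_smul, smul_eq_mul]
  have hadd : ∀ j, ∀ u ∈ S, u + a j ∈ S := fun j u hu =>
    add_mem hu (AddSubmonoid.subset_closure ⟨j, rfl⟩)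
  have hkill : ∀ v ∈ sumRange (dOp a α) (suppIn S), F v = 0 := by
    change sumRange _ _ ≤ LinearMap.ker F
    refine sumRange_le fun i => ?_
    change suppIn S ≤ (LinearMap.ker F).comap (dOp a α i)
    refine suppIn_le fun u hu => ?_
    obtain ⟨w', rfl⟩ := exists_delPow_lift hu
    rw [Submodule.mem_comap, LinearMap.mem_ker, dOp_mono, map_add, map_sum]
    simp only [← sum_add_single_smul, hF, mul_one]
    rw [← map_sum, ← map_add, ← delPow_mul_eulerOp, hypMk_mul_eulerOp]
  have hdel : ∀ j, ∀ v ∈ suppIn S, F (delOp a j v) = del j • F v := by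
    intro j v hv
    rw [suppIn_eq_span] at hv
    induction hv using Submodule.span_induction with
    | mem x hx =>
      obtain ⟨u, hu, rfl⟩ := hx
      obtain ⟨w', rfl⟩ := exists_delPow_lift hu
      change F (delOp a j (mono _ 1)) = del j • F (mono _ 1)
      rw [delOp_mono, Derivation.map_one_eq_zero, mono_zero, zero_add, ← sum_add_single_smul, hF, hF,
        coeff_one, one_mul, one_mul, ← map_smul, smul_eq_mul, add_comm, delPow_add, delPow_single]
    | zero => simp
    | add x y _ _ hx hy => rw [map_add, map_add, map_add, hx, hy, smul_add]
    | smul κ x _ hx =>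
      rw [delOp_smul, map_add, map_smul, map_smul, map_smul, hx, hsmul, hsmul, hsmul, ← mul_smul,
        ← mul_smul, del_mul_coeff, add_smul, add_comm]
  -- Here nonresonance enters: the map, so far meaningful on the semigroup, extends to all Laurent
  -- polynomials.
  obtain ⟨Ψ, h1, h2, -, h4⟩ := exists_extension (dOp_commute a α) (reach_semigroup ha hα) F hkill
  refine ⟨Ψ.toAddMonoidHom, fun κ v => map_smul Ψ κ v, fun j v => ?_, h2, ?_⟩
  · exact h4 (delOp a j) (DistribMulAction.toAddMonoidEnd (DiffOp N) _ (del j))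
      (fun v hv => ⟨delOp_mem_suppIn (hadd j) hv, hdel j v hv⟩)
      (fun v hv => delOp_sumRange a α (W := ⊤) (fun _ _ => trivial) hv) v
  · have h0 : (1 : Laurent N n) = mono (∑ j, (0 : Fin N → ℕ) j • a j) 1 := by
      simp [mono_zero_one]
    change Ψ 1 = _
    rw [h1 _ (by rw [← mono_zero_one]; exact mono_mem_suppIn (zero_mem _) _), h0, hF, delPow_zero,
      coeff_one, one_mul]

variable (a α) in
/-- The criterion for a `𝒟̄`-module to be isomorphic to the hypergeometric module. -/
theorem nonempty_equiv_hypergeometricModule (ha : AddSubgroup.closure (Set.range a) = ⊤)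
    (hα : Nonresonant a α) {M : Type} [AddCommGroup M] [Module (DiffOp N) M]
    (Θ : Laurent N n →+ M) (hc : ∀ (κ : RatFun N) v, Θ (κ • v) = coeff κ • Θ v)
    (hd : ∀ j v, Θ (delOp a j v) = del j • Θ v) (hs : Function.Surjective Θ)
    (hk : ∀ v, Θ v = 0 ↔ v ∈ sumRange (dOp a α) ⊤) :
    Nonempty (HypergeometricModule a α ≃ₗ[DiffOp N] M) := by
  obtain ⟨Ψ, hΨc, hΨd, hΨk, hΨ1⟩ := exists_toHypergeometric ha hα
  let Ξ₀ : M →+ HypergeometricModule a α := Θ.liftOfSurjective hs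
    ⟨Ψ, fun v hv => hΨk v ((hk v).1 hv)⟩
  have hΞ : ∀ v, Ξ₀ (Θ v) = Ψ v := fun v => AddMonoidHom.liftOfRightInverse_comp_apply _ _ _ _ v
  let Ξ : M →ₗ[DiffOp N] HypergeometricModule a α := diffOpLinear Ξ₀
    (fun κ x => by
      obtain ⟨v, rfl⟩ := hs x
      rw [← hc, hΞ, hΞ, hΨc])
    (fun j x => by
      obtain ⟨v, rfl⟩ := hs x
      rw [← hd, hΞ, hΞ, hΨd])
  have hΞ' : ∀ v, Ξ (Θ v) = Ψ v := hΞ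
  -- The inverse isomorphism, P ↦ P·Θ(1). It is defined on 𝒟̄ and must be shown to kill the
  -- hypergeometric ideal.
  let R₀ : DiffOp N →ₗ[DiffOp N] M := LinearMap.toSpanSingleton (DiffOp N) M (Θ 1)
  have hR₀ : ∀ P, R₀ P = P • Θ 1 := fun P => rfl
  have hmono : ∀ (w : Fin N → ℕ), delPow w • Θ 1 = Θ (mono (∑ j, w j • a j) 1) := by
    intro w
    have : ∀ u : Fin n → ℤ, delPow w • Θ (mono u 1) = Θ (mono (u + ∑ j, w j • a j) 1) := by
      induction w using delPow_induction with
      | zero => intro u; simp [delPow_zero]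
      | add w w' h h' =>
        intro u
        rw [delPow_add, mul_smul, h', h]
        simp only [Pi.add_apply, add_smul, Finset.sum_add_distrib]
        rw [add_assoc, add_comm (∑ j, w' j • a j)]
      | single j =>
        intro u
        have := sum_add_single_smul (a := a) 0 j
        simp only [zero_add, Pi.zero_apply, zero_smul, Finset.sum_const_zero] at this
        rw [delPow_single, ← hd, delOp_mono, Derivation.map_one_eq_zero, mono_zero, zero_add, this]
    have h0 := this 0
    rwa [zero_add, mono_zero_one] at h0
  have hle : hypergeometricIdeal a α ≤ LinearMap.ker R₀ := by
    rw [hypergeometricIdeal, Submodule.span_le]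
    rintro _ (⟨l, hl, rfl⟩ | ⟨i, rfl⟩)
    · rw [SetLike.mem_coe, LinearMap.mem_ker, hR₀, boxOp_eq, sub_smul, hmono, hmono, sub_eq_zero]
      congr 2
      rw [← sub_eq_zero, ← Finset.sum_sub_distrib]
      rw [← hl]
      refine Finset.sum_congr rfl fun j _ => ?_
      rw [← natCast_zsmul, ← natCast_zsmul, ← sub_smul]
      congr 1
      omega
    -- The operator `Zᵢ` applied to Θ(1) gives Θ(Dᵢ1), as one sees from the case w = 0 of
    -- `delPow_mul_eulerOp`.
    · rw [SetLike.mem_coe, LinearMap.mem_ker, hR₀]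
      have h1 := delPow_mul_eulerOp (a := a) α 0 i
      rw [delPow_zero, one_mul] at h1
      rw [h1, add_smul, Finset.sum_smul, mul_one, ← hc]
      simp only [mul_smul, hmono, ← hc, smul_mono, sum_add_single_smul]
      rw [← map_sum, ← map_add, hk, ← mono_zero_one, smul_mono]
      have h2 := dOp_mono a α i 0 1
      have h3 : ∑ j, (0 : Fin N → ℕ) j • a j = 0 := by simp
      rw [h3]
      simp only [mul_one] at h2 ⊢
      rw [← h2]
      exact apply_mem_sumRange i trivial
  let R : HypergeometricModule a α →ₗ[DiffOp N] M := (hypergeometricIdeal a α).liftQ R₀ hle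
  have hR : ∀ P, R (hypMk a α P) = P • Θ 1 := fun P => rfl
  refine ⟨LinearEquiv.ofLinearMap R Ξ ?_ ?_⟩
  -- On semigroup monomials the composite is the identity because they are ∂^w·Θ(1). Every class has
  -- a representative supported in the semigroup, by `reach_semigroup`.
  · have hspan : ∀ v ∈ suppIn (AddSubmonoid.closure (Set.range a) : Set (Fin n → ℤ)),
        R (Ξ (Θ v)) = Θ v := by
      intro v hv
      rw [suppIn_eq_span] at hv
      induction hv using Submodule.span_induction with
      | mem x hx =>
        obtain ⟨u, hu, rfl⟩ := hx
        obtain ⟨w, rfl⟩ := exists_delPow_lift hu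
        change R (Ξ (Θ (mono _ 1))) = Θ (mono _ 1)
        rw [← hmono, map_smul, map_smul, hΞ', hΨ1, hR, one_smul]
      | zero => simp
      | add x y _ _ hx hy => simp only [map_add, hx, hy]
      | smul κ x _ hx => rw [hc, map_smul, map_smul, hx]
    ext x
    obtain ⟨v, rfl⟩ := hs x
    have hv : v ∈ reach (dOp_commute a α) (isStable_semigroup (a := a)) := by
      rw [reach_semigroup ha hα]; trivial
    obtain ⟨T, hT, h⟩ := hv
    have h1 : Θ (T v) = Θ v := by
      rw [← sub_eq_zero, ← map_sub, hk]
      exact isStable_top.apply_sub_mem hT trivial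
    rw [LinearMap.comp_apply, ← h1]
    exact hspan _ h
  · ext
    change Ξ (R (hypMk a α 1)) = hypMk a α 1
    rw [hR, one_smul, hΞ', hΨ1]

end ToHypergeometric

/-! ### Étale coordinates -/

section EtaleCoords

/-- Étale coordinates on `Spec B` over `A` with values in a torus: units `xᵢ` such that the
`dxᵢ/xᵢ` form a basis of the differentials, the dual basis being given by derivations `θᵢ`. -/
structure EtaleCoords (A B : Type) [CommRing A] [CommRing B] [Algebra A B] (m : ℕ) where
  x : Fin m → B
  v : Fin m → B
  v_mul : ∀ i, v i * x i = 1
  θ : Fin m → Derivation A B B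
  θ_x : ∀ i j, θ i (x j) = if i = j then x j else 0
  D_eq : ∀ b, KaehlerDifferential.D A B b = ∑ i, θ i b • dlog (x i) (v i)

variable {A B : Type} [CommRing A] [CommRing B] [Algebra A B] {m : ℕ} (E : EtaleCoords A B m)

namespace EtaleCoords

/-- The form `dx_{s(1)}/x_{s(1)} ∧ … ∧ dx_{s(k)}/x_{s(k)}`. -/
def wedge {k : ℕ} (s : Fin k → Fin m) : Forms A B :=
  ExteriorAlgebra.ιMulti B k fun i => dlog (A := A) (E.x (s i)) (E.v (s i))

theorem wedge_zero (s : Fin 0 → Fin m) : E.wedge s = 1 := ExteriorAlgebra.ιMulti_zero_apply _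

theorem wedge_cons {k : ℕ} (i : Fin m) (s : Fin k → Fin m) :
    E.wedge (Fin.cons i s : Fin (k + 1) → Fin m)
      = ExteriorAlgebra.ι B (dlog (E.x i) (E.v i)) * E.wedge s :=
  ExteriorAlgebra.ιMulti_succ_apply _

theorem wedge_induction {P : ℕ → Forms A B → Prop} (zero : P 0 1)
    (cons : ∀ k i (s : Fin k → Fin m), P k (E.wedge s) →
      P (k + 1) (ExteriorAlgebra.ι B (dlog (E.x i) (E.v i)) * E.wedge s))
    {k : ℕ} (s : Fin k → Fin m) : P k (E.wedge s) := by
  induction k with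
  | zero => rw [wedge_zero]; exact zero
  | succ k ih =>
    rw [← Fin.cons_self_tail s, wedge_cons]
    exact cons k _ _ (ih _)

theorem wedge_mem {k : ℕ} (s : Fin k → Fin m) : E.wedge s ∈ formsDeg A B k :=
  E.wedge_induction (P := fun k x => x ∈ formsDeg A B k) (by rw [← map_one (fn A)]; exact fn_mem 1)
    (fun _ _ _ h => ι_mul_mem _ h) s

theorem extDeriv_wedge {k : ℕ} (s : Fin k → Fin m) : extDeriv (E.wedge s) = 0 :=
  E.wedge_induction (P := fun _ x => extDeriv x = 0) extDeriv_one (fun k i s h => by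
    rw [ι_dlog, mul_assoc, extDeriv_fn_mul, extDeriv_dd_mul, h, dd_inv (E.v_mul i)]
    simp only [mul_zero, neg_zero, add_zero, neg_mul]
    rw [mul_assoc, ← mul_assoc (dd A (E.x i)), dd_sq, zero_mul, mul_zero, neg_zero]) s

/-- In the frame dxᵢ/xᵢ, a derivation killing the coordinates acts on coefficients alone. -/
theorem lieDeriv_wedge {δ : Derivation ℤ A A} {θ : Derivation ℤ B B} (h : Extends δ θ)
    (hθ : ∀ i, θ (E.x i) = 0) {k : ℕ} (s : Fin k → Fin m) : lieDeriv h (E.wedge s) = 0 :=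
  E.wedge_induction (P := fun _ x => lieDeriv h x = 0) (lieDeriv_one h) (fun k i s hs => by
    rw [lieDeriv_mul, hs, mul_zero, add_zero, lieDeriv_dlog h (E.v_mul i), hθ, mul_zero, map_zero,
      zero_mul]) s

theorem pullback_wedge {σ : B →ₐ[A] B} (hσ : ∀ i, σ (E.x i) = E.x i) {k : ℕ} (s : Fin k → Fin m) :
    pullback σ (E.wedge s) = E.wedge s := by
  have hv : ∀ i, σ (E.v i) = E.v i := by
    intro i
    have h1 := congrArg σ (E.v_mul i)
    rw [map_mul, hσ, map_one] at h1
    calc σ (E.v i) = σ (E.v i) * (E.v i * E.x i) := by rw [E.v_mul, mul_one]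
      _ = (σ (E.v i) * E.x i) * E.v i := by ring
      _ = E.v i := by rw [h1, one_mul]
  refine E.wedge_induction (P := fun _ x => pullback σ x = x) (map_one _) (fun k i s hs => ?_) s
  rw [map_mul, hs, ι_dlog, map_mul, pullback_fn, pullback_dd, hσ, hv]

theorem dd_eq (b : B) :
    dd A b = ∑ i, fn A (E.θ i b) * ExteriorAlgebra.ι B (dlog (E.x i) (E.v i)) := by
  rw [dd_def, E.D_eq, map_sum]
  exact Finset.sum_congr rfl fun i _ => by rw [map_smul, Algebra.smul_def]; rfl

theorem dd_mul_wedge (b : B) {k : ℕ} (s : Fin k → Fin m) :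
    dd A b * E.wedge s = ∑ i, fn A (E.θ i b) * E.wedge (Fin.cons i s : Fin (k + 1) → Fin m) := by
  rw [E.dd_eq, Finset.sum_mul]
  exact Finset.sum_congr rfl fun i _ => by rw [wedge_cons, mul_assoc]

theorem mem_span_wedge {k : ℕ} {ω : Forms A B} (hω : ω ∈ formsDeg A B k) :
    ∃ b : (Fin k → Fin m) → B, ω = ∑ s, fn A (b s) * E.wedge s := by
  refine formsDeg_induction (P := fun k ω => ∃ b : (Fin k → Fin m) → B,
    ω = ∑ s, fn A (b s) * E.wedge s) ?_ ?_ ?_ ?_ hω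
  · exact ⟨fun _ => 1, by simp [wedge_zero]⟩
  · rintro k _ _ ⟨b, rfl⟩ ⟨b', rfl⟩
    exact ⟨b + b', by simp [add_mul, Finset.sum_add_distrib]⟩
  · rintro k c _ _ ⟨b, rfl⟩
    exact ⟨fun s => c * b s, by simp [Finset.mul_sum, mul_assoc]⟩
  · rintro k c _ _ ⟨b, rfl⟩
    refine ⟨fun t => E.θ (t 0) c * b (Fin.tail t), ?_⟩
    rw [Finset.mul_sum, ← (Fin.consEquiv fun _ => Fin m).sum_comp, Fintype.sum_prod_type,
      Finset.sum_comm]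
    refine Finset.sum_congr rfl fun s _ => ?_
    rw [← mul_assoc, ← fn_comm, mul_assoc, E.dd_mul_wedge, Finset.mul_sum]
    refine Finset.sum_congr rfl fun i _ => ?_
    change _ = fn A (E.θ i c * b s) * E.wedge (Fin.cons i s : Fin (k + 1) → Fin m)
    rw [map_mul, ← mul_assoc, ← map_mul, ← map_mul, mul_comm]

theorem wedge_of_not_injective {k : ℕ} {s : Fin k → Fin m} (hs : ¬ Function.Injective s) :
    E.wedge s = 0 :=
  AlternatingMap.map_eq_zero_of_not_injective _ _ fun h =>
    hs (Function.Injective.of_comp (f := fun i => dlog (A := A) (E.x i) (E.v i)) h)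

/-- The form `dx₁/x₁ ∧ … ∧ dx_m/x_m`. -/
def vol : Forms A B := E.wedge id

theorem vol_mem : E.vol ∈ formsDeg A B m := E.wedge_mem _

theorem wedge_of_bijective {s : Fin m → Fin m} (hs : Function.Bijective s) :
    ∃ ε : ℤˣ, E.wedge s = ε • E.vol :=
  ⟨Equiv.Perm.sign (Equiv.ofBijective s hs),
    AlternatingMap.map_perm (ExteriorAlgebra.ιMulti B m)
      (fun i => dlog (A := A) (E.x i) (E.v i)) (Equiv.ofBijective s hs)⟩

theorem exists_wedge_eq (s : Fin m → Fin m) : ∃ ε : ℤ, E.wedge s = ε • E.vol := by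
  by_cases hs : Function.Injective s
  · obtain ⟨ε, h⟩ := E.wedge_of_bijective (Finite.injective_iff_bijective.1 hs)
    exact ⟨ε, h⟩
  · exact ⟨0, by rw [E.wedge_of_not_injective hs, zero_smul]⟩

theorem fn_mul_zsmul (b : B) (ε : ℤ) (x : Forms A B) : fn A b * (ε • x) = fn A (ε • b) * x := by
  rw [map_zsmul, mul_smul_comm, smul_mul_assoc]

theorem exists_eq_fn_mul_vol {ω : Forms A B} (hω : ω ∈ formsDeg A B m) :
    ∃ b, ω = fn A b * E.vol := by
  obtain ⟨b, rfl⟩ := E.mem_span_wedge hω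
  choose ε hε using E.exists_wedge_eq
  refine ⟨∑ s, ε s • b s, ?_⟩
  rw [map_sum, Finset.sum_mul]
  exact Finset.sum_congr rfl fun s _ => by rw [hε, fn_mul_zsmul]

theorem eq_zero_of_mem_succ (E : EtaleCoords A B m) {ω : Forms A B} (hω : ω ∈ formsDeg A B (m + 1)) : ω = 0 := by
  obtain ⟨b, rfl⟩ := E.mem_span_wedge hω
  refine Finset.sum_eq_zero fun s _ => ?_
  rw [E.wedge_of_not_injective, mul_zero]
  intro hs
  have := Fintype.card_le_of_injective s hs
  simp at this

/-- Pairing m-forms with θ₁, …, θ_m by a determinant is a B-linear functional with value 1 on the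
volume form, so multiples of that form have no torsion. -/
theorem fn_mul_vol_eq_zero {b : B} (h : fn A b * E.vol = 0) : b = 0 := by
  let t : Ω[B⁄A] →ₗ[B] (Fin m → B) := LinearMap.pi fun i => (E.θ i).liftKaehlerDifferential
  let d : Ω[B⁄A] [⋀^Fin m]→ₗ[B] B := Matrix.detRowAlternating.compLinearMap t
  let L : Forms A B →ₗ[B] B :=
    ExteriorAlgebra.liftAlternating (Function.update 0 m d)
  have hL : L E.vol = 1 := by
    have h1 : L E.vol = d fun i => dlog (A := A) (E.x i) (E.v i) := by
      have := ExteriorAlgebra.liftAlternating_apply_ιMulti (R := B) (N := B)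
        (Function.update 0 m d) (fun i : Fin m => dlog (A := A) (E.x i) (E.v i))
      rw [Function.update_self] at this
      exact this
    rw [h1]
    change Matrix.det (fun i => t (dlog (A := A) (E.x i) (E.v i))) = 1
    have h2 : (fun i => t (dlog (A := A) (E.x i) (E.v i))) = (1 : Matrix (Fin m) (Fin m) B) := by
      ext i j
      change (E.θ j).liftKaehlerDifferential (dlog (A := A) (E.x i) (E.v i)) = _
      rw [dlog, map_smul, Derivation.liftKaehlerDifferential_comp_D, E.θ_x, Matrix.one_apply,
        smul_eq_mul]
      by_cases hij : i = j
      · rw [if_pos hij, if_pos hij.symm, E.v_mul]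
      · rw [if_neg hij, if_neg (Ne.symm hij), mul_zero]
    rw [h2, Matrix.det_one]
  have h3 := congrArg L h
  rw [fn_def, ← Algebra.smul_def, map_smul, hL, map_zero, smul_eq_mul, mul_one] at h3
  exact h3

/-- The operator `θᵢ + cᵢ`. -/
def op (c : Fin m → B) (i : Fin m) : Module.End A B :=
  (E.θ i).toLinearMap + LinearMap.mulLeft A (c i)

theorem op_apply (c : Fin m → B) (i : Fin m) (b : B) : E.op c i b = E.θ i b + c i * b := rfl

variable {η : Ω[B⁄A]} {c : Fin m → B}

theorem twistedDiff_fn_mul_wedge (hη : η = ∑ i, c i • dlog (E.x i) (E.v i)) (b : B) {k : ℕ}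
    (s : Fin k → Fin m) : twistedDiff η (fn A b * E.wedge s)
      = ∑ i, fn A (E.op c i b) * E.wedge (Fin.cons i s : Fin (k + 1) → Fin m) := by
  rw [twistedDiff_apply, extDeriv_fn_mul, extDeriv_wedge, mul_zero, add_zero, E.dd_mul_wedge, hη,
    map_sum, Finset.sum_mul, ← Finset.sum_add_distrib]
  refine Finset.sum_congr rfl fun i _ => ?_
  rw [map_smul, Algebra.smul_def, ← fn_def (A := A), E.op_apply, map_add, add_mul, wedge_cons, map_mul]
  congr 1
  rw [← mul_assoc, mul_assoc (fn A (c i)), ← fn_comm]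
  simp only [mul_assoc]

/-- The twisted differential of b times a frame element is ∑ᵢ (θᵢ + cᵢ)b · dxᵢ/xᵢ ∧ (frame element).
In top degree each term is a signed multiple of the volume form, so top cohomology is the quotient
of B by the images of the θᵢ + cᵢ. -/
theorem fn_mul_vol_mem_coboundaries (hη : η = ∑ i, c i • dlog (E.x i) (E.v i)) {b : B} :
    fn A b * E.vol ∈ coboundaries η m ↔ b ∈ sumRange (E.op c) ⊤ := by
  cases m with
  | zero =>
    constructor
    · intro h
      rw [E.fn_mul_vol_eq_zero (b := b) h]
      exact zero_mem _
    · rintro ⟨w, -, rfl⟩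
      simp only [Finset.univ_eq_empty, Finset.sum_empty, map_zero, zero_mul]
      exact zero_mem _
  | succ k =>
    constructor
    · rintro ⟨ω, hω, h⟩
      obtain ⟨b', rfl⟩ := E.mem_span_wedge hω
      choose ε hε using E.exists_wedge_eq
      rw [map_sum] at h
      simp only [E.twistedDiff_fn_mul_wedge hη, hε, fn_mul_zsmul] at h
      simp only [← Finset.sum_mul, ← map_sum] at h
      rw [← sub_eq_zero, ← sub_mul, ← map_sub] at h
      rw [← sub_eq_zero.1 (E.fn_mul_vol_eq_zero h)]
      refine Submodule.sum_mem _ fun s _ => Submodule.sum_mem _ fun i _ => ?_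
      rw [← map_zsmul]
      exact apply_mem_sumRange i trivial
    · rintro ⟨w, -, rfl⟩
      rw [map_sum, Finset.sum_mul]
      refine Submodule.sum_mem _ fun i _ => ?_
      -- To realize the i-th operator alone, take the frame element omitting dxᵢ/xᵢ: all the other
      -- terms repeat a factor and vanish. The sign of the resulting permutation is removed at the
      -- end by ε² = 1.
      have hbij : Function.Bijective (Fin.cons i i.succAbove : Fin (k + 1) → Fin (k + 1)) := by
        refine Finite.injective_iff_bijective.1 (Fin.cons_injective_iff.2 ⟨?_, ?_⟩)
        · rintro ⟨t, ht⟩; exact Fin.succAbove_ne i t ht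
        · exact Fin.succAbove_right_injective
      obtain ⟨ε, hε⟩ := E.wedge_of_bijective hbij
      have h1 : twistedDiff η (fn A (w i) * E.wedge i.succAbove)
          = ε • (fn A (E.op c i (w i)) * E.vol) := by
        rw [E.twistedDiff_fn_mul_wedge hη, Finset.sum_eq_single i]
        · rw [hε, mul_smul_comm]
        · intro j _ hj
          rw [E.wedge_of_not_injective, mul_zero]
          intro hinj
          obtain ⟨t, rfl⟩ := Fin.exists_succAbove_eq hj
          exact (Fin.cons_injective_iff.1 hinj).1 ⟨t, rfl⟩
        · simp
      have h2 : twistedDiff η (fn A (w i) * E.wedge i.succAbove) ∈ coboundaries η (k + 1) :=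
        ⟨_, fn_mul_mem _ (E.wedge_mem _), rfl⟩
      rw [h1] at h2
      have h3 := (coboundaries η (k + 1)).toAddSubgroup.zsmul_mem h2 (ε : ℤ)
      rw [Units.smul_def, smul_smul, Int.units_coe_mul_self, one_smul] at h3
      exact h3

theorem fn_mul_vol_mem_cocycles (η : Ω[B⁄A]) (b : B) : fn A b * E.vol ∈ cocycles η m :=
  ⟨E.eq_zero_of_mem_succ (twistedDiff_mem η (fn_mul_mem b E.vol_mem)), fn_mul_mem b E.vol_mem⟩

/-- The form `b dx₁/x₁ ∧ … ∧ dx_m/x_m`, as a cocycle. -/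
def topForm (η : Ω[B⁄A]) : B →ₗ[A] cocycles η m where
  toFun b := ⟨fn A b * E.vol, E.fn_mul_vol_mem_cocycles η b⟩
  map_add' b b' := Subtype.ext (by
    change fn A (b + b') * E.vol = fn A b * E.vol + fn A b' * E.vol
    rw [map_add, add_mul])
  map_smul' κ b := Subtype.ext (by
    change fn A (κ • b) * E.vol = κ • (fn A b * E.vol)
    rw [smul_eq_fn_mul, ← mul_assoc, ← map_mul, Algebra.smul_def])

/-- The class of the form `b dx₁/x₁ ∧ … ∧ dx_m/x_m`. -/
def topClass (η : Ω[B⁄A]) : B →ₗ[A] Cohomology η m := (cohomologyClass η m).comp (E.topForm η)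

theorem topClass_apply (η : Ω[B⁄A]) (b : B) :
    E.topClass η b = cohomologyClass η m ⟨fn A b * E.vol, E.fn_mul_vol_mem_cocycles η b⟩ := rfl

theorem topClass_surjective (η : Ω[B⁄A]) : Function.Surjective (E.topClass η) := by
  intro z
  obtain ⟨⟨ω, hω⟩, rfl⟩ := cohomologyClass_surjective η m z
  obtain ⟨b, rfl⟩ := E.exists_eq_fn_mul_vol hω.2
  exact ⟨b, rfl⟩

theorem topClass_eq_zero (hη : η = ∑ i, c i • dlog (E.x i) (E.v i)) {b : B} :
    E.topClass η b = 0 ↔ b ∈ sumRange (E.op c) ⊤ := by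
  rw [topClass_apply, cohomologyClass_eq_zero]
  exact E.fn_mul_vol_mem_coboundaries hη

theorem cohomologyMap_topClass {T : Forms A B →+ Forms A B}
    (hT : ∀ x, T (twistedDiff η x) = twistedDiff η (T x))
    (hdeg : ∀ k x, x ∈ formsDeg A B k → T x ∈ formsDeg A B k) {b b' : B}
    (h : T (fn A b * E.vol) = fn A b' * E.vol) :
    cohomologyMap hT hdeg m (E.topClass η b) = E.topClass η b' := by
  rw [topClass_apply, cohomologyMap_class, topClass_apply]
  exact congrArg _ (Subtype.ext h)

theorem connection_topClass {δ : Derivation ℤ A A} {θ : Derivation ℤ B B} (h : Extends δ θ)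
    (hθ : ∀ i, θ (E.x i) = 0) {e : B} (he : lieDeriv h (ExteriorAlgebra.ι B η) = dd A e) (b : B) :
    connection h he m (E.topClass η b) = E.topClass η (θ b + e * b) := by
  refine E.cohomologyMap_topClass _ _ ?_
  rw [lieDerivAdd_apply, lieDeriv_fn_mul, vol, E.lieDeriv_wedge h hθ, mul_zero, add_zero, map_add,
    map_mul, add_mul, mul_assoc]

theorem gaussManin_topClass [Algebra.FormallySmooth A B] {δ : Derivation ℤ A A}
    {θ : Derivation ℤ B B} (h : Extends δ θ) (hθ : ∀ i, θ (E.x i) = 0) (b : B) :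
    gaussManin δ m (E.topClass 0 b) = E.topClass 0 (θ b) := by
  rw [gaussManin_eq h]
  refine E.cohomologyMap_topClass _ _ ?_
  rw [lieDeriv_fn_mul, vol, E.lieDeriv_wedge h hθ, mul_zero, add_zero]

theorem pullbackCohomology_topClass {σ : B →ₐ[A] B} (hσ : ∀ i, σ (E.x i) = E.x i) (b : B) :
    pullbackCohomology σ m (E.topClass 0 b) = E.topClass 0 (σ b) := by
  refine E.cohomologyMap_topClass _ _ ?_
  change pullback σ (fn A b * E.vol) = _
  rw [map_mul, pullback_fn, vol, E.pullback_wedge hσ]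

end EtaleCoords

end EtaleCoords

/-! ### Étale coordinates on the open set `Ū` -/

section General

variable {A B : Type} [CommRing A] [CommRing B] [Algebra A B] {m : ℕ}

/-- A derivation of `B` which kills `A` is `A`-linear. -/
def derivationOfKills (θ : Derivation ℤ B B) (h : ∀ a, θ (algebraMap A B a) = 0) :
    Derivation A B B :=
  Derivation.mk'
    { toFun := θ
      map_add' := map_add θ
      map_smul' := by
        intro a b
        rw [Algebra.smul_def, Derivation.leibniz, h, smul_zero, add_zero, RingHom.id_apply,
          smul_eq_mul, Algebra.smul_def] }
    (fun b c => θ.leibniz b c)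

theorem derivationOfKills_apply (θ : Derivation ℤ B B) (h : ∀ a, θ (algebraMap A B a) = 0) (b : B) :
    derivationOfKills θ h b = θ b := rfl

/-- The functions `b` with `db = ∑ᵢ θᵢ(b) eᵢ`. -/
def coordSubalgebra (θ : Fin m → Derivation A B B) (e : Fin m → Ω[B⁄A]) : Subalgebra A B where
  carrier := {b | KaehlerDifferential.D A B b = ∑ i, θ i b • e i}
  mul_mem' := by
    intro b c (hb : _ = _) (hc : _ = _)
    change KaehlerDifferential.D A B (b * c) = _
    simp only [Derivation.leibniz, hb, hc, Finset.smul_sum, smul_smul, smul_eq_mul, add_smul,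
      Finset.sum_add_distrib]
  add_mem' := by
    intro b c (hb : _ = _) (hc : _ = _)
    change KaehlerDifferential.D A B (b + c) = _
    simp only [map_add, hb, hc, add_smul, Finset.sum_add_distrib]
  algebraMap_mem' := by
    intro a
    change KaehlerDifferential.D A B (algebraMap A B a) = _
    simp

theorem mem_coordSubalgebra {θ : Fin m → Derivation A B B} {e : Fin m → Ω[B⁄A]} {b : B} :
    b ∈ coordSubalgebra θ e ↔ KaehlerDifferential.D A B b = ∑ i, θ i b • e i := Iff.rfl

/-- Lets the formula for db be checked on coordinates and on g alone, their inverses being then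
covered. -/
theorem inv_mem_coordSubalgebra {θ : Fin m → Derivation A B B} {e : Fin m → Ω[B⁄A]} {u v : B}
    (h : v * u = 1) (hu : u ∈ coordSubalgebra θ e) : v ∈ coordSubalgebra θ e := by
  rw [mem_coordSubalgebra] at hu ⊢
  rw [Derivation.leibniz_of_mul_eq_one _ h, hu, Finset.smul_sum]
  refine Finset.sum_congr rfl fun i _ => ?_
  rw [Derivation.leibniz_of_mul_eq_one _ h, smul_smul, smul_eq_mul]

end General

/-! ### Powers of g and the frame dxᵢ/xᵢ on Ū -/

section TorusCoords

variable {N m : ℕ} (g : Laurent N m)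

instance : IsScalarTower (RatFun N) (Laurent N m) (TorusOpen g) :=
  IsScalarTower.of_algebraMap_eq fun _ => rfl

theorem exists_openEuler (i : Fin m) : ∃ θ : Derivation (RatFun N) (TorusOpen g) (TorusOpen g),
    ∀ p, θ (toOpen g p) = toOpen g (euler i p) := by
  have : Algebra.FormallySmooth (Laurent N m) (TorusOpen g) :=
    Algebra.FormallySmooth.of_isLocalization (Submonoid.powers g)
  obtain ⟨θ, hθ⟩ := exists_extends (A := Laurent N m) (B := TorusOpen g)
    ((euler (N := N) i).restrictScalars ℤ)
  refine ⟨derivationOfKills θ fun κ => ?_, hθ⟩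
  rw [IsScalarTower.algebraMap_apply (RatFun N) (Laurent N m) (TorusOpen g), hθ]
  simp

/-- The derivation `xᵢ ∂/∂xᵢ` of the coordinate ring of `Ū`. -/
def openEuler (i : Fin m) : Derivation (RatFun N) (TorusOpen g) (TorusOpen g) :=
  (exists_openEuler g i).choose

theorem openEuler_toOpen (i : Fin m) (p : Laurent N m) :
    openEuler g i (toOpen g p) = toOpen g (euler i p) := (exists_openEuler g i).choose_spec p

theorem toOpen_smul (κ : RatFun N) (p : Laurent N m) : toOpen g (κ • p) = κ • toOpen g p := by
  rw [Algebra.smul_def, map_mul, Algebra.smul_def]; rfl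

/-- The function `g^{-k}` on `Ū`. -/
def gPow (k : ℤ) : TorusOpen g :=
  ((Units.mk (gInv g) (toOpen g g) (gInv_mul g) (by rw [mul_comm, gInv_mul])) ^ k :
    (TorusOpen g)ˣ)

theorem gPow_zero : gPow g 0 = 1 := by simp [gPow]

theorem gPow_add (k l : ℤ) : gPow g (k + l) = gPow g k * gPow g l := by
  rw [gPow, zpow_add, Units.val_mul]; rfl

theorem gPow_one : gPow g 1 = gInv g := by simp [gPow]

theorem gPow_succ (k : ℤ) : gPow g (k + 1) = gPow g k * gInv g := by rw [gPow_add, gPow_one]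

theorem gPow_succ_mul (k : ℤ) : gPow g (k + 1) * toOpen g g = gPow g k := by
  rw [gPow_succ, mul_assoc, gInv_mul, mul_one]

theorem gPow_natCast (k : ℕ) : gPow g k = gInv g ^ k := by
  rw [gPow, zpow_natCast, Units.val_pow_eq_pow_val]

theorem gPow_neg_natCast (k : ℕ) : gPow g (-k) = toOpen g (g ^ k) := by
  rw [gPow, zpow_neg, ← inv_zpow, zpow_natCast, Units.val_pow_eq_pow_val, map_pow]; rfl

/-- Because `gPow` has the exponent -k, the derivative carries -k and raises the index by one.
Induction in both directions uses only the Leibniz rule for g^{-k} = g^{-(k+1)}·g. -/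
theorem derivation_gPow {R : Type*} [CommRing R] [Algebra R (TorusOpen g)]
    (θ : Derivation R (TorusOpen g) (TorusOpen g)) (k : ℤ) :
    θ (gPow g k) = -(k : TorusOpen g) * gPow g (k + 1) * θ (toOpen g g) := by
  have step : ∀ k : ℤ, θ (gPow g k) = gPow g (k + 1) * θ (toOpen g g)
      + toOpen g g * θ (gPow g (k + 1)) := by
    intro k
    conv_lhs => rw [← gPow_succ_mul]
    rw [Derivation.leibniz, smul_eq_mul, smul_eq_mul]
  induction k using Int.induction_on with
  | zero => rw [gPow_zero, Derivation.map_one_eq_zero]; simp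
  | succ k ih =>
    have h := step k
    rw [ih] at h
    have hu := gInv_mul g
    have h2 : gInv g * toOpen g g * θ (gPow g (k + 1))
        = gInv g * (-(k : TorusOpen g) * gPow g (k + 1) * θ (toOpen g g)
          - gPow g (k + 1) * θ (toOpen g g)) := by
      push_cast at h
      linear_combination -gInv g * h
    rw [hu, one_mul] at h2
    rw [h2, gPow_succ g (k + 1)]
    push_cast
    ring
  | pred k ih =>
    have h := step (-k - 1)
    rw [sub_add_cancel, ih] at h
    rw [sub_add_cancel, h]
    have e := gPow_succ_mul g (-k)
    push_cast
    linear_combination (-(-(k : TorusOpen g))) * θ (toOpen g g) * e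

/-- The lower bound on the pole order is free, as numerator and denominator may be multiplied by
powers of g; it keeps later lifts in the half space where γ behaves well. -/
theorem exists_eq_toOpen_mul_gPow (s : TorusOpen g) (k₀ : ℤ) :
    ∃ k, k₀ ≤ k ∧ ∃ p, s = toOpen g p * gPow g k := by
  obtain ⟨l, p, hp⟩ := IsLocalization.Away.surj g s
  have h1 : s = toOpen g p * gPow g l := by
    have h2 : toOpen g p = s * toOpen g g ^ l := hp.symm
    rw [h2, gPow_natCast, mul_assoc, ← mul_pow, mul_comm (toOpen g g), gInv_mul, one_pow, mul_one]
  refine ⟨max k₀ l, le_max_left _ _, p * g ^ (max k₀ l - l).toNat, ?_⟩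
  have h3 : gPow g l = gPow g (-((max k₀ l - l).toNat : ℤ)) * gPow g (max k₀ l) := by
    rw [← gPow_add, Int.toNat_of_nonneg (sub_nonneg.2 (le_max_right _ _))]
    congr 1; ring
  rw [map_mul, ← gPow_neg_natCast, mul_assoc, ← h3, h1]

theorem toOpen_mem {S : Subalgebra (RatFun N) (TorusOpen g)}
    (hx : ∀ i, toOpen g (lvar i) ∈ S) (hv : ∀ i, toOpen g (lvarInv i) ∈ S) (p : Laurent N m) :
    toOpen g p ∈ S := by
  have hmono : ∀ u : Fin m → ℤ, toOpen g (mono u 1) ∈ S := by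
    -- Asking for x^u and x^{-u} at the same time makes the admissible exponents a subgroup, so the
    -- unit vectors suffice.
    let U : AddSubgroup (Fin m → ℤ) :=
      { carrier := {u | toOpen g (mono u 1) ∈ S ∧ toOpen g (mono (-u) 1) ∈ S}
        zero_mem' := by
          rw [Set.mem_ofPred_eq, neg_zero, mono_zero_one, map_one]
          exact ⟨one_mem _, one_mem _⟩
        add_mem' := by
          intro u v hu hv
          have h : ∀ u v : Fin m → ℤ, (mono (u + v) 1 : Laurent N m) = mono u 1 * mono v 1 := by
            intro u v; rw [mono_mul, one_mul]
          rw [Set.mem_ofPred_eq, neg_add, h, h, map_mul, map_mul]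
          exact ⟨mul_mem hu.1 hv.1, mul_mem hu.2 hv.2⟩
        neg_mem' := by
          intro u hu
          exact ⟨hu.2, by rw [neg_neg]; exact hu.1⟩ }
    intro u
    have hu : u ∈ U := by
      rw [show u = ∑ i, u i • Pi.single i 1 by ext k; simp [Pi.single_apply]]
      exact sum_mem fun i _ => zsmul_mem (show Pi.single i 1 ∈ U from ⟨hx i, hv i⟩) _
    exact hu.1
  induction p using laurent_induction with
  | zero => rw [map_zero]; exact zero_mem _
  | add x y hx hy => rw [map_add]; exact add_mem hx hy
  | mono u κ =>
    rw [← mul_one κ, ← smul_mono, toOpen_smul]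
    exact S.smul_mem (hmono u) κ

/-- The coordinates `xᵢ` on `Ū`. -/
def openCoords : EtaleCoords (RatFun N) (TorusOpen g) m where
  x i := toOpen g (lvar i)
  v i := toOpen g (lvarInv i)
  v_mul i := by rw [← map_mul, lvarInv_mul, map_one]
  θ := openEuler g
  θ_x i j := by
    rw [openEuler_toOpen, lvar, euler_mono, Pi.single_apply]
    split_ifs
    · simp
    · rw [Int.cast_zero, zero_mul, mono_zero, map_zero]
  D_eq := by
    have hinv : ∀ i : Fin m, toOpen g (lvarInv i) * toOpen g (lvar i) = 1 := fun i => by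
      rw [← map_mul, lvarInv_mul, map_one]
    let e : Fin m → Ω[TorusOpen g⁄RatFun N] := fun i => dlog (toOpen g (lvar i)) (toOpen g (lvarInv i))
    have hx : ∀ i, toOpen g (lvar i) ∈ coordSubalgebra (openEuler g) e := by
      intro j
      rw [mem_coordSubalgebra, Finset.sum_eq_single j]
      · rw [openEuler_toOpen, lvar, euler_mono]
        simp only [e, dlog, Pi.single_eq_same, Int.cast_one, mul_one, smul_smul]
        have := hinv j
        rw [lvar] at this
        rw [mul_comm, this, one_smul]
        rfl
      · intro i _ h
        rw [openEuler_toOpen, lvar, euler_mono, Pi.single_eq_of_ne h, Int.cast_zero, zero_mul,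
          mono_zero, map_zero, zero_smul]
      · simp
    have hp := toOpen_mem g (S := coordSubalgebra (openEuler g) e) hx
      fun i => inv_mem_coordSubalgebra (hinv i) (hx i)
    intro b
    obtain ⟨k, hk, p, rfl⟩ := exists_eq_toOpen_mul_gPow g b 0
    refine mul_mem (hp p) ?_
    lift k to ℕ using hk
    rw [gPow_natCast]
    exact pow_mem (inv_mem_coordSubalgebra (gInv_mul g) (hp g)) k

variable (β : Fin (m + 1) → ℂ)

/-- The coefficients of the form `twistForm g β` with respect to the `dxᵢ/xᵢ`. -/
def twistCoeff (i : Fin m) : TorusOpen g :=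
  algebraMap (RatFun N) (TorusOpen g) (algebraMap ℂ (RatFun N) (β i.castSucc))
    - algebraMap (RatFun N) (TorusOpen g) (algebraMap ℂ (RatFun N) (β (Fin.last m)))
      * (gInv g * toOpen g (euler i g))

theorem twistForm_eq :
    twistForm g β = ∑ i, twistCoeff g β i • dlog ((openCoords g).x i) ((openCoords g).v i) := by
  have h : dlog (A := RatFun N) (toOpen g g) (gInv g)
      = ∑ i, (gInv g * toOpen g (euler i g)) • dlog ((openCoords g).x i) ((openCoords g).v i) := by
    rw [dlog, (openCoords g).D_eq, Finset.smul_sum]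
    refine Finset.sum_congr rfl fun i _ => ?_
    rw [smul_smul]
    congr 2
    exact openEuler_toOpen g i g
  rw [twistForm, h, Finset.smul_sum, ← Finset.sum_sub_distrib]
  refine Finset.sum_congr rfl fun i _ => ?_
  have e : ∀ (κ : RatFun N) (s : TorusOpen g) (ω : Ω[TorusOpen g⁄RatFun N]),
      (algebraMap (RatFun N) (TorusOpen g) κ * s) • ω = κ • s • ω := fun κ s ω => by
    rw [mul_smul, algebraMap_smul]
  rw [twistCoeff, sub_smul, e, algebraMap_smul (TorusOpen g) (algebraMap ℂ (RatFun N) _)]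
  rfl

end TorusCoords

/-! ### The comparison of Laurent polynomials with functions on `Ū` -/

section HomogeneousForm

variable {N m : ℕ} {a : Fin N → Fin (m + 1) → ℤ} {g : Laurent N m}

theorem addVariable_mono (u : Fin m → ℤ) (κ : RatFun N) :
    addVariable (mono u κ) = mono (Fin.snoc u 0) κ := AddMonoidAlgebra.mapDomain_single

theorem addVariable_add (x y : Laurent N m) :
    addVariable (x + y) = addVariable x + addVariable y := AddMonoidAlgebra.mapDomain_add _ _ _

theorem addVariable_zero : addVariable (0 : Laurent N m) = 0 := AddMonoidAlgebra.mapDomain_zero _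

theorem addVariable_injective : Function.Injective (addVariable : Laurent N m → Laurent N (m + 1)) :=
  AddMonoidAlgebra.mapDomain_injective fun u u' h => by
    simpa using congrArg (Fin.init (α := fun _ => ℤ)) h

theorem lvar_mul_addVariable_mem (x : Laurent N m) :
    lvar (Fin.last m) * addVariable x ∈ suppIn {u : Fin (m + 1) → ℤ | u (Fin.last m) = 1} := by
  induction x using laurent_induction with
  | zero => rw [addVariable_zero, mul_zero]; exact zero_mem _
  | add x y hx hy => rw [addVariable_add, mul_add]; exact add_mem hx hy
  | mono u κ =>
    rw [addVariable_mono, lvar, mono_mul]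
    exact mono_mem_suppIn (by simp) _

theorem coeffwise_mem_suppIn {n : ℕ} {s : Set (Fin n → ℤ)} (δ : Derivation ℤ (RatFun N) (RatFun N))
    {x : Laurent N n} (hx : x ∈ suppIn s) : coeffwise δ x ∈ suppIn s := by
  rw [mem_suppIn] at hx ⊢
  intro u hu
  have h : AddMonoidAlgebra.coeff (coeffwise δ x) u = δ (AddMonoidAlgebra.coeff x u) := rfl
  rw [h, hx u hu, map_zero]

/-- Applying ∂/∂λⱼ to f = xₙg gives x^{a⁽ʲ⁾} on one side, and on the other a polynomial all of whose
exponents have last component 1. -/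
theorem apply_last_eq_one (hfg : hypPoly a = lvar (Fin.last m) * addVariable g) (j : Fin N) :
    a j (Fin.last m) = 1 := by
  have h1 : mono (a j) 1 ∈ suppIn (N := N) {u : Fin (m + 1) → ℤ | u (Fin.last m) = 1} := by
    rw [← coeffwise_hypPoly, hfg]
    exact coeffwise_mem_suppIn _ (lvar_mul_addVariable_mem g)
  by_contra h
  have h2 := mem_suppIn.1 h1 (a j) h
  change AddMonoidAlgebra.coeff (AddMonoidAlgebra.single (a j) (1 : RatFun N)) (a j) = 0 at h2
  rw [AddMonoidAlgebra.coeff_single, Finsupp.single_eq_same] at h2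
  exact one_ne_zero h2

theorem eq_hypPoly_init (hfg : hypPoly a = lvar (Fin.last m) * addVariable g) :
    g = hypPoly fun j => Fin.init (a j) := by
  have hadd : ∀ (s : Finset (Fin N)) (F : Fin N → Laurent N m),
      addVariable (∑ j ∈ s, F j) = ∑ j ∈ s, addVariable (F j) := fun s F =>
    map_sum (⟨⟨addVariable, addVariable_zero⟩, addVariable_add⟩ : Laurent N m →+ _) _ _
  apply addVariable_injective
  have h : lvar (Fin.last m) * addVariable g
      = lvar (Fin.last m) * addVariable (hypPoly fun j => Fin.init (a j)) := by
    rw [← hfg, hypPoly, hypPoly, hadd, Finset.mul_sum]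
    refine Finset.sum_congr rfl fun j _ => ?_
    rw [addVariable_mono, lvar, mono_mul, one_mul]
    congr 1
    ext i
    refine Fin.lastCases ?_ (fun i => ?_) i
    · simp [apply_last_eq_one hfg]
    · simp [Fin.init]
  rw [← one_mul (addVariable g), ← lvarInv_mul (Fin.last m), mul_assoc, h, ← mul_assoc, lvarInv_mul,
    one_mul]

end HomogeneousForm

/-- A solution of the recursion `γ(k + 1) = (c - k) γ(k)` without zeros, for `k ≥ k₁`. -/
def IsGamma (c : ℂ) (k₁ : ℤ) (γ : ℤ → ℂ) : Prop :=
  ∀ k, k₁ ≤ k → γ (k + 1) = (c - k) * γ k ∧ γ k ≠ 0 ∧ c - k ≠ 0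

/-- The factor c - k can vanish only if c is an integer, and then the recursion is started just
above c. Up to normalization γ(k) plays the role of (-1)^k Γ(k - c). -/
theorem exists_isGamma (c : ℂ) : ∃ k₁ γ, IsGamma c k₁ γ := by
  have h : ∃ k₁ : ℤ, ∀ k : ℤ, k₁ ≤ k → c ≠ k := by
    by_cases hc : ∃ z : ℤ, c = z
    · obtain ⟨z, rfl⟩ := hc
      refine ⟨z + 1, fun k hk h => ?_⟩
      have := Int.cast_injective h
      omega
    · exact ⟨0, fun k _ h => hc ⟨k, h⟩⟩
  obtain ⟨k₁, hk₁⟩ := h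
  refine ⟨k₁, fun k => ∏ j ∈ Finset.range (k - k₁).toNat, (c - k₁ - j), fun k hk => ⟨?_, ?_, ?_⟩⟩
  · have h1 : (k + 1 - k₁).toNat = (k - k₁).toNat + 1 := by omega
    have h2 : (((k - k₁).toNat : ℕ) : ℂ) = (k : ℂ) - k₁ := by
      rw [← Int.cast_natCast, Int.toNat_of_nonneg (by omega), Int.cast_sub]
    beta_reduce
    rw [h1, Finset.prod_range_succ, h2]
    ring
  · rw [Finset.prod_ne_zero_iff]
    intro j _ h0
    refine hk₁ (k₁ + j) (by omega) ?_
    push_cast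
    linear_combination h0
  · exact sub_ne_zero.2 (hk₁ k hk)

/-! ### Elimination of the last variable -/

section Comparison

variable {N m : ℕ} (g : Laurent N m) (γ : ℤ → ℂ)

/-- The map which sends `x^u` to `γ(u_{m+1}) x₁^{u₁} ⋯ x_m^{u_m} g^{-u_{m+1}}`. -/
def toFunctions : Laurent N (m + 1) →ₗ[RatFun N] TorusOpen g :=
  monoLift fun u => algebraMap ℂ (RatFun N) (γ (u (Fin.last m))) •
    (toOpen g (mono (Fin.init u) 1) * gPow g (u (Fin.last m)))

theorem toFunctions_mono (u : Fin (m + 1) → ℤ) (κ : RatFun N) :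
    toFunctions g γ (mono u κ) = κ • algebraMap ℂ (RatFun N) (γ (u (Fin.last m))) •
      (toOpen g (mono (Fin.init u) 1) * gPow g (u (Fin.last m))) := monoLift_mono _ _ _

/-- Multiplication by `x_{m+1}^k`. -/
def homogenize (k : ℤ) : Laurent N m →ₗ[RatFun N] Laurent N (m + 1) :=
  monoLift fun u => mono (Fin.snoc u k) 1

theorem homogenize_mono (k : ℤ) (u : Fin m → ℤ) (κ : RatFun N) :
    homogenize k (mono u κ) = mono (Fin.snoc u k) κ := by
  rw [homogenize, monoLift_mono, smul_mono, mul_one]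

theorem homogenize_mem {k₁ k : ℤ} (hk : k₁ ≤ k) (r : Laurent N m) :
    homogenize k r ∈ suppIn {u : Fin (m + 1) → ℤ | k₁ ≤ u (Fin.last m)} := by
  induction r using laurent_induction with
  | zero => rw [map_zero]; exact zero_mem _
  | add x y hx hy => rw [map_add]; exact add_mem hx hy
  | mono u κ => rw [homogenize_mono]; exact mono_mem_suppIn (by simpa using hk) _

theorem toFunctions_homogenize (k : ℤ) (r : Laurent N m) :
    toFunctions g γ (homogenize k r)
      = algebraMap ℂ (RatFun N) (γ k) • (toOpen g r * gPow g k) := by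
  induction r using laurent_induction with
  | zero => simp
  | add x y hx hy => rw [map_add, map_add, hx, hy, map_add, add_mul, smul_add]
  | mono u κ =>
    rw [homogenize_mono, toFunctions_mono, Fin.snoc_last, Fin.init_snoc, smul_comm]
    congr 1
    rw [← smul_mul_assoc, ← toOpen_smul, smul_mono, mul_one]

variable {g γ}

/-- The exponents whose last component is at least `k₁`. -/
abbrev upper (m : ℕ) (k₁ : ℤ) : Set (Fin (m + 1) → ℤ) := {u | k₁ ≤ u (Fin.last m)}

theorem toFunctions_surjective {c : ℂ} {k₁ : ℤ} (hγ : IsGamma c k₁ γ) (s : TorusOpen g) :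
    ∃ v ∈ suppIn (upper m k₁), toFunctions g γ v = s := by
  obtain ⟨k, hk, r, rfl⟩ := exists_eq_toOpen_mul_gPow g s k₁
  refine ⟨homogenize k ((algebraMap ℂ (RatFun N) (γ k))⁻¹ • r), homogenize_mem hk _, ?_⟩
  rw [toFunctions_homogenize, toOpen_smul, smul_mul_assoc, smul_smul, mul_inv_cancel₀, one_smul]
  exact (map_ne_zero _).2 (hγ k hk).2.1



variable {a : Fin N → Fin (m + 1) → ℤ} {α : Fin (m + 1) → ℂ}

theorem add_gen_mem_upper (hfg : hypPoly a = lvar (Fin.last m) * addVariable g) (k₁ : ℤ) (j : Fin N)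
    (u : Fin (m + 1) → ℤ) (hu : u ∈ upper m k₁) : u + a j ∈ upper m k₁ := by
  change k₁ ≤ u (Fin.last m) + a j (Fin.last m)
  rw [apply_last_eq_one hfg]
  have : k₁ ≤ u (Fin.last m) := hu
  omega

/-- By the recursion for γ, multiplication by x^{a⁽ʲ⁾} becomes multiplication by (αₙ - uₙ) times the
j-th monomial of g, divided by g. Summing over j then produces g or its derivatives. -/
theorem toFunctions_mono_add (hfg : hypPoly a = lvar (Fin.last m) * addVariable g) {k₁ : ℤ}
    (hγ : IsGamma (α (Fin.last m)) k₁ γ) (j : Fin N) {u : Fin (m + 1) → ℤ} (hu : u ∈ upper m k₁)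
    (κ : RatFun N) : toFunctions g γ (mono (u + a j) κ)
      = algebraMap ℂ (RatFun N) (α (Fin.last m) - u (Fin.last m)) •
        (gInv g * toOpen g (mono (Fin.init (a j)) κ)) * toFunctions g γ (mono u 1) := by
  have h1 : (u + a j) (Fin.last m) = u (Fin.last m) + 1 := by
    rw [Pi.add_apply, apply_last_eq_one hfg]
  have h2 : (mono (Fin.init (u + a j)) 1 : Laurent N m)
      = mono (Fin.init u) 1 * mono (Fin.init (a j)) 1 := by
    rw [mono_mul, one_mul]; rfl
  have h3 : (mono (Fin.init (a j)) κ : Laurent N m) = κ • mono (Fin.init (a j)) 1 := by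
    rw [smul_mono, mul_one]
  rw [toFunctions_mono, toFunctions_mono, h1, h2, h3, (hγ _ hu).1, map_mul, map_mul, gPow_succ,
    toOpen_smul, one_smul]
  simp only [Algebra.smul_def, map_mul]
  ring

/-- The terms from the generators add up to (αₙ - uₙ)(xᵢ∂g/∂xᵢ)/g; the part with -uₙ is the
derivative of g^{-uₙ}, and the part with αₙ belongs to the twist by -α. -/
theorem toFunctions_dOp_castSucc (hfg : hypPoly a = lvar (Fin.last m) * addVariable g) {k₁ : ℤ}
    (hγ : IsGamma (α (Fin.last m)) k₁ γ) (i : Fin m) {v : Laurent N (m + 1)}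
    (hv : v ∈ suppIn (upper m k₁)) : toFunctions g γ (dOp a α i.castSucc v)
      = (openCoords g).op (twistCoeff g (-α)) i (toFunctions g γ v) := by
  have h : suppIn (upper m k₁) ≤ LinearMap.eqLocus (toFunctions g γ ∘ₗ dOp a α i.castSucc)
      ((openCoords g).op (twistCoeff g (-α)) i ∘ₗ toFunctions g γ) := by
    refine suppIn_le fun u hu => ?_
    change toFunctions g γ (dOp a α i.castSucc (mono u 1)) = (openCoords g).op _ i
      (toFunctions g γ (mono u 1))
    rw [dOp_mono, map_add, map_sum]
    simp only [toFunctions_mono_add hfg hγ _ hu]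
    rw [← Finset.sum_mul, ← Finset.smul_sum, ← Finset.mul_sum, ← map_sum]
    have h1 : ∑ j, (mono (Fin.init (a j)) ((a j i.castSucc : RatFun N) * lam j * 1) : Laurent N m)
        = euler i g := by
      rw [eq_hypPoly_init hfg, euler_hypPoly]
      exact Finset.sum_congr rfl fun j _ => by rw [mul_one]; rfl
    rw [h1, EtaleCoords.op_apply]
    change _ = openEuler g i _ + _
    rw [toFunctions_mono, toFunctions_mono, one_smul, Derivation.map_smul, Derivation.leibniz,
      openEuler_toOpen, euler_mono, derivation_gPow, openEuler_toOpen, twistCoeff, gPow_succ]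
    have h2 : (mono (Fin.init u) ((Fin.init u i : ℤ) * 1 : RatFun N) : Laurent N m)
        = ((u i.castSucc : ℤ) : RatFun N) • mono (Fin.init u) 1 := by
      rw [smul_mono]; rfl
    rw [h2, toOpen_smul]
    simp only [Algebra.smul_def, map_mul, map_sub, map_intCast, Algebra.algebraMap_self, RingHom.id_apply,
      Pi.neg_apply, map_neg, map_one]
    ring
  exact h hv

/-- The generators contribute αₙ - uₙ, because their monomials add up to g, which cancels 1/g; the
Euler term contributes uₙ - αₙ. -/
theorem toFunctions_dOp_last (hfg : hypPoly a = lvar (Fin.last m) * addVariable g) {k₁ : ℤ}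
    (hγ : IsGamma (α (Fin.last m)) k₁ γ) {v : Laurent N (m + 1)}
    (hv : v ∈ suppIn (upper m k₁)) : toFunctions g γ (dOp a α (Fin.last m) v) = 0 := by
  have h : suppIn (upper m k₁) ≤ LinearMap.ker (toFunctions g γ ∘ₗ dOp a α (Fin.last m)) := by
    refine suppIn_le fun u hu => ?_
    change toFunctions g γ (dOp a α (Fin.last m) (mono u 1)) = 0
    rw [dOp_mono, map_add, map_sum]
    simp only [toFunctions_mono_add hfg hγ _ hu]
    rw [← Finset.sum_mul, ← Finset.smul_sum, ← Finset.mul_sum, ← map_sum]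
    have h1 : ∑ j, (mono (Fin.init (a j)) ((a j (Fin.last m) : RatFun N) * lam j * 1) : Laurent N m)
        = g := by
      conv_rhs => rw [eq_hypPoly_init hfg, hypPoly]
      refine Finset.sum_congr rfl fun j _ => ?_
      rw [apply_last_eq_one hfg, Int.cast_one, one_mul, mul_one]
    rw [h1, gInv_mul, toFunctions_mono, toFunctions_mono, one_smul]
    simp only [Algebra.smul_def, map_mul, map_sub, map_intCast, map_one]
    ring
  exact h hv

theorem toFunctions_delOp (hfg : hypPoly a = lvar (Fin.last m) * addVariable g) {k₁ : ℤ}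
    (hγ : IsGamma (α (Fin.last m)) k₁ γ) (j : Fin N) {v : Laurent N (m + 1)}
    (hv : v ∈ suppIn (upper m k₁)) : toFunctions g γ (delOp a j v)
      = openDeriv g j (toFunctions g γ v) + twistFun g (-α) j * toFunctions g γ v := by
  rw [suppIn_eq_span] at hv
  induction hv using Submodule.span_induction with
  | mem x hx =>
    obtain ⟨u, hu, rfl⟩ := hx
    change toFunctions g γ (delOp a j (mono u 1)) = openDeriv g j (toFunctions g γ (mono u 1))
      + twistFun g (-α) j * toFunctions g γ (mono u 1)
    have h1 : coeffwise (partialDeriv j) g = mono (Fin.init (a j)) 1 := by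
      conv_lhs => rw [eq_hypPoly_init hfg]
      exact coeffwise_hypPoly _ j
    rw [delOp_mono, Derivation.map_one_eq_zero, mono_zero, zero_add, toFunctions_mono_add hfg hγ _ hu,
      toFunctions_mono, one_smul, openDeriv_smul, Derivation.leibniz, openDeriv_toOpen,
      coeffwise_mono, Derivation.map_one_eq_zero, mono_zero, map_zero, derivation_gPow,
      openDeriv_toOpen, twistFun, h1, gPow_succ]
    simp only [Algebra.smul_def, map_sub, map_intCast, Algebra.algebraMap_self, RingHom.id_apply,
      Pi.neg_apply, map_neg]
    ring
  | zero => simp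
  | add x y _ _ hx hy => simp only [map_add, hx, hy, mul_add]; ring
  | smul κ x _ hx =>
    rw [delOp_smul, map_add, map_smul, map_smul, map_smul, hx, Algebra.smul_def, Algebra.smul_def,
      Algebra.smul_def, Derivation.leibniz, openDeriv_extends g j, smul_eq_mul, smul_eq_mul]
    ring

theorem dOp_last_homogenize (hfg : hypPoly a = lvar (Fin.last m) * addVariable g) (k : ℤ)
    (r : Laurent N m) : dOp a α (Fin.last m) (homogenize k r)
      = ((k : RatFun N) - algebraMap ℂ (RatFun N) (α (Fin.last m))) • homogenize k r
        + homogenize (k + 1) (g * r) := by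
  induction r using laurent_induction with
  | zero => simp
  | add x y hx hy => simp only [map_add, hx, hy, mul_add, smul_add]; abel
  | mono u κ =>
    have hg : homogenize (k + 1) (g * mono u κ)
        = ∑ j, mono ((Fin.snoc u k : Fin (m + 1) → ℤ) + a j) (lam j * κ) := by
      conv_lhs => rw [eq_hypPoly_init hfg, hypPoly]
      rw [Finset.sum_mul, map_sum]
      refine Finset.sum_congr rfl fun j _ => ?_
      rw [mono_mul, homogenize_mono]
      congr 1
      ext i
      refine Fin.lastCases ?_ (fun i => ?_) i
      · simp [apply_last_eq_one hfg]
      · simp [Fin.init, add_comm]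
    rw [homogenize_mono, dOp_mono, hg, smul_mono, Fin.snoc_last]
    congr 1
    refine Finset.sum_congr rfl fun j _ => ?_
    rw [apply_last_eq_one hfg, Int.cast_one, one_mul]

/-- The image of the Laurent polynomials supported in the half space under the last operator. -/
def lastRange (a : Fin N → Fin (m + 1) → ℤ) (α : Fin (m + 1) → ℂ) (k₁ : ℤ) :
    Submodule (RatFun N) (Laurent N (m + 1)) :=
  (suppIn (upper m k₁)).map (dOp a α (Fin.last m))

/-- Modulo the image of Dₙ, the polynomial xₙᵏr equals xₙᵏ⁺¹gr divided by αₙ - k, which is nonzero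
for k ≥ k₁. Iterating raises the power of xₙ at the cost of powers of g. -/
theorem exists_homogenize_sub_mem (hfg : hypPoly a = lvar (Fin.last m) * addVariable g) {k₁ : ℤ}
    (hγ : IsGamma (α (Fin.last m)) k₁ γ) {k : ℤ} (hk : k₁ ≤ k) (l : ℕ) (r : Laurent N m) :
    ∃ κ : RatFun N, homogenize k r - homogenize (k + l) (κ • (g ^ l * r)) ∈ lastRange a α k₁ := by
  induction l with
  | zero => exact ⟨1, by simp⟩
  | succ l ih =>
    obtain ⟨κ, h⟩ := ih
    set c : RatFun N := algebraMap ℂ (RatFun N) (α (Fin.last m)) - ((k + l : ℤ) : RatFun N) with hc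
    have hc0 : c ≠ 0 := by
      have h0 := (map_ne_zero (algebraMap ℂ (RatFun N))).2 (hγ (k + l) (by omega)).2.2
      rwa [map_sub, map_intCast] at h0
    refine ⟨c⁻¹ * κ, ?_⟩
    have h1 : dOp a α (Fin.last m) (homogenize (k + l) (c⁻¹ • κ • (g ^ l * r))) ∈ lastRange a α k₁ :=
      Submodule.mem_map_of_mem (homogenize_mem (by omega) _)
    rw [dOp_last_homogenize hfg, ← neg_sub (algebraMap ℂ (RatFun N) _), ← hc,
      map_smul (homogenize (k + l)) c⁻¹, smul_smul, neg_mul, mul_inv_cancel₀ hc0, neg_smul,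
      one_smul] at h1
    have h2 : homogenize (k + (l + 1 : ℕ)) ((c⁻¹ * κ) • (g ^ (l + 1) * r))
        = homogenize (k + l + 1) (g * c⁻¹ • κ • (g ^ l * r)) := by
      rw [mul_smul_comm, mul_smul_comm, smul_smul, ← mul_assoc, ← pow_succ', Nat.cast_add,
        Nat.cast_one, add_assoc]
    rw [h2]
    convert sub_mem h h1 using 1
    abel

/-- All monomials of v can be brought to one common, arbitrarily high power of xₙ. The bound must
hold for all larger k so that two polynomials can be added. -/
theorem exists_sub_homogenize_mem (hfg : hypPoly a = lvar (Fin.last m) * addVariable g) {k₁ : ℤ}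
    (hγ : IsGamma (α (Fin.last m)) k₁ γ) {v : Laurent N (m + 1)} (hv : v ∈ suppIn (upper m k₁)) :
    ∃ k₀, k₁ ≤ k₀ ∧ ∀ k, k₀ ≤ k → ∃ r : Laurent N m, v - homogenize k r ∈ lastRange a α k₁ := by
  rw [suppIn_eq_span] at hv
  induction hv using Submodule.span_induction with
  | mem x hx =>
    obtain ⟨u, hu, rfl⟩ := hx
    refine ⟨u (Fin.last m), hu, fun k hk => ?_⟩
    obtain ⟨κ, h⟩ := exists_homogenize_sub_mem hfg hγ hu (k - u (Fin.last m)).toNat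
      (mono (Fin.init u) 1)
    rw [Int.toNat_of_nonneg (by omega), add_sub_cancel, homogenize_mono, Fin.snoc_init_self] at h
    exact ⟨_, h⟩
  | zero => exact ⟨k₁, le_rfl, fun k _ => ⟨0, by simp⟩⟩
  | add x y _ _ hx hy =>
    obtain ⟨k₀, hk₀, hx⟩ := hx
    obtain ⟨k₀', -, hy⟩ := hy
    refine ⟨max k₀ k₀', le_max_of_le_left hk₀, fun k hk => ?_⟩
    obtain ⟨r, hr⟩ := hx k (le_of_max_le_left hk)
    obtain ⟨r', hr'⟩ := hy k (le_of_max_le_right hk)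
    refine ⟨r + r', ?_⟩
    rw [map_add, add_sub_add_comm]
    exact add_mem hr hr'
  | smul κ x _ hx =>
    obtain ⟨k₀, hk₀, hx⟩ := hx
    refine ⟨k₀, hk₀, fun k hk => ?_⟩
    obtain ⟨r, hr⟩ := hx k hk
    refine ⟨κ • r, ?_⟩
    rw [map_smul, ← smul_sub]
    exact Submodule.smul_mem _ _ hr

theorem lastRange_le_ker (hfg : hypPoly a = lvar (Fin.last m) * addVariable g) {k₁ : ℤ}
    (hγ : IsGamma (α (Fin.last m)) k₁ γ) :
    lastRange a α k₁ ≤ LinearMap.ker (toFunctions g γ) := by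
  rintro _ ⟨v, hv, rfl⟩
  exact toFunctions_dOp_last hfg hγ hv

/-- Reduce to v = xₙᵏr. If the image vanishes, then r is zero on Ū, so some gˡ annihilates r, and
raising the power of xₙ by l steps shows that v lies in the image of Dₙ. -/
theorem toFunctions_eq_zero (hfg : hypPoly a = lvar (Fin.last m) * addVariable g) {k₁ : ℤ}
    (hγ : IsGamma (α (Fin.last m)) k₁ γ) {v : Laurent N (m + 1)} (hv : v ∈ suppIn (upper m k₁))
    (h0 : toFunctions g γ v = 0) : v ∈ lastRange a α k₁ := by
  obtain ⟨k, hk, h⟩ := exists_sub_homogenize_mem hfg hγ hv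
  obtain ⟨r, hr⟩ := h k le_rfl
  have h1 : toFunctions g γ (v - homogenize k r) = 0 := lastRange_le_ker hfg hγ hr
  rw [map_sub, h0, zero_sub, neg_eq_zero, toFunctions_homogenize, smul_eq_zero] at h1
  have h2 : toOpen g r = 0 := by
    rcases h1 with h1 | h1
    · exact absurd h1 ((map_ne_zero _).2 (hγ k hk).2.1)
    · have h3 := congrArg (· * gPow g (-k)) h1
      beta_reduce at h3
      rwa [mul_assoc, ← gPow_add, add_neg_cancel, gPow_zero, mul_one, zero_mul] at h3
  obtain ⟨⟨_, l, rfl⟩, hl⟩ := (IsLocalization.map_eq_zero_iff (Submonoid.powers g) (TorusOpen g) r).1 h2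
  obtain ⟨κ, h4⟩ := exists_homogenize_sub_mem hfg hγ hk l r
  have h5 : g ^ l * r = 0 := hl
  rw [h5, smul_zero, map_zero, sub_zero] at h4
  rw [← sub_add_cancel v (homogenize k r)]
  exact add_mem hr h4

/-- The comparison of the hypergeometric module with the cohomology of `Ū`. -/
theorem nonempty_equiv_torusCohomology (ha : AddSubgroup.closure (Set.range a) = ⊤)
    (hfg : hypPoly a = lvar (Fin.last m) * addVariable g) (hα : Nonresonant a α) :
    Nonempty (HypergeometricModule a α ≃ₗ[DiffOp N] TorusCohomology g (-α) m) := by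
  obtain ⟨k₁, γ, hγ⟩ := exists_isGamma (α (Fin.last m))
  let cls : TorusOpen g →ₗ[RatFun N] TorusCohomology g (-α) m :=
    (openCoords g).topClass (twistForm g (-α))
  have hcls : ∀ s, cls s = 0 ↔ s ∈ sumRange ((openCoords g).op (twistCoeff g (-α))) ⊤ := fun s =>
    (openCoords g).topClass_eq_zero (twistForm_eq g (-α))
  have hconn : ∀ j s, torusConnection g (-α) m j (cls s)
      = cls (openDeriv g j s + twistFun g (-α) j * s) := fun j s =>
    (openCoords g).connection_topClass (openDeriv_extends g j) (fun i => by
      change openDeriv g j (toOpen g (lvar i)) = 0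
      rw [openDeriv_toOpen, coeffwise_lvar, map_zero]) (lieDeriv_twistForm g (-α) j) s
  let F : Laurent N (m + 1) →ₗ[RatFun N] TorusCohomology g (-α) m := cls ∘ₗ toFunctions g γ
  have hstab : IsStable (dOp a α) (suppIn (upper m k₁)) :=
    isStable_upper (apply_last_eq_one hfg) k₁
  have hF : ∀ v ∈ sumRange (dOp a α) (suppIn (upper m k₁)), F v = 0 := by
    change _ ≤ LinearMap.ker F
    refine sumRange_le fun i v hv => ?_
    change cls (toFunctions g γ (dOp a α i v)) = 0
    refine Fin.lastCases ?_ (fun i => ?_) i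
    · rw [toFunctions_dOp_last hfg hγ hv, map_zero]
    · rw [toFunctions_dOp_castSucc hfg hγ i hv, hcls]
      exact apply_mem_sumRange i trivial
  -- The map is controlled only on exponents with uₙ ≥ k₁; `reach_upper` allows the extension to all
  -- of V.
  obtain ⟨Θ, h1, h2, h3, h4⟩ := exists_extension (dOp_commute a α)
    (reach_upper ha hα (apply_last_eq_one hfg) k₁) F hF
  refine nonempty_equiv_hypergeometricModule a α ha hα Θ.toAddMonoidHom (fun κ v => ?_)
    (fun j v => ?_) (fun z => ?_) fun v => ⟨h3 ?_ v, h2 v⟩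
  · rw [coeff_smul_torusCohomology]
    exact map_smul Θ κ v
  · rw [del_smul_torusCohomology]
    refine h4 (delOp a j) (torusConnection g (-α) m j) (fun v hv =>
      ⟨delOp_mem_suppIn (add_gen_mem_upper hfg k₁ j) hv, ?_⟩)
      (fun v hv => delOp_sumRange a α (W := ⊤) (fun _ _ => trivial) hv) v
    change cls (toFunctions g γ (delOp a j v)) = torusConnection g (-α) m j (cls (toFunctions g γ v))
    rw [hconn, toFunctions_delOp hfg hγ j hv]
  · obtain ⟨s, rfl⟩ := (openCoords g).topClass_surjective (twistForm g (-α)) z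
    obtain ⟨v, hv, rfl⟩ := toFunctions_surjective hγ s
    exact ⟨v, h1 v hv⟩
  · intro v hv h0
    -- If the class vanishes, the function is ∑(θᵢ + cᵢ)wᵢ. Lifting the wᵢ and subtracting the
    -- corresponding Dᵢ-images leaves an element of the kernel of `toFunctions`, that is, an image
    -- of Dₙ.
    obtain ⟨w, -, hw⟩ := (hcls _).1 h0
    choose w' hw' hww' using toFunctions_surjective (g := g) hγ
    have hmem : ∀ i : Fin m, dOp a α i.castSucc (w' (w i)) ∈ suppIn (upper m k₁) := fun i =>
      hstab _ _ (hw' (w i))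
    have h5 : v - ∑ i : Fin m, dOp a α i.castSucc (w' (w i)) ∈ lastRange a α k₁ := by
      refine toFunctions_eq_zero hfg hγ (sub_mem hv (Submodule.sum_mem _ fun i _ => hmem i)) ?_
      rw [map_sub, map_sum, hw, sub_eq_zero]
      refine Finset.sum_congr rfl fun i _ => ?_
      rw [toFunctions_dOp_castSucc hfg hγ i (hw' _), hww']
    obtain ⟨x, hx, h6⟩ := h5
    rw [← sub_add_cancel v (∑ i : Fin m, dOp a α i.castSucc (w' (w i))), ← h6]
    exact add_mem (apply_mem_sumRange _ hx)
      (Submodule.sum_mem _ fun i _ => apply_mem_sumRange _ (hw' _))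

end Comparison

/-! ### The covering obtained by adjoining a root of a unit -/

section RootCover

open Polynomial

variable {S : Type} [CommRing S] (d : ℕ) (h : S)

/-- The algebra `S[w]/(w^d - h)`. -/
def RootCover : Type := AdjoinRoot (X ^ d - C h : S[X])

instance : CommRing (RootCover d h) := inferInstanceAs (CommRing (AdjoinRoot (X ^ d - C h : S[X])))

instance : Algebra S (RootCover d h) :=
  inferInstanceAs (Algebra S (AdjoinRoot (X ^ d - C h : S[X])))

instance {A : Type} [Field A] [Algebra A S] : Algebra A (RootCover d h) :=
  inferInstanceAs (Algebra A (AdjoinRoot (X ^ d - C h : S[X])))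

instance {A : Type} [Field A] [Algebra A S] : IsScalarTower A S (RootCover d h) :=
  inferInstanceAs (IsScalarTower A S (AdjoinRoot (X ^ d - C h : S[X])))

/-- The root `w` of `h`. -/
def coverRoot : RootCover d h := AdjoinRoot.root _

theorem coverRoot_pow : coverRoot d h ^ d = algebraMap S (RootCover d h) h := by
  have h1 := AdjoinRoot.eval₂_root (X ^ d - C h : S[X])
  rw [eval₂_sub, eval₂_X_pow, eval₂_C, sub_eq_zero] at h1
  exact h1

section CoverHom

variable {d h} {A : Type} [Field A] [Algebra A S]

theorem eval₂_coverPoly {ζ : A} (hζ : ζ ^ d = 1) : (X ^ d - C h : S[X]).eval₂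
    (algebraMap S (RootCover d h)) (algebraMap A _ ζ * coverRoot d h) = 0 := by
  rw [eval₂_sub, eval₂_X_pow, eval₂_C, mul_pow, ← map_pow, hζ, map_one, one_mul, coverRoot_pow,
    sub_self]

variable (A) in
/-- The automorphism `w ↦ ζ w` of the covering. -/
def coverHom (ζ : A) (hζ : ζ ^ d = 1) : RootCover d h →ₐ[A] RootCover d h :=
  (AdjoinRoot.liftAlgHom (X ^ d - C h : S[X]) (Algebra.ofId S (RootCover d h))
    (algebraMap A _ ζ * coverRoot d h) (eval₂_coverPoly hζ)).restrictScalars A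

theorem coverHom_root (ζ : A) (hζ : ζ ^ d = 1) :
    coverHom A ζ hζ (coverRoot d h) = algebraMap A _ ζ * coverRoot d h :=
  AdjoinRoot.liftAlgHom_root _ _ _ (eval₂_coverPoly hζ)

theorem coverHom_algebraMap (ζ : A) (hζ : ζ ^ d = 1) (s : S) :
    coverHom A ζ hζ (algebraMap S (RootCover d h) s) = algebraMap S _ s :=
  AdjoinRoot.liftAlgHom_of _ _ _ (eval₂_coverPoly hζ) _

end CoverHom

variable [NeZero d]

theorem exists_coverBasis [Nontrivial S] :
    ∃ b : Module.Basis (Fin d) S (RootCover d h), ∀ k, b k = coverRoot d h ^ (k : ℕ) := by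
  let pb := AdjoinRoot.powerBasis' (monic_X_pow_sub_C h (NeZero.ne d))
  have hdim : pb.dim = d := natDegree_X_pow_sub_C
  have h1 : ∀ k, pb.basis.reindex (finCongr hdim) k = pb.gen ^ (k : ℕ) := fun k => by
    rw [Module.Basis.reindex_apply, pb.basis_eq_pow]
    rfl
  exact ⟨pb.basis.reindex (finCongr hdim), h1⟩

/-- The basis `1, w, …, w^{d-1}`. -/
def coverBasis [Nontrivial S] : Module.Basis (Fin d) S (RootCover d h) := (exists_coverBasis d h).choose

theorem coverBasis_apply [Nontrivial S] (k : Fin d) :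
    coverBasis d h k = coverRoot d h ^ (k : ℕ) := (exists_coverBasis d h).choose_spec k

theorem cover_eq_sum [Nontrivial S] (b : RootCover d h) :
    b = ∑ k, algebraMap S (RootCover d h) ((coverBasis d h).repr b k) * coverRoot d h ^ (k : ℕ) := by
  conv_lhs => rw [← (coverBasis d h).sum_repr b]
  exact Finset.sum_congr rfl fun k _ => by rw [Algebra.smul_def, coverBasis_apply]

variable {d h}

/-- The inverse of `w`. -/
def coverRootInv (d : ℕ) (h hi : S) : RootCover d h :=
  coverRoot d h ^ (d - 1) * algebraMap S (RootCover d h) hi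

theorem coverRootInv_mul {hi : S} (hh : hi * h = 1) :
    coverRootInv d h hi * coverRoot d h = 1 := by
  rw [coverRootInv, mul_right_comm, ← pow_succ, Nat.sub_add_cancel (NeZero.one_le), coverRoot_pow,
    ← map_mul, mul_comm, hh, map_one]

/-- The projection `∑ₖ sₖ w^{k+1} ↦ s₀`. -/
def coverProj [Nontrivial S] (d : ℕ) [NeZero d] (h hi : S) : RootCover d h →ₗ[S] S :=
  (coverBasis d h).coord 0 ∘ₗ LinearMap.mulLeft S (coverRootInv d h hi)

theorem coverProj_root_mul [Nontrivial S] {hi : S} (hh : hi * h = 1) (b : RootCover d h) :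
    coverProj d h hi (coverRoot d h * b) = (coverBasis d h).repr b 0 := by
  change (coverBasis d h).repr (coverRootInv d h hi * (coverRoot d h * b)) 0 = _
  rw [← mul_assoc, coverRootInv_mul hh, one_mul]

theorem coverProj_root_mul_algebraMap [Nontrivial S] {hi : S} (hh : hi * h = 1) (s : S) :
    coverProj d h hi (coverRoot d h * algebraMap S _ s) = s := by
  have h1 : algebraMap S (RootCover d h) s = s • coverBasis d h 0 := by
    rw [coverBasis_apply, Fin.val_zero, pow_zero, Algebra.smul_def, mul_one]
  rw [coverProj_root_mul hh, h1, map_smul, Module.Basis.repr_self]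
  simp

/-- As w is a unit, w, …, wᵈ is also a basis. With these exponents the tautological eigenspace
always has index 0, even for d = 1. -/
theorem exists_eq_root_mul [Nontrivial S] {hi : S} (hh : hi * h = 1) (b : RootCover d h) :
    ∃ c : Fin d → S, c 0 = coverProj d h hi b ∧
      b = ∑ k : Fin d, coverRoot d h ^ ((k : ℕ) + 1) * algebraMap S _ (c k) := by
  refine ⟨fun k => (coverBasis d h).repr (coverRootInv d h hi * b) k, rfl, ?_⟩
  have h1 : b = coverRoot d h * (coverRootInv d h hi * b) := by
    rw [← mul_assoc, mul_comm (coverRoot d h), coverRootInv_mul hh, one_mul]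
  conv_lhs => rw [h1, cover_eq_sum d h (coverRootInv d h hi * b), Finset.mul_sum]
  exact Finset.sum_congr rfl fun k _ => by rw [pow_succ']; ring

/-- A derivation is determined on `w` by its value on `h`. -/
theorem smul_derivation_coverRoot {R M : Type*} [CommRing R] [Algebra R (RootCover d h)]
    [AddCommGroup M] [Module (RootCover d h) M] [Module R M] (D : Derivation R (RootCover d h) M) :
    (algebraMap S (RootCover d h) (d * h)) • D (coverRoot d h)
      = coverRoot d h • D (algebraMap S _ h) := by
  rw [← coverRoot_pow, Derivation.leibniz_pow, ← Nat.cast_smul_eq_nsmul (RootCover d h), smul_smul,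
    smul_smul, map_mul, ← coverRoot_pow, map_natCast]
  congr 1
  have h1 : coverRoot d h ^ d = coverRoot d h ^ (d - 1) * coverRoot d h := by
    rw [← pow_succ, Nat.sub_add_cancel NeZero.one_le]
  rw [h1]
  ring

/-- From wᵈ = h one gets d·Θ(w)/w = θ(h)/h: a logarithmic derivative d·c of h becomes c for w. Thus
θ + c on S corresponds to Θ on wS. -/
theorem derivation_coverRoot {hi : S} (hh : hi * h = 1) (hd : IsUnit (d : S)) {θ : Derivation ℤ S S}
    {Θ : Derivation ℤ (RootCover d h) (RootCover d h)} (hΘ : Extends θ Θ) {c : S}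
    (hc : θ h = d * c * h) : Θ (coverRoot d h) = coverRoot d h * algebraMap S _ c := by
  have h1 := smul_derivation_coverRoot Θ
  have hu : IsUnit (algebraMap S (RootCover d h) (d * h)) :=
    (hd.mul (IsUnit.of_mul_eq_one_right _ hh)).map _
  rw [hΘ, hc] at h1
  refine hu.mul_left_cancel (h1.trans ?_)
  simp only [smul_eq_mul, map_mul]
  ring

/-- The derivation preserves each summand wᵏS, acting there as θ + kc; `coverProj` picks k = 1. So
relations on the covering project to relations of the twisted complex. -/
theorem coverProj_derivation [Nontrivial S] {hi : S} (hh : hi * h = 1) (hd : IsUnit (d : S))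
    {θ : Derivation ℤ S S} {Θ : Derivation ℤ (RootCover d h) (RootCover d h)} (hΘ : Extends θ Θ)
    {c : S} (hc : θ h = d * c * h) (b : RootCover d h) :
    coverProj d h hi (Θ b) = θ (coverProj d h hi b) + c * coverProj d h hi b := by
  have hw := derivation_coverRoot hh hd hΘ hc
  have hpow : ∀ k : ℕ, Θ (coverRoot d h ^ k) = coverRoot d h ^ k * algebraMap S _ (k * c) := by
    intro k
    induction k with
    | zero => simp
    | succ k ih =>
      rw [pow_succ, Derivation.leibniz, ih, hw, smul_eq_mul, smul_eq_mul, map_mul, map_mul,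
        map_natCast, map_natCast, Nat.cast_succ]
      ring
  have key : ∀ (k : Fin d) (s : S), coverProj d h hi (coverRoot d h ^ ((k : ℕ) + 1) * algebraMap S _ s)
      = if k = 0 then s else 0 := by
    intro k s
    have h1 : coverRoot d h ^ (k : ℕ) * algebraMap S (RootCover d h) s = s • coverBasis d h k := by
      rw [coverBasis_apply, Algebra.smul_def, mul_comm]
    rw [pow_succ', mul_assoc, coverProj_root_mul hh, h1, map_smul, Module.Basis.repr_self,
      Finsupp.smul_apply, Finsupp.single_apply, smul_eq_mul]
    split_ifs <;> simp
  obtain ⟨e, -, rfl⟩ := exists_eq_root_mul hh b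
  simp only [map_sum, Finset.mul_sum]
  rw [← Finset.sum_add_distrib]
  refine Finset.sum_congr rfl fun k _ => ?_
  rw [Derivation.leibniz, hΘ, hpow, smul_eq_mul, smul_eq_mul, ← mul_assoc, mul_comm (algebraMap S _ _),
    mul_assoc, ← map_mul, map_add, key, key, key]
  split_ifs with hk
  · subst hk
    simp
    ring
  · simp

theorem adjoin_coverRoot {A : Type*} [CommRing A] [Algebra A (RootCover d h)]
    {T : Subalgebra A (RootCover d h)} [Nontrivial S] (hS : ∀ s, algebraMap S _ s ∈ T)
    (hw : coverRoot d h ∈ T) (b : RootCover d h) : b ∈ T := by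
  rw [cover_eq_sum d h b]
  exact sum_mem fun k _ => mul_mem (hS _) (pow_mem hw _)

/-- The derivative d·w^{d-1} is a unit, since d and h are; this is a standard étale algebra with
nothing inverted. -/
theorem etale_rootCover {hi : S} (hh : hi * h = 1) (hd : IsUnit (d : S)) :
    Algebra.Etale S (RootCover d h) := by
  obtain ⟨e, he⟩ := hd.exists_right_inv
  let P : StandardEtalePair S :=
    { f := X ^ d - C h
      monic_f := monic_X_pow_sub_C h (NeZero.ne d)
      g := 1
      cond := by
        -- Bézout relation: (e/h)X times the derivative is Xᵈ/h, where e is the inverse of d, and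
        -- subtracting (Xᵈ - h)/h leaves 1.
        refine ⟨C (e * hi) * X, -C hi, 1, ?_⟩
        have h1 : (X : S[X]) ^ d = X ^ (d - 1) * X := by
          rw [← pow_succ, Nat.sub_add_cancel NeZero.one_le]
        have h2 : (C (d : S) : S[X]) * C e = 1 := by rw [← C_mul, he, C_1]
        have h3 : (C hi : S[X]) * C h = 1 := by rw [← C_mul, hh, C_1]
        rw [derivative_sub, derivative_X_pow, derivative_C, sub_zero, pow_one, C_mul, h1]
        linear_combination (X ^ (d - 1) * X * C hi) * h2 + h3 }
  let φ : P.Ring →ₐ[S] RootCover d h := P.lift (coverRoot d h) ⟨by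
    change aeval _ (X ^ d - C h : S[X]) = 0
    rw [map_sub, map_pow, aeval_X, aeval_C, coverRoot_pow, sub_self], by
    change IsUnit (aeval _ (1 : S[X]))
    rw [map_one]; exact isUnit_one⟩
  let ψ : RootCover d h →ₐ[S] P.Ring := AdjoinRoot.liftAlgHom _ (Algebra.ofId S _) P.X
    (StandardEtalePair.hasMap_X (P := P)).1
  have hφ : φ P.X = coverRoot d h := P.lift_X _ _
  have hψ : ψ (coverRoot d h) = P.X := AdjoinRoot.liftAlgHom_root _ _ _ _
  have e1 : φ.comp ψ = AlgHom.id S _ := AdjoinRoot.algHom_ext (by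
    change φ (ψ (coverRoot d h)) = coverRoot d h
    rw [hψ, hφ])
  have e2 : ψ.comp φ = AlgHom.id S _ := P.hom_ext (by
    change ψ (φ P.X) = P.X
    rw [hφ, hψ])
  exact Algebra.Etale.of_equiv (AlgEquiv.ofAlgHom φ ψ e1 e2)

variable {A : Type} [Field A] [Algebra A S] {m : ℕ}

/-- Étale coordinates on the covering. -/
def coverCoords [Nontrivial S] (E : EtaleCoords A S m) {hi : S} (hh : hi * h = 1) (hd : IsUnit (d : S))
    (θ : Fin m → Derivation ℤ (RootCover d h) (RootCover d h))
    (hθ : ∀ i, Extends (((E.θ i).restrictScalars ℤ)) (θ i)) : EtaleCoords A (RootCover d h) m where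
  x i := algebraMap S _ (E.x i)
  v i := algebraMap S _ (E.v i)
  v_mul i := by rw [← map_mul, E.v_mul, map_one]
  θ i := derivationOfKills (θ i) fun κ => by
    rw [IsScalarTower.algebraMap_apply A S (RootCover d h), hθ]
    simp
  θ_x i j := by
    rw [derivationOfKills_apply, hθ]
    change algebraMap S _ (E.θ i (E.x j)) = _
    rw [E.θ_x]
    split_ifs <;> simp
  D_eq := by
    have hk : ∀ i (κ : A), θ i (algebraMap A _ κ) = 0 := fun i κ => by
      rw [IsScalarTower.algebraMap_apply A S (RootCover d h), hθ]
      simp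
    let θ' : Fin m → Derivation A (RootCover d h) (RootCover d h) := fun i =>
      derivationOfKills (θ i) (hk i)
    let e : Fin m → Ω[RootCover d h⁄A] := fun i =>
      dlog (algebraMap S _ (E.x i)) (algebraMap S _ (E.v i))
    have hS : ∀ s, algebraMap S _ s ∈ coordSubalgebra θ' e := by
      intro s
      rw [mem_coordSubalgebra]
      have h1 := congrArg (KaehlerDifferential.map A A S (RootCover d h)) (E.D_eq s)
      rw [KaehlerDifferential.map_D, map_sum] at h1
      rw [h1]
      refine Finset.sum_congr rfl fun i _ => ?_
      rw [map_smul, ← algebraMap_smul (RootCover d h) (E.θ i s)]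
      congr 1
      · exact (hθ i s).symm
      · rw [dlog, map_smul, KaehlerDifferential.map_D, ← algebraMap_smul (RootCover d h) (E.v i)]
        rfl
    -- The functions with the right differential form a subalgebra containing S, so only w remains;
    -- its differential is fixed, after multiplication by the unit dh, by that of h.
    refine adjoin_coverRoot hS ?_
    have hu : IsUnit (algebraMap S (RootCover d h) (d * h)) :=
      (hd.mul (IsUnit.of_mul_eq_one_right _ hh)).map _
    rw [mem_coordSubalgebra]
    refine hu.smul_left_cancel.1 ?_
    rw [smul_derivation_coverRoot, (mem_coordSubalgebra.1 (hS h)), Finset.smul_sum, Finset.smul_sum]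
    refine Finset.sum_congr rfl fun i _ => ?_
    rw [smul_smul, smul_smul]
    congr 1
    exact (smul_derivation_coverRoot (θ' i)).symm

theorem cover_algHom_ext [Nontrivial S] {f f' : RootCover d h →ₐ[A] RootCover d h}
    (hS : ∀ s, f (algebraMap S _ s) = f' (algebraMap S _ s))
    (hw : f (coverRoot d h) = f' (coverRoot d h)) : f = f' :=
  AlgHom.ext fun b => adjoin_coverRoot (T := AlgHom.equalizer f f') hS hw b

theorem coverHom_mul [Nontrivial S] {ζ ζ' : A} (hζ : ζ ^ d = 1) (hζ' : ζ' ^ d = 1)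
    (hζζ' : (ζ * ζ') ^ d = 1) :
    (coverHom A ζ hζ).comp (coverHom A ζ' hζ') = coverHom (d := d) (h := h) A (ζ * ζ') hζζ' := by
  refine cover_algHom_ext (fun s => ?_) ?_
  · rw [AlgHom.comp_apply, coverHom_algebraMap, coverHom_algebraMap, coverHom_algebraMap]
  · rw [AlgHom.comp_apply, coverHom_root, map_mul, AlgHom.commutes, coverHom_root, coverHom_root,
      map_mul]
    ring

theorem coverHom_one [Nontrivial S] :
    coverHom A 1 (one_pow d) = AlgHom.id A (RootCover d h) := by
  refine cover_algHom_ext (fun s => ?_) ?_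
  · rw [coverHom_algebraMap]; rfl
  · rw [coverHom_root, map_one, one_mul]; rfl

end RootCover

/-! ### Smoothness of tori -/

section Smooth

variable {N m : ℕ}

/-- The homomorphism from `ℤᵐ` to a multiplicative group with prescribed values. -/
def zpowHom {G : Type*} [CommGroup G] (b : Fin m → G) : Multiplicative (Fin m → ℤ) →* G where
  toFun u := ∏ i, b i ^ u.toAdd i
  map_one' := by simp
  map_mul' u v := by simp [zpow_add, Finset.prod_mul_distrib]

theorem zpowHom_unique {G : Type*} [CommGroup G] (φ : Multiplicative (Fin m → ℤ) →* G)
    (u : Multiplicative (Fin m → ℤ)) :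
    φ u = zpowHom (fun i => φ (Multiplicative.ofAdd (Pi.single i 1))) u := by
  have h1 : u = ∏ i, (Multiplicative.ofAdd (Pi.single i 1 : Fin m → ℤ)) ^ (u.toAdd i) := by
    apply Multiplicative.toAdd.injective
    rw [toAdd_prod]
    ext k
    simp [Pi.single_apply]
  conv_lhs => rw [h1, map_prod]
  exact Finset.prod_congr rfl fun i _ => map_zpow _ _ _

/-- A homomorphism out of Laurent polynomials is a choice of m units, and units lift along a
square-zero ideal. -/
instance : Algebra.FormallySmooth (RatFun N) (Laurent N m) := by
  refine Algebra.FormallySmooth.of_comp_surjective fun B _ _ I hI f => ?_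
  let f' : AddMonoidAlgebra (RatFun N) (Fin m → ℤ) →ₐ[RatFun N] B ⧸ I := f
  let φ : Multiplicative (Fin m → ℤ) →* (B ⧸ I)ˣ :=
    ((f' : _ →* B ⧸ I).comp (AddMonoidAlgebra.of (RatFun N) (Fin m → ℤ))).toHomUnits
  have hφ : ∀ u, (φ u : B ⧸ I) = f' (AddMonoidAlgebra.single u.toAdd 1) := fun u => rfl
  have hlift : ∀ i : Fin m, ∃ b : Bˣ, Units.map (Ideal.Quotient.mk I : B →* B ⧸ I) b
      = φ (Multiplicative.ofAdd (Pi.single i 1)) := by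
    intro i
    obtain ⟨b, hb⟩ := Ideal.Quotient.mk_surjective
      (φ (Multiplicative.ofAdd (Pi.single i 1)) : B ⧸ I)
    have hu : IsUnit b := (IsNilpotent.isUnit_quotient_mk_iff (I := I) ⟨2, hI⟩).1 (by
      rw [hb]; exact Units.isUnit _)
    exact ⟨hu.unit, Units.ext hb⟩
  choose b hb using hlift
  let F : AddMonoidAlgebra (RatFun N) (Fin m → ℤ) →ₐ[RatFun N] B :=
    AddMonoidAlgebra.lift (RatFun N) B (Fin m → ℤ) ((Units.coeHom B).comp (zpowHom b))
  refine ⟨F, ?_⟩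
  change (Ideal.Quotient.mkₐ (RatFun N) I).comp F = f'
  refine AddMonoidAlgebra.algHom_ext (fun u : Fin m → ℤ => ?_) (Subsingleton.elim _ _)
  have h1 : F (AddMonoidAlgebra.single u 1) = (zpowHom b (Multiplicative.ofAdd u) : Bˣ) := by
    simp [F]
  rw [AlgHom.comp_apply, h1]
  refine Eq.trans ?_ (hφ (Multiplicative.ofAdd u))
  rw [zpowHom_unique φ]
  change ((Units.map (Ideal.Quotient.mk I : B →* B ⧸ I) (zpowHom b _) : (B ⧸ I)ˣ) : B ⧸ I) = _
  congr 1
  change Units.map _ (∏ i : Fin m, b i ^ u i)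
    = ∏ i : Fin m, φ (Multiplicative.ofAdd (Pi.single i 1)) ^ u i
  rw [map_prod]
  exact Finset.prod_congr rfl fun i _ => by rw [map_zpow, hb]

instance : Algebra.FinitePresentation (RatFun N) (Laurent N m) := by
  have : AddMonoid.FG (Fin m → ℤ) := inferInstance
  have h : Algebra.FiniteType (RatFun N) (AddMonoidAlgebra (RatFun N) (Fin m → ℤ)) := inferInstance
  exact Algebra.FinitePresentation.of_finiteType.1 h

instance : Algebra.Smooth (RatFun N) (Laurent N m) where

theorem smooth_torusOpen (g : Laurent N m) : Algebra.Smooth (RatFun N) (TorusOpen g) := by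
  have : Algebra.Smooth (Laurent N m) (TorusOpen g) := Algebra.Smooth.of_isLocalization_Away g
  exact Algebra.Smooth.comp (RatFun N) (Laurent N m) (TorusOpen g)

theorem smooth_rootCover (g : Laurent N m) {d : ℕ} [NeZero d] {h hi : TorusOpen g} (hh : hi * h = 1)
    (hd : IsUnit (d : TorusOpen g)) : Algebra.Smooth (RatFun N) (RootCover d h) := by
  have := smooth_torusOpen g
  have := etale_rootCover hh hd
  exact Algebra.Smooth.comp (RatFun N) (TorusOpen g) (RootCover d h)

end Smooth

/-! ### The action of the roots of unity on the covering -/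

section IsotypicCover

variable {N m : ℕ}

/-- The tautological character of the group of roots of unity. -/
def tautological (d : ℕ) : Representation ℂ (rootsOfUnity d ℂ) ℂ where
  toFun ζ := LinearMap.mulLeft ℂ ((ζ : ℂˣ) : ℂ)
  map_one' := by ext; simp
  map_mul' ζ ζ' := by ext; simp

theorem tautological_apply {d : ℕ} (ζ : rootsOfUnity d ℂ) (v : ℂ) :
    tautological d ζ v = ((ζ : ℂˣ) : ℂ) * v := rfl

theorem tautological_isIrreducible (d : ℕ) : (tautological d).IsIrreducible where
  exists_pair_ne := ⟨⊥, ⊤, fun h => by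
    have h1 := congrArg (fun W => (1 : ℂ) ∈ W.toSubmodule) h
    have h2 : (1 : ℂ) ∈ (⊥ : Submodule ℂ ℂ) := h1.mpr trivial
    exact one_ne_zero ((Submodule.mem_bot ℂ).1 h2)⟩
  eq_bot_or_eq_top W := by
    rcases eq_bot_or_eq_top W.toSubmodule with h | h
    · exact Or.inl (Subrepresentation.toSubmodule_injective h)
    · exact Or.inr (Subrepresentation.toSubmodule_injective h)

variable {d : ℕ}

/-- The root of unity `ζ`, as a constant. -/
def constRoot (N : ℕ) {d : ℕ} (ζ : rootsOfUnity d ℂ) : RatFun N :=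
  algebraMap ℂ (RatFun N) ((ζ : ℂˣ) : ℂ)

theorem constRoot_pow (ζ : rootsOfUnity d ℂ) : constRoot N ζ ^ d = 1 := by
  rw [constRoot, ← map_pow, ← Units.val_pow_eq_pow_val, (mem_rootsOfUnity d _).1 ζ.2, Units.val_one,
    map_one]

theorem constRoot_mul (ζ ζ' : rootsOfUnity d ℂ) :
    constRoot N (ζ * ζ') = constRoot N ζ * constRoot N ζ' := by
  simp [constRoot]

theorem constRoot_one : constRoot N (1 : rootsOfUnity d ℂ) = 1 := by simp [constRoot]

variable {S : Type} [CommRing S] [Nontrivial S] [Algebra (RatFun N) S] [NeZero d] {h : S}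

/-- The action `w ↦ ζ w` on the covering, by homomorphisms. -/
def coverActionHom : rootsOfUnity d ℂ →* (RootCover d h →ₐ[RatFun N] RootCover d h) where
  toFun ζ := coverHom (RatFun N) (constRoot N ζ) (constRoot_pow ζ)
  map_one' := by
    simp only [constRoot_one]
    exact coverHom_one
  map_mul' ζ ζ' := by
    simp only [constRoot_mul]
    exact (coverHom_mul _ _ _).symm

/-- The action `w ↦ ζ w` of the roots of unity on the covering. -/
def coverAction : rootsOfUnity d ℂ →* (RootCover d h ≃ₐ[RatFun N] RootCover d h) :=
  (AlgEquiv.algHomUnitsEquiv (RatFun N) (RootCover d h)).toMonoidHom.comp coverActionHom.toHomUnits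

theorem coverAction_apply (ζ : rootsOfUnity d ℂ) (b : RootCover d h) :
    coverAction (N := N) ζ b = coverHom (RatFun N) (constRoot N ζ) (constRoot_pow ζ) b := rfl

theorem coverAction_root (ζ : rootsOfUnity d ℂ) :
    coverAction (N := N) ζ (coverRoot d h) = constRoot N ζ • coverRoot d h := by
  rw [coverAction_apply, coverHom_root, Algebra.smul_def]

theorem coverAction_algebraMap (ζ : rootsOfUnity d ℂ) (s : S) :
    coverAction (N := N) ζ (algebraMap S (RootCover d h) s) = algebraMap S _ s := by
  rw [coverAction_apply, coverHom_algebraMap]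

theorem coverAction_pow_mul (ζ : rootsOfUnity d ℂ) (k : ℕ) (s : S) :
    coverAction (N := N) ζ (coverRoot d h ^ k * algebraMap S _ s)
      = constRoot N ζ ^ k • (coverRoot d h ^ k * algebraMap S _ s) := by
  rw [map_mul, map_pow, coverAction_root, coverAction_algebraMap, smul_pow, smul_mul_assoc]

/-- The isotypic component of the tautological character in the top de Rham cohomology of the
covering. -/
theorem mem_deRhamIsotypic_cover {hi : S} (hh : hi * h = 1)
    (E : EtaleCoords (RatFun N) (RootCover d h) m)
    (hE : ∀ ζ i, coverAction (N := N) ζ (E.x i) = E.x i) (z : DeRham N (RootCover d h) m) :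
    z ∈ deRhamIsotypic (coverAction (N := N) (d := d) (h := h)) (tautological d) m ↔
      ∃ s, E.topClass 0 (coverRoot d h * algebraMap S _ s) = z := by
  let cls : RootCover d h →ₗ[RatFun N] DeRham N (RootCover d h) m := E.topClass 0
  have hact : ∀ ζ b, deRhamMap (coverAction (N := N) (d := d) (h := h) ζ) m (cls b)
      = cls (coverAction (N := N) ζ b) := fun ζ b => E.pullbackCohomology_topClass (hE ζ) b
  constructor
  · intro hz
    let R : Submodule (RatFun N) (DeRham N (RootCover d h) m) := LinearMap.range
      (cls ∘ₗ LinearMap.mulLeft (RatFun N) (coverRoot d h) ∘ₗ (Algebra.linearMap S _).restrictScalars _)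
    change z ∈ R
    refine Submodule.span_le.2 ?_ hz
    rintro _ ⟨φ, -, hφ, v, rfl⟩
    -- An equivariant image of the tautological character consists of common eigenvectors.
    have heig : ∀ ζ : rootsOfUnity d ℂ, deRhamMap (coverAction (N := N) (d := d) (h := h) ζ) m (φ v)
        = constRoot N ζ • φ v := by
      intro ζ
      rw [← hφ, tautological_apply, ← smul_eq_mul, LinearMap.map_smulₛₗ]
      rfl
    obtain ⟨b, hb⟩ := E.topClass_surjective 0 (φ v)
    change cls b = φ v at hb
    rw [← hb] at heig ⊢
    obtain ⟨c, -, hc⟩ := exists_eq_root_mul hh b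
    let y : Fin d → DeRham N (RootCover d h) m := fun k =>
      cls (coverRoot d h ^ ((k : ℕ) + 1) * algebraMap S _ (c k))
    -- Dividing the eigenvector equation by ζ shifts the exponents to 0, …, d - 1. The left side no
    -- longer depends on ζ, so one can average.
    have hsum : ∀ ζ : rootsOfUnity d ℂ, cls b = ∑ k : Fin d, constRoot N ζ ^ (k : ℕ) • y k := by
      intro ζ
      have h0 : constRoot N ζ ≠ 0 := fun h0 => by
        have := constRoot_pow (N := N) ζ
        rw [h0, zero_pow (NeZero.ne d)] at this
        exact zero_ne_one this
      have h1 := heig ζ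
      rw [hact] at h1
      rw [← inv_smul_smul₀ h0 (cls b), ← h1, hc, map_sum, map_sum, Finset.smul_sum]
      refine Finset.sum_congr rfl fun k _ => ?_
      rw [coverAction_pow_mul, map_smul, smul_smul, pow_succ', inv_mul_cancel_left₀ h0]
    have hprim := Complex.isPrimitiveRoot_exp d (NeZero.ne d)
    let ζ₀ : rootsOfUnity d ℂ := hprim.toRootsOfUnity
    set ξ : RatFun N := constRoot N ζ₀ with hξ
    have hξprim : IsPrimitiveRoot ξ d := hprim.map_of_injective (algebraMap ℂ (RatFun N)).injective
    have hpow : ∀ i : ℕ, constRoot N (ζ₀ ^ i) = ξ ^ i := by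
      intro i
      simp [hξ, constRoot]
    have : CharZero (RatFun N) :=
      charZero_of_injective_algebraMap (algebraMap ℂ (RatFun N)).injective
    have hd0 : (d : RatFun N) ≠ 0 := Nat.cast_ne_zero.2 (NeZero.ne d)
    -- Summing over the powers of a primitive root kills all components except the one of index 0.
    -- This works in cohomology and does not require its direct sum decomposition.
    have h2 : (d : RatFun N) • cls b = (d : RatFun N) • y 0 := by
      have h3 : (d : RatFun N) • cls b = ∑ i ∈ Finset.range d, cls b := by
        rw [Finset.sum_const, Finset.card_range, Nat.cast_smul_eq_nsmul]
      rw [h3, Finset.sum_congr rfl fun i _ => hsum (ζ₀ ^ i), Finset.sum_comm]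
      simp only [hpow, ← Finset.sum_smul]
      rw [Finset.sum_eq_single 0]
      · simp
      · intro k _ hk
        have h4 : ξ ^ (k : ℕ) ≠ 1 := hξprim.pow_ne_one_of_pos_of_lt
          (fun h => hk (Fin.ext h)) k.2
        have h5 : ∑ i ∈ Finset.range d, (ξ ^ i) ^ (k : ℕ) = 0 := by
          have h6 := geom_sum_mul (ξ ^ (k : ℕ)) d
          rw [pow_right_comm ξ _ d, hξprim.pow_eq_one, one_pow, sub_self] at h6
          simp only [← pow_mul, mul_comm _ (k : ℕ)] at h6 ⊢
          exact (mul_eq_zero.1 h6).resolve_right (sub_ne_zero.2 h4)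
        rw [h5, zero_smul]
      · simp
    have h7 := smul_right_injective _ hd0 h2
    refine ⟨c 0, ?_⟩
    rw [h7]
    change cls _ = cls _
    simp
  · rintro ⟨s, rfl⟩
    change cls _ ∈ _
    set z := cls (coverRoot d h * algebraMap S _ s) with hz
    -- The isotypic component is spanned by images of injective maps, so the zero class is treated
    -- separately.
    by_cases h0 : z = 0
    · rw [h0]; exact zero_mem _
    let φ : ℂ →ₛₗ[algebraMap ℂ (RatFun N)] DeRham N (RootCover d h) m :=
      { toFun := fun v => algebraMap ℂ (RatFun N) v • z
        map_add' := fun v v' => by rw [map_add, add_smul]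
        map_smul' := fun c v => by rw [smul_eq_mul, map_mul, mul_smul] }
    refine Submodule.subset_span ⟨φ, ?_, ?_, 1, ?_⟩
    · intro v v' hv
      exact (algebraMap ℂ (RatFun N)).injective (smul_left_injective _ h0 hv)
    · intro ζ v
      change algebraMap ℂ (RatFun N) _ • z = deRhamMap _ m (algebraMap ℂ (RatFun N) v • z)
      have h1 := coverAction_pow_mul (N := N) (h := h) ζ 1 s
      rw [pow_one, pow_one] at h1
      have h2 : deRhamMap (coverAction (N := N) (d := d) (h := h) ζ) m
          (algebraMap ℂ (RatFun N) v • z) = cls (coverAction (N := N) ζ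
            (algebraMap ℂ (RatFun N) v • (coverRoot d h * algebraMap S _ s))) := by
        rw [hz, ← map_smul cls]
        exact hact _ _
      rw [h2, map_smul, h1, map_smul, map_smul, smul_smul, tautological_apply, map_mul, mul_comm]
      rfl
    · change algebraMap ℂ (RatFun N) 1 • z = z
      rw [map_one, one_smul]

end IsotypicCover

/-! ### The case of rational parameters -/

section Rational

variable {N m : ℕ} {a : Fin N → Fin (m + 1) → ℤ} {g : Laurent N m} {α : Fin (m + 1) → ℂ}

/-- If g = 0 then f = 0, which is impossible when A is nonempty, because ∂f/∂λⱼ is a monomial; and A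
is nonempty, as it generates ℤ^{m+1}. Laurent polynomials form a domain, so inverting g ≠ 0 gives a
nonzero ring. -/
theorem nontrivial_torusOpen (ha : AddSubgroup.closure (Set.range a) = ⊤)
    (hfg : hypPoly a = lvar (Fin.last m) * addVariable g) : Nontrivial (TorusOpen g) := by
  have hg : g ≠ 0 := by
    rintro rfl
    rcases isEmpty_or_nonempty (Fin N) with hN | ⟨⟨j⟩⟩
    · rw [Set.range_eq_empty, AddSubgroup.closure_empty] at ha
      have h1 : (Pi.single (Fin.last m) 1 : Fin (m + 1) → ℤ) ∈ (⊥ : AddSubgroup _) := by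
        rw [ha]; trivial
      have h2 := congrFun (AddSubgroup.mem_bot.1 h1) (Fin.last m)
      simp at h2
    · have h1 := coeffwise_hypPoly a j
      rw [hfg, addVariable_zero, mul_zero, map_zero] at h1
      have h2 : AddMonoidAlgebra.single (a j) (1 : RatFun N) = 0 := h1.symm
      exact one_ne_zero (AddMonoidAlgebra.single_eq_zero.1 h2)
  have : IsDomain (Laurent N m) :=
    inferInstanceAs (IsDomain (AddMonoidAlgebra (RatFun N) (Fin m → ℤ)))
  have := IsLocalization.isDomain_localization (powers_le_nonZeroDivisors_of_noZeroDivisors hg)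
  exact inferInstanceAs (Nontrivial (Localization.Away g))

theorem exists_common_denominator {n : ℕ} (q : Fin n → ℚ) :
    ∃ (d : ℕ) (_ : NeZero d) (e : Fin n → ℤ), ∀ i, (e i : ℂ) = d * (q i : ℂ) := by
  refine ⟨∏ i, (q i).den, ⟨Finset.prod_ne_zero_iff.2 fun i _ => (q i).den_nz⟩,
    fun i => (q i).num * ∏ j ∈ Finset.univ.erase i, ((q j).den : ℤ), fun i => ?_⟩
  have h1 : ((q i : ℚ) : ℂ) * (q i).den = (q i).num := by
    exact_mod_cast Rat.mul_den_eq_num (q i)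
  rw [← Finset.mul_prod_erase _ _ (Finset.mem_univ i)]
  push_cast
  rw [← h1]
  ring

variable (g) in
/-- The function `x₁^{e₁} ⋯ x_m^{e_m} g^k`. -/
def monoFun (e : Fin m → ℤ) (k : ℤ) : TorusOpen g := toOpen g (mono e 1) * gPow g (-k)

theorem monoFun_mul (e e' : Fin m → ℤ) (k k' : ℤ) :
    monoFun g e k * monoFun g e' k' = monoFun g (e + e') (k + k') := by
  have h1 : (mono (e + e') 1 : Laurent N m) = mono e 1 * mono e' 1 := by rw [mono_mul, one_mul]
  rw [monoFun, monoFun, monoFun, h1, map_mul, neg_add, gPow_add]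
  ring

theorem monoFun_zero : monoFun g 0 0 = 1 := by
  rw [monoFun, neg_zero, gPow_zero, mono_zero_one, map_one, mul_one]

theorem openEuler_monoFun (i : Fin m) (e : Fin m → ℤ) (k : ℤ) : openEuler g i (monoFun g e k)
    = ((e i : TorusOpen g) + k * (gInv g * toOpen g (euler i g))) * monoFun g e k := by
  have h1 : (mono e ((e i : RatFun N) * 1) : Laurent N m) = (e i : RatFun N) • mono e 1 := by
    rw [smul_mono]
  rw [monoFun, Derivation.leibniz, derivation_gPow, openEuler_toOpen, openEuler_toOpen, euler_mono,
    h1, toOpen_smul, gPow_succ]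
  simp only [Algebra.smul_def, map_intCast, Algebra.algebraMap_self, RingHom.id_apply, Int.cast_neg]
  ring

theorem openDeriv_monoFun (j : Fin N) (e : Fin m → ℤ) (k : ℤ) : openDeriv g j (monoFun g e k)
    = k * (gInv g * toOpen g (coeffwise (partialDeriv j) g)) * monoFun g e k := by
  rw [monoFun, Derivation.leibniz, derivation_gPow, openDeriv_toOpen, openDeriv_toOpen,
    coeffwise_mono, Derivation.map_one_eq_zero, mono_zero, map_zero, gPow_succ]
  simp only [smul_eq_mul, Int.cast_neg]
  ring

theorem comesFromGeometry_torusCohomology [Nontrivial (TorusOpen g)]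
    (hq : ∃ q : Fin (m + 1) → ℚ, ∀ i, α i = (q i : ℂ)) :
    ComesFromGeometry N (TorusCohomology g (-α) m) := by
  obtain ⟨q, hq⟩ := hq
  obtain ⟨d, _, e, he⟩ := exists_common_denominator q
  have heK : ∀ i, algebraMap (RatFun N) (TorusOpen g) (algebraMap ℂ (RatFun N) (d * α i)) = e i := by
    intro i
    rw [hq, ← he, map_intCast, map_intCast]
  -- The exponents -dαᵢ of xᵢ and dαₙ of g are integers, chosen so that dh/h is d times the twisting
  -- form; formally w is x^{-α}g^{αₙ}, with x the first m variables.
  let h : TorusOpen g := monoFun g (-Fin.init e) (e (Fin.last m))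
  let hi : TorusOpen g := monoFun g (Fin.init e) (-e (Fin.last m))
  have hh : hi * h = 1 := by
    rw [monoFun_mul, add_neg_cancel, neg_add_cancel, monoFun_zero]
  have hd : IsUnit (d : TorusOpen g) := by
    have h1 : (d : TorusOpen g) = algebraMap (RatFun N) _ (algebraMap ℂ (RatFun N) d) := by
      rw [map_natCast, map_natCast]
    rw [h1]
    exact ((Nat.cast_ne_zero.2 (NeZero.ne d)).isUnit.map _).map _
  have hθ : ∀ i, ((openCoords g).θ i).restrictScalars ℤ h = d * twistCoeff g (-α) i * h := by
    intro i
    change openEuler g i h = _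
    rw [openEuler_monoFun, ← heK, twistCoeff]
    have h1 : ((-Fin.init e : Fin m → ℤ) i : TorusOpen g)
        = -algebraMap (RatFun N) _ (algebraMap ℂ (RatFun N) (d * α i.castSucc)) := by
      rw [heK]; push_cast [Pi.neg_apply, Fin.init]; rfl
    rw [h1]
    simp only [map_mul, map_natCast, Pi.neg_apply, map_neg]
    ring
  -- The same h serves the λ-directions, so multiplication by w is also compatible with the
  -- connections.
  have hδ : ∀ j, openDeriv g j h = d * twistFun g (-α) j * h := by
    intro j
    rw [openDeriv_monoFun, ← heK, twistFun]
    simp only [map_mul, map_natCast, Pi.neg_apply, map_neg, Algebra.smul_def]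
    ring
  have hsm : Algebra.Smooth (RatFun N) (RootCover d h) := smooth_rootCover g hh hd
  have het : Algebra.Etale (TorusOpen g) (RootCover d h) := etale_rootCover hh hd
  have hexΘ : ∀ i, ∃ Θ : Derivation ℤ (RootCover d h) (RootCover d h),
      Extends (((openCoords g).θ i).restrictScalars ℤ) Θ := fun i => exists_extends _
  choose Θ hΘ using hexΘ
  have hexΞ : ∀ j, ∃ Ξ : Derivation ℤ (RootCover d h) (RootCover d h),
      Extends (openDeriv g j) Ξ := fun j => exists_extends _
  choose Ξ hΞ using hexΞ
  have hΞK : ∀ j, Extends (partialDeriv j) (Ξ j) := by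
    intro j κ
    rw [IsScalarTower.algebraMap_apply (RatFun N) (TorusOpen g) (RootCover d h), hΞ,
      openDeriv_extends g j, ← IsScalarTower.algebraMap_apply]
  let E := coverCoords (openCoords g) hh hd Θ hΘ
  let cls : RootCover d h →ₗ[RatFun N] DeRham N (RootCover d h) m := E.topClass 0
  let clsS : TorusOpen g →ₗ[RatFun N] TorusCohomology g (-α) m :=
    (openCoords g).topClass (twistForm g (-α))
  have hmul : ∀ (δ : Derivation ℤ (TorusOpen g) (TorusOpen g))
      (Δ : Derivation ℤ (RootCover d h) (RootCover d h)), Extends δ Δ → ∀ c, δ h = d * c * h → ∀ s,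
      Δ (coverRoot d h * algebraMap _ _ s) = coverRoot d h * algebraMap _ _ (δ s + c * s) := by
    intro δ Δ hΔ c hc s
    rw [Derivation.leibniz, hΔ, derivation_coverRoot hh hd hΔ hc, map_add, map_mul, smul_eq_mul,
      smul_eq_mul]
    ring
  let F : TorusOpen g →ₗ[RatFun N] DeRham N (RootCover d h) m := cls ∘ₗ
    LinearMap.mulLeft (RatFun N) (coverRoot d h) ∘ₗ (Algebra.linearMap _ _).restrictScalars _
  have hF : ∀ s, F s = cls (coverRoot d h * algebraMap _ _ s) := fun s => rfl
  have hcls : ∀ b, cls b = 0 ↔ b ∈ sumRange (E.op 0) ⊤ := fun b =>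
    E.topClass_eq_zero (by simp)
  have hclsS : ∀ s, clsS s = 0 ↔ s ∈ sumRange ((openCoords g).op (twistCoeff g (-α))) ⊤ := fun s =>
    (openCoords g).topClass_eq_zero (twistForm_eq g (-α))
  have hop : ∀ i b, E.op 0 i b = Θ i b := by
    intro i b
    rw [EtaleCoords.op_apply, Pi.zero_apply, zero_mul, add_zero]
    rfl
  -- Relations are carried to the covering by multiplication with w, and back by `coverProj`. This
  -- gives both well-definedness and injectivity of the comparison map.
  have hker : ∀ s, clsS s = 0 ↔ F s = 0 := by
    intro s
    rw [hclsS, hF, hcls]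
    constructor
    · rintro ⟨w, -, rfl⟩
      refine ⟨fun i => coverRoot d h * algebraMap _ _ (w i), fun _ => trivial, ?_⟩
      rw [map_sum, Finset.mul_sum]
      refine Finset.sum_congr rfl fun i _ => ?_
      rw [hop, hmul _ _ (hΘ i) _ (hθ i)]
      rfl
    · rintro ⟨w, -, hw⟩
      refine ⟨fun i => coverProj d h hi (w i), fun _ => trivial, ?_⟩
      rw [← coverProj_root_mul_algebraMap (d := d) hh s, hw, map_sum]
      refine Finset.sum_congr rfl fun i _ => ?_
      rw [hop, coverProj_derivation hh hd (hΘ i) (hθ i)]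
      rfl
  have hsurj : Function.Surjective clsS := (openCoords g).topClass_surjective (twistForm g (-α))
  let Φ₀ : TorusCohomology g (-α) m →+ DeRham N (RootCover d h) m :=
    clsS.toAddMonoidHom.liftOfSurjective hsurj ⟨F.toAddMonoidHom, fun s hs => (hker s).1 hs⟩
  have hΦ₀ : ∀ s, Φ₀ (clsS s) = F s := fun s => AddMonoidHom.liftOfRightInverse_comp_apply _ _ _ _ s
  let Φ : TorusCohomology g (-α) m →ₗ[DiffOp N] DeRham N (RootCover d h) m := diffOpLinear Φ₀
    (fun κ z => by
      obtain ⟨s, rfl⟩ := hsurj z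
      rw [coeff_smul_torusCohomology, coeff_smul_deRham, ← map_smul clsS, hΦ₀, hΦ₀, map_smul])
    (fun j z => by
      obtain ⟨s, rfl⟩ := hsurj z
      have h1 : torusConnection g (-α) m j (clsS s)
          = clsS (openDeriv g j s + twistFun g (-α) j * s) :=
        (openCoords g).connection_topClass (openDeriv_extends g j) (fun i => by
          change openDeriv g j (toOpen g (lvar i)) = 0
          rw [openDeriv_toOpen, coeffwise_lvar, map_zero]) (lieDeriv_twistForm g (-α) j) s
      have h2 : ∀ b, deRhamConnection N (RootCover d h) m j (cls b) = cls (Ξ j b) := fun b =>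
        E.gaussManin_topClass (hΞK j) (fun i => by
          change Ξ j (algebraMap _ _ (toOpen g (lvar i))) = 0
          rw [hΞ, openDeriv_toOpen, coeffwise_lvar, map_zero, map_zero]) b
      rw [del_smul_torusCohomology, del_smul_deRham, h1, hΦ₀, hΦ₀, hF, hF, h2,
        hmul _ _ (hΞ j) _ (hδ j)])
  have hΦ : ∀ s, Φ (clsS s) = cls (coverRoot d h * algebraMap _ _ s) := hΦ₀
  refine ⟨RootCover d h, inferInstance, inferInstance, hsm, rootsOfUnity d ℂ, inferInstance,
    inferInstance, coverAction, ℂ, inferInstance, inferInstance, tautological d,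
    tautological_isIrreducible d, m, Φ, ?_, fun z => ?_⟩
  · rw [injective_iff_map_eq_zero]
    intro z hz
    obtain ⟨s, rfl⟩ := hsurj z
    exact (hker s).2 ((hΦ s).symm.trans hz)
  · rw [mem_deRhamIsotypic_cover hh E fun ζ i => coverAction_algebraMap ζ _]
    constructor
    · rintro ⟨s, rfl⟩
      exact ⟨clsS s, hΦ s⟩
    · rintro ⟨x, rfl⟩
      obtain ⟨s, rfl⟩ := hsurj x
      exact ⟨s, (hΦ s).symm⟩

theorem ComesFromGeometry.of_equiv {M M' : Type} [AddCommGroup M] [AddCommGroup M']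
    [Module (DiffOp N) M] [Module (DiffOp N) M'] (e : M ≃ₗ[DiffOp N] M')
    (h : ComesFromGeometry N M') : ComesFromGeometry N M := by
  obtain ⟨B, i1, i2, i3, G, i4, i5, act, V, i6, i7, χ, hχ, k, φ, hφ, him⟩ := h
  refine ⟨B, i1, i2, i3, G, i4, i5, act, V, i6, i7, χ, hχ, k, φ ∘ₗ e.toLinearMap,
    hφ.comp e.injective, fun z => (him z).trans ⟨?_, ?_⟩⟩
  · rintro ⟨x, rfl⟩
    exact ⟨e.symm x, congrArg φ (e.apply_symm_apply x)⟩
  · rintro ⟨x, rfl⟩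
    exact ⟨e x, rfl⟩

end Rational

end AHyp

end

theorem corollary4p5 (N m : ℕ) (a : Fin N → Fin (m + 1) → ℤ)
    (ha : AddSubgroup.closure (Set.range a) = ⊤)
    (g : Laurent N m) (hfg : hypPoly a = lvar (Fin.last m) * addVariable g)
    (α : Fin (m + 1) → ℂ) (hα : Nonresonant a α) :
    Nonempty (HypergeometricModule a α ≃ₗ[DiffOp N] TorusCohomology g (-α) m) ∧
      ((∃ q : Fin (m + 1) → ℚ, ∀ i, α i = (q i : ℂ)) →
        ComesFromGeometry N (HypergeometricModule a α)) := by
  obtain ⟨e⟩ := nonempty_equiv_torusCohomology ha hfg hα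
  refine ⟨⟨e⟩, fun hq => ?_⟩
  have := nontrivial_torusOpen ha hfg
  exact (comesFromGeometry_torusCohomology hq).of_equiv e
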